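/- Let $k\in\mathbb N$ and let $x_1,\dots,x_k$ be $\mathbb N$-valued program variables. A \emph{PGF} is a formal power series $g=\sum_{\sigma\in\mathbb N^k}g(\sigma)\mathbf X^\sigma\in\mathbb R[[X_1,\dots,X_k]]$ with $g(\sigma)\ge 0$ for all $\sigma$ and $\sum_\sigma g(\sigma)\le 1$; $\mathrm{PGF}$ denotes the set of these, ordered coefficientwise, and $g[X/h]$ denotes substitution of $h$ for $X$ in $g$. A \emph{distribution expression} $D$ is a pair of polynomials $p,q\in\mathbb Q[T]$ with $q(0)\neq 0$ such that $[\![D]\!]:=p\,q^{-1}\in\mathbb R[[T]]$ is a PGF. A \emph{guard} is a Boolean combination of conditions $x<n$ ($x$ a variable, $n\in\mathbb N$); for a PGF $g$ and a guard $\varphi$ let $g_\varphi$ be the sum of the terms $g(\sigma)\mathbf X^\sigma$ with $\sigma\models\varphi$. \emph{ReDiP programs} are given by $$P::= x:=n\;\mid\; x\text{-}\text{-}\;\mid\; x\mathrel{+}=\mathtt{iid}(D,y)\;\mid\;\mathtt{if}(\varphi)\{P\}\,\mathtt{else}\,\{P\}\;\mid\; P;P\;\mid\;\mathtt{while}(\varphi)\{P\},$$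 where $x,y$ are (possibly equal) variables, and the transformer $[\![P]\!]:\mathrm{PGF}\to\mathrm{PGF}$ is defined by \begin{itemize} \item $[\![x:=n]\!](g)=g[X/1]\,X^n$; \item $[\![x\text{-}\text{-}]\!](g)=(g-g[X/0])X^{-1}+g[X/0]$; \item $[\![x\mathrel{+}=\mathtt{iid}(D,y)]\!](g)=g\big[Y/\,Y\cdot[\![D]\!][T/X]\big]$; \item $[\![\mathtt{if}(\varphi)\{P_1\}\,\mathtt{else}\,\{P_2\}]\!](g)=[\![P_1]\!](g_\varphi)+[\![P_2]\!](g-g_\varphi)$; \item $[\![P_1;P_2]\!](g)=[\![P_2]\!]([\![P_1]\!](g))$; \item $[\![\mathtt{while}(\varphi)\{P\}]\!]$ is the least (in the pointwise order) $\psi:\mathrm{PGF}\to\mathrm{PGF}$ with $\psi(f)=(f-f_\varphi)+\psi([\![P]\!](f_\varphi))$ for all $f$. \end{itemize} A program is \emph{loop-free} if it contains no $\mathtt{while}$, and \emph{universally almost-surely terminating (UAST)} if $[\![P]\!](g)$ and $g$ have the same coefficient sum for every PGF $g$. \textbf{Theorem.} It is decidable, given $k$, a loop $L=\mathtt{while}(\varphi)\{P\}$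 that is UAST and has a loop-free body $P$, and a loop-free program $I$ over $x_1,\dots,x_k$, whether $[\![L]\!]=[\![I]\!]$. That is, there is a single total computable function that takes $k$ and (encodings of the syntax of) $L$ and $I$ and, whenever $P$ and $I$ are loop-free and $L$ is UAST, returns true if and only if $[\![L]\!](g)=[\![I]\!](g)$ for all $g\in\mathrm{PGF}$. -/

import Mathlib

/-! ### Probability generating functions

Formal power series in the indeterminates `ι` are Mathlib's `MvPowerSeries ι ℝ`, i.e. arrays
`(ι →₀ ℕ) → ℝ`.  For `ι = Fin k`, an exponent vector `σ : Fin k →₀ ℕ` is a program state. -/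

/-- Nonnegative coefficients with a (convergent) sum that is at most `1`. -/
def IsPGF {ι : Type} (g : MvPowerSeries ι ℝ) : Prop :=
  (∀ σ, 0 ≤ MvPowerSeries.coeff σ g) ∧
    Summable (fun σ => MvPowerSeries.coeff σ g) ∧ ∑' σ, MvPowerSeries.coeff σ g ≤ 1

theorem hasSum_mulCoeff {ι : Type} {f g : MvPowerSeries ι ℝ}
    (hf : ∀ σ, 0 ≤ MvPowerSeries.coeff σ f) (hf' : Summable fun σ => MvPowerSeries.coeff σ f)
    (hg : ∀ σ, 0 ≤ MvPowerSeries.coeff σ g) (hg' : Summable fun σ => MvPowerSeries.coeff σ g) :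
    HasSum (fun σ => MvPowerSeries.coeff σ (f * g))
      ((∑' σ, MvPowerSeries.coeff σ f) * ∑' σ, MvPowerSeries.coeff σ g) := by
  classical
  have h := hf'.mul_of_nonneg hg' hf hg
  have h2 := summable_sum_mul_antidiagonal_of_summable_mul h
  rw [hf'.tsum_mul_tsum_eq_tsum_sum_antidiagonal hg' h]
  simp only [MvPowerSeries.coeff_mul]
  exact h2.hasSum

/-- The PGF, as a submonoid of the multiplicative monoid of formal power series. -/
def pgfSubmonoid (ι : Type) : Submonoid (MvPowerSeries ι ℝ) where
  carrier := {g | IsPGF g}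
  one_mem' := by
    classical
    have h : HasSum (fun σ => MvPowerSeries.coeff σ (1 : MvPowerSeries ι ℝ)) 1 := by
      simpa only [MvPowerSeries.coeff_one] using hasSum_ite_eq (0 : ι →₀ ℕ) (1 : ℝ)
    refine ⟨fun σ => ?_, h.summable, h.tsum_eq.le⟩
    rw [MvPowerSeries.coeff_one]
    split_ifs <;> norm_num
  mul_mem' := by
    classical
    rintro f g ⟨hf, hf', hf1⟩ ⟨hg, hg', hg1⟩
    have h := hasSum_mulCoeff hf hf' hg hg'
    refine ⟨fun σ => ?_, h.summable, ?_⟩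
    · rw [MvPowerSeries.coeff_mul]
      exact Finset.sum_nonneg fun p _ => mul_nonneg (hf _) (hg _)
    · rw [h.tsum_eq]
      exact mul_le_one₀ hf1 (tsum_nonneg hg) hg1

/-- The set of PGF (sub-probability ones included) in the indeterminates `ι`. -/
abbrev PGF (ι : Type) : Type := pgfSubmonoid ι

namespace PGF

variable {ι κ : Type}

/-- The coefficient (probability) of the state `σ`. -/
noncomputable def coeff (g : PGF ι) (σ : ι →₀ ℕ) : ℝ := MvPowerSeries.coeff σ g.1

/-- The total probability mass, i.e. the value `g[𝐗/𝟏]`. -/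
noncomputable def mass (g : PGF ι) : ℝ := ∑' σ, g.coeff σ

/-- The PGF with a given array of coefficients. -/
def ofFun (f : (ι →₀ ℕ) → ℝ) (h0 : ∀ σ, 0 ≤ f σ) (h : Summable f) (h1 : ∑' σ, f σ ≤ 1) : PGF ι :=
  ⟨f, h0, h, h1⟩

theorem coeff_nonneg (g : PGF ι) (σ : ι →₀ ℕ) : 0 ≤ g.coeff σ := g.2.1 σ

theorem summable_coeff (g : PGF ι) : Summable g.coeff := g.2.2.1

theorem mass_le_one (g : PGF ι) : g.mass ≤ 1 := g.2.2.2

theorem coeff_ofFun (f : (ι →₀ ℕ) → ℝ) (h0 h h1) (σ : ι →₀ ℕ) :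
    (ofFun f h0 h h1).coeff σ = f σ := rfl

@[ext] theorem ext {f g : PGF ι} (h : ∀ σ, f.coeff σ = g.coeff σ) : f = g :=
  Subtype.ext (MvPowerSeries.ext h)

/-- The pointwise order on PGF. -/
instance : PartialOrder (PGF ι) where
  le f g := ∀ σ, f.coeff σ ≤ g.coeff σ
  le_refl _ _ := le_rfl
  le_trans _ _ _ h h' σ := (h σ).trans (h' σ)
  le_antisymm _ _ h h' := ext fun σ => le_antisymm (h σ) (h' σ)

/-- The zero series. -/
instance : Zero (PGF ι) := ⟨⟨0, by simp [pgfSubmonoid, IsPGF]⟩⟩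

theorem coeff_zero (σ : ι →₀ ℕ) : (0 : PGF ι).coeff σ = 0 := rfl

theorem mass_zero : (0 : PGF ι).mass = 0 := by simp [mass, coeff_zero]

theorem mass_nonneg (g : PGF ι) : 0 ≤ g.mass := tsum_nonneg g.coeff_nonneg

theorem mass_mul (f g : PGF ι) : (f * g).mass = f.mass * g.mass :=
  (hasSum_mulCoeff f.2.1 f.2.2.1 g.2.1 g.2.2.1).tsum_eq

/-- The monomial `𝐗^σ`. -/
noncomputable def monomial (σ : ι →₀ ℕ) : PGF ι :=
  ⟨MvPowerSeries.monomial σ 1, by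
    classical
    have h : HasSum (fun τ => MvPowerSeries.coeff τ (MvPowerSeries.monomial σ (1 : ℝ))) 1 := by
      simpa only [MvPowerSeries.coeff_monomial] using hasSum_ite_eq σ (1 : ℝ)
    refine ⟨fun τ => ?_, h.summable, h.tsum_eq.le⟩
    rw [MvPowerSeries.coeff_monomial]
    split_ifs <;> norm_num⟩

/-- The indeterminate `X_i`. -/
noncomputable def X (i : ι) : PGF ι := monomial (Finsupp.single i 1)

/-- Sum of two PGF whose joint mass does not exceed `1`. -/
noncomputable def add (f g : PGF ι) (h : f.mass + g.mass ≤ 1) : PGF ι :=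
  ofFun (fun σ => f.coeff σ + g.coeff σ)
    (fun σ => add_nonneg (f.coeff_nonneg σ) (g.coeff_nonneg σ))
    (f.summable_coeff.add g.summable_coeff)
    (by rw [f.summable_coeff.tsum_add g.summable_coeff]; exact h)

theorem coeff_add (f g : PGF ι) (h) (σ : ι →₀ ℕ) :
    (add f g h).coeff σ = f.coeff σ + g.coeff σ := rfl

theorem mass_add (f g : PGF ι) (h) : (add f g h).mass = f.mass + g.mass :=
  f.summable_coeff.tsum_add g.summable_coeff

theorem summable_family (g : PGF ι) (K : (ι →₀ ℕ) → PGF κ) :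
    Summable fun p : (ι →₀ ℕ) × (κ →₀ ℕ) => g.coeff p.1 * (K p.1).coeff p.2 := by
  refine (summable_prod_of_nonneg
    (fun p => mul_nonneg (g.coeff_nonneg _) ((K p.1).coeff_nonneg _))).2
    ⟨fun σ => (K σ).summable_coeff.mul_left (g.coeff σ), ?_⟩
  have h : ∀ σ, ∑' τ, g.coeff σ * (K σ).coeff τ = g.coeff σ * (K σ).mass :=
    fun σ => tsum_mul_left
  simp only [h]
  exact g.summable_coeff.of_nonneg_of_le
    (fun σ => mul_nonneg (g.coeff_nonneg _) (K σ).mass_nonneg)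
    (fun σ => mul_le_of_le_one_right (g.coeff_nonneg _) (K σ).mass_le_one)

theorem hasSum_family (g : PGF ι) (K : (ι →₀ ℕ) → PGF κ) :
    HasSum (fun τ => ∑' σ, g.coeff σ * (K σ).coeff τ) (∑' σ, g.coeff σ * (K σ).mass) := by
  have h := g.summable_family K
  have h2 : Summable fun τ => ∑' σ, g.coeff σ * (K σ).coeff τ := h.prod_symm.prod
  have h3 : ∑' τ, ∑' σ, g.coeff σ * (K σ).coeff τ = ∑' σ, ∑' τ, g.coeff σ * (K σ).coeff τ :=
    Summable.tsum_comm h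
  have h4 : ∑' σ, g.coeff σ * (K σ).mass = ∑' σ, ∑' τ, g.coeff σ * (K σ).coeff τ :=
    tsum_congr fun σ => tsum_mul_left.symm
  rw [h4, ← h3]
  exact h2.hasSum

theorem tsum_family_le (g : PGF ι) (K : (ι →₀ ℕ) → PGF κ) :
    ∑' σ, g.coeff σ * (K σ).mass ≤ g.mass :=
  Summable.tsum_le_tsum (fun σ => mul_le_of_le_one_right (g.coeff_nonneg _) (K σ).mass_le_one)
    (g.summable_coeff.of_nonneg_of_le
      (fun σ => mul_nonneg (g.coeff_nonneg _) (K σ).mass_nonneg)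
      (fun σ => mul_le_of_le_one_right (g.coeff_nonneg _) (K σ).mass_le_one))
    g.summable_coeff

/-- The simultaneous substitution of the PGF `h i` for every indeterminate `X_i` in `g`:
the series `∑_σ g(σ) ∏_i (h i)^(σ i)` (with `h^0 = 1`). -/
noncomputable def subst (g : PGF ι) (h : ι → PGF κ) : PGF κ :=
  ofFun (fun τ => ∑' σ, g.coeff σ * (σ.prod fun i n => h i ^ n).coeff τ)
    (fun _ => tsum_nonneg fun _ => mul_nonneg (g.coeff_nonneg _) (coeff_nonneg _ _))
    (g.hasSum_family fun σ => σ.prod fun i n => h i ^ n).summable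
    ((g.hasSum_family fun σ => σ.prod fun i n => h i ^ n).tsum_eq.le.trans
      ((g.tsum_family_le _).trans g.mass_le_one))

theorem mass_subst_le (g : PGF ι) (h : ι → PGF κ) : (g.subst h).mass ≤ g.mass :=
  (g.hasSum_family fun σ => σ.prod fun i n => h i ^ n).tsum_eq.le.trans (g.tsum_family_le _)

/-- The substitution `g[X_i/h]` for a single indeterminate. -/
noncomputable def subst₁ [DecidableEq ι] (g : PGF ι) (i : ι) (h : PGF ι) : PGF ι :=
  g.subst (Function.update X i h)

/-- The part of `g` on the states that satisfy `p`. -/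
noncomputable def restrict (g : PGF ι) (p : (ι →₀ ℕ) → Bool) : PGF ι :=
  ofFun (fun σ => if p σ then g.coeff σ else 0)
    (fun σ => by split_ifs; exacts [g.coeff_nonneg σ, le_rfl])
    (g.summable_coeff.of_nonneg_of_le
      (fun σ => by split_ifs; exacts [g.coeff_nonneg σ, le_rfl])
      (fun σ => by split_ifs; exacts [le_rfl, g.coeff_nonneg σ]))
    ((Summable.tsum_le_tsum (fun σ => by split_ifs; exacts [le_rfl, g.coeff_nonneg σ])
      (g.summable_coeff.of_nonneg_of_le
        (fun σ => by split_ifs; exacts [g.coeff_nonneg σ, le_rfl])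
        (fun σ => by split_ifs; exacts [le_rfl, g.coeff_nonneg σ]))
      g.summable_coeff).trans g.mass_le_one)

theorem coeff_restrict (g : PGF ι) (p : (ι →₀ ℕ) → Bool) (σ : ι →₀ ℕ) :
    (g.restrict p).coeff σ = if p σ then g.coeff σ else 0 := rfl

theorem mass_restrict_add (g : PGF ι) (p : (ι →₀ ℕ) → Bool) :
    (g.restrict p).mass + (g.restrict fun σ => !p σ).mass = g.mass := by
  unfold mass
  rw [← (g.restrict p).summable_coeff.tsum_add (g.restrict _).summable_coeff]
  refine tsum_congr fun σ => ?_
  simp only [coeff_restrict]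
  cases p σ <;> simp

/-- `g` shifted to the left in dimension `X_i`; this is `g X_i⁻¹` if `g[X_i/0] = 0`. -/
noncomputable def leftShift (i : ι) (g : MvPowerSeries ι ℝ) : MvPowerSeries ι ℝ :=
  fun σ => MvPowerSeries.coeff (σ + Finsupp.single i 1) g

theorem coeff_prod_update_zero [DecidableEq ι] (i : ι) (σ τ : ι →₀ ℕ) :
    (σ.prod fun j n => (Function.update X i (0 : PGF ι) j) ^ n).coeff τ
      = if σ i = 0 ∧ τ = σ then 1 else 0 := by
  have h : ((σ.prod fun j n => (Function.update X i (0 : PGF ι) j) ^ n : PGF ι) :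
      MvPowerSeries ι ℝ) = ∏ j ∈ σ.support, ((Function.update X i (0 : PGF ι) j).1) ^ σ j := by
    simp [Finsupp.prod]
  rw [coeff, h]
  by_cases hi : σ i = 0
  · have h2 : ∏ j ∈ σ.support, ((Function.update X i (0 : PGF ι) j).1) ^ σ j
        = MvPowerSeries.monomial σ (1 : ℝ) := by
      conv_rhs => rw [← MvPolynomial.coe_monomial, MvPolynomial.monomial_eq]
      rw [MvPolynomial.C_1, one_mul, Finsupp.prod, ← MvPolynomial.coeToMvPowerSeries.ringHom_apply,
        map_prod]
      refine Finset.prod_congr rfl fun j hj => ?_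
      have hji : j ≠ i := by rintro rfl; simp_all
      rw [Function.update_of_ne hji, map_pow, MvPolynomial.coeToMvPowerSeries.ringHom_apply,
        MvPolynomial.coe_X]
      rfl
    rw [h2, MvPowerSeries.coeff_monomial]
    simp [hi]
  · rw [Finset.prod_eq_zero (i := i) (by simpa using hi)]
    · simp [hi]
    · rw [Function.update_self]
      exact zero_pow hi

theorem coeff_subst_zero [DecidableEq ι] (g : PGF ι) (i : ι) (τ : ι →₀ ℕ) :
    (g.subst₁ i 0).coeff τ = if τ i = 0 then g.coeff τ else 0 := by
  change ∑' σ, g.coeff σ * (σ.prod fun j n => (Function.update X i (0 : PGF ι) j) ^ n).coeff τ = _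
  rw [tsum_eq_single τ]
  · rw [coeff_prod_update_zero]; split_ifs <;> simp_all
  · intro σ hσ
    rw [coeff_prod_update_zero, if_neg (fun h => hσ h.2.symm), mul_zero]

theorem coeff_decr_aux [DecidableEq ι] (g : PGF ι) (i : ι) (σ : ι →₀ ℕ) :
    MvPowerSeries.coeff σ (leftShift i (g.1 - (g.subst₁ i 0).1) + (g.subst₁ i 0).1)
      = g.coeff (σ + Finsupp.single i 1) + if σ i = 0 then g.coeff σ else 0 := by
  rw [map_add]
  change MvPowerSeries.coeff (σ + Finsupp.single i 1) (g.1 - (g.subst₁ i 0).1)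
    + (g.subst₁ i 0).coeff σ = _
  rw [map_sub]
  change g.coeff (σ + Finsupp.single i 1) - (g.subst₁ i 0).coeff (σ + Finsupp.single i 1) + _ = _
  rw [coeff_subst_zero, coeff_subst_zero, if_neg (by simp), sub_zero]

theorem hasSum_decr [DecidableEq ι] (g : PGF ι) (i : ι) :
    HasSum (fun σ => MvPowerSeries.coeff σ
      (leftShift i (g.1 - (g.subst₁ i 0).1) + (g.subst₁ i 0).1)) g.mass := by
  simp only [coeff_decr_aux]
  have hinj : Function.Injective fun σ : ι →₀ ℕ => σ + Finsupp.single i 1 :=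
    add_left_injective _
  have h1 : HasSum (fun σ => g.coeff (σ + Finsupp.single i 1))
      (g.restrict fun σ => !decide (σ i = 0)).mass := by
    have h := (g.restrict fun σ => !decide (σ i = 0)).summable_coeff.hasSum
    rw [← hinj.hasSum_iff] at h
    · convert h using 1
      · funext σ
        simp [coeff_restrict]
      · rfl
    · intro σ hσ
      rw [coeff_restrict, if_neg]
      intro h0
      refine hσ ⟨σ - Finsupp.single i 1, ?_⟩
      refine tsub_add_cancel_of_le ?_
      rw [Finsupp.single_le_iff]
      simp at h0
      lia
  have h2 : HasSum (fun σ => if σ i = 0 then g.coeff σ else 0)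
      (g.restrict fun σ => decide (σ i = 0)).mass := by
    convert (g.restrict fun σ => decide (σ i = 0)).summable_coeff.hasSum using 1
    · funext σ
      simp [coeff_restrict]
    · rfl
  have h := h1.add h2
  rwa [add_comm (mass _), mass_restrict_add] at h

/-- `(g - g[X_i/0]) X_i⁻¹ + g[X_i/0]`. -/
noncomputable def decr [DecidableEq ι] (g : PGF ι) (i : ι) : PGF ι :=
  ⟨leftShift i (g.1 - (g.subst₁ i 0).1) + (g.subst₁ i 0).1, by
    refine ⟨fun σ => ?_, (g.hasSum_decr i).summable,
      (g.hasSum_decr i).tsum_eq.le.trans g.mass_le_one⟩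
    rw [coeff_decr_aux]
    have h := g.coeff_nonneg
    split_ifs
    · exact add_nonneg (h _) (h _)
    · exact add_nonneg (h _) le_rfl⟩

theorem mass_decr [DecidableEq ι] (g : PGF ι) (i : ι) : (g.decr i).mass = g.mass :=
  (g.hasSum_decr i).tsum_eq

end PGF

/-! ### Syntax -/

/-- The polynomial with the given list of coefficients (constant coefficient first), as a power
series. -/
noncomputable def listSeries (l : List ℚ) : PowerSeries ℚ := PowerSeries.mk fun n => l.getD n 0

/-- A distribution expression: a rational closed form `num / den` of a univariate PGF, where
`num` and `den` are polynomials over `ℚ`, given by their lists of coefficients, and `den` is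
invertible as a power series. -/
structure DistExpr where
  num : List ℚ
  den : List ℚ
  den_ne : PowerSeries.constantCoeff (listSeries den) ≠ 0
  isPGF : IsPGF (ι := Unit)
    (PowerSeries.map (algebraMap ℚ ℝ) (listSeries num * (listSeries den)⁻¹))

/-- The PGF, in the placeholder indeterminate `T = X ()`, of a distribution expression. -/
noncomputable def DistExpr.sem (D : DistExpr) : PGF Unit := ⟨_, D.isPGF⟩

/-- Rectangular guards `x < n` over the program variables `x_0, …, x_(k-1)`, and their Boolean
combinations. -/
inductive Guard (k : ℕ) : Type
  | lt (x : Fin k) (n : ℕ)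
  | neg (φ : Guard k)
  | and (φ ψ : Guard k)
  | or (φ ψ : Guard k)

/-- The truth value of a guard in a program state. -/
def Guard.eval {k : ℕ} : Guard k → (Fin k →₀ ℕ) → Bool
  | .lt x n, σ => decide (σ x < n)
  | .neg φ, σ => !φ.eval σ
  | .and φ ψ, σ => φ.eval σ && ψ.eval σ
  | .or φ ψ, σ => φ.eval σ || ψ.eval σ

/-- ReDiP programs over the program variables `x_0, …, x_(k-1)`. -/
inductive Prog (k : ℕ) : Type
  /-- `x := n` -/
  | assign (x : Fin k) (n : ℕ)
  /-- `x--` -/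
  | decr (x : Fin k)
  /-- `x += iid(D, y)` -/
  | iid (x : Fin k) (D : DistExpr) (y : Fin k)
  /-- `if (φ) {P} else {Q}` -/
  | ite (φ : Guard k) (P Q : Prog k)
  /-- `P; Q` -/
  | seq (P Q : Prog k)
  /-- `while (φ) {P}` -/
  | loop (φ : Guard k) (P : Prog k)

/-- The program contains no `while` loop. -/
def Prog.LoopFree {k : ℕ} : Prog k → Prop
  | .assign _ _ => True
  | .decr _ => True
  | .iid _ _ _ => True
  | .ite _ P Q => P.LoopFree ∧ Q.LoopFree
  | .seq P Q => P.LoopFree ∧ Q.LoopFree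
  | .loop _ _ => False

/-! ### Semantics -/

/-- PGF transformers `PGF → PGF` that do not create probability mass. -/
structure Transformer (k : ℕ) where
  toFun : PGF (Fin k) → PGF (Fin k)
  mass_le : ∀ g, (toFun g).mass ≤ g.mass

namespace Transformer

variable {k : ℕ}

/-- The functional `ψ ↦ λ f. (f - f_φ) + ψ(⟦P⟧(f_φ))` of a loop, where `S = ⟦P⟧`. -/
noncomputable def charFun (φ : Guard k) (S ψ : Transformer k) : Transformer k where
  toFun f := PGF.add (f.restrict φ.neg.eval) (ψ.toFun (S.toFun (f.restrict φ.eval))) (by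
    have h := (ψ.mass_le (S.toFun (f.restrict φ.eval))).trans (S.mass_le _)
    have h2 := f.mass_restrict_add φ.eval
    have h3 := f.mass_le_one
    change (f.restrict fun σ => !φ.eval σ).mass + _ ≤ 1
    linarith)
  mass_le f := by
    have h := (ψ.mass_le (S.toFun (f.restrict φ.eval))).trans (S.mass_le _)
    have h2 := f.mass_restrict_add φ.eval
    rw [PGF.mass_add]
    change (f.restrict fun σ => !φ.eval σ).mass + _ ≤ _
    linarith

/-- The transformer that maps everything to `0`, the least one in the pointwise order. -/
def bot : Transformer k := ⟨fun _ => 0, fun g => PGF.mass_zero.le.trans g.mass_nonneg⟩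

/-- The Kleene iterates of the functional of a loop. -/
noncomputable def iter (φ : Guard k) (S : Transformer k) (n : ℕ) : Transformer k :=
  (charFun φ S)^[n] bot

theorem iter_succ (φ : Guard k) (S : Transformer k) (n : ℕ) (f : PGF (Fin k))
    (σ : Fin k →₀ ℕ) :
    ((iter φ S (n + 1)).toFun f).coeff σ = (f.restrict φ.neg.eval).coeff σ
      + ((iter φ S n).toFun (S.toFun (f.restrict φ.eval))).coeff σ := by
  rw [iter, Function.iterate_succ_apply']; rfl

theorem iter_mono (φ : Guard k) (S : Transformer k) (f : PGF (Fin k)) (σ : Fin k →₀ ℕ) :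
    Monotone fun n => ((iter φ S n).toFun f).coeff σ := by
  refine monotone_nat_of_le_succ fun n => ?_
  induction n generalizing f σ with
  | zero => exact PGF.coeff_nonneg _ _
  | succ n ih =>
    rw [iter_succ, iter_succ]
    exact add_le_add le_rfl (ih _ _)

theorem iter_sum_le (φ : Guard k) (S : Transformer k) (f : PGF (Fin k)) (n : ℕ)
    (s : Finset (Fin k →₀ ℕ)) : ∑ σ ∈ s, ((iter φ S n).toFun f).coeff σ ≤ f.mass :=
  ((PGF.summable_coeff _).sum_le_tsum s fun _ _ => PGF.coeff_nonneg _ _).trans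
    ((iter φ S n).mass_le f)

theorem iter_bddAbove (φ : Guard k) (S : Transformer k) (f : PGF (Fin k)) (σ : Fin k →₀ ℕ) :
    BddAbove (Set.range fun n => ((iter φ S n).toFun f).coeff σ) := by
  refine ⟨f.mass, ?_⟩
  rintro _ ⟨n, rfl⟩
  simpa using iter_sum_le φ S f n {σ}

theorem iter_tendsto (φ : Guard k) (S : Transformer k) (f : PGF (Fin k)) (σ : Fin k →₀ ℕ) :
    Filter.Tendsto (fun n => ((iter φ S n).toFun f).coeff σ) Filter.atTop
      (nhds (⨆ n, ((iter φ S n).toFun f).coeff σ)) :=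
  tendsto_atTop_ciSup (iter_mono φ S f σ) (iter_bddAbove φ S f σ)

theorem iSup_nonneg (φ : Guard k) (S : Transformer k) (f : PGF (Fin k)) (σ : Fin k →₀ ℕ) :
    0 ≤ ⨆ n, ((iter φ S n).toFun f).coeff σ :=
  Real.iSup_nonneg fun _ => PGF.coeff_nonneg _ _

theorem iSup_sum_le (φ : Guard k) (S : Transformer k) (f : PGF (Fin k))
    (s : Finset (Fin k →₀ ℕ)) : ∑ σ ∈ s, ⨆ n, ((iter φ S n).toFun f).coeff σ ≤ f.mass :=
  le_of_tendsto (tendsto_finsetSum s fun σ _ => iter_tendsto φ S f σ)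
    (Filter.Eventually.of_forall fun n => iter_sum_le φ S f n s)

theorem iSup_summable (φ : Guard k) (S : Transformer k) (f : PGF (Fin k)) :
    Summable fun σ => ⨆ n, ((iter φ S n).toFun f).coeff σ :=
  summable_of_sum_le (iSup_nonneg φ S f) (iSup_sum_le φ S f)

theorem iSup_tsum_le (φ : Guard k) (S : Transformer k) (f : PGF (Fin k)) :
    ∑' σ, ⨆ n, ((iter φ S n).toFun f).coeff σ ≤ f.mass :=
  (iSup_summable φ S f).tsum_le_of_sum_le (iSup_sum_le φ S f)

/-- The least fixed point of the functional of a loop, as the supremum of the Kleene iterates;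
see `lfp_isLeast`. -/
noncomputable def lfp (φ : Guard k) (S : Transformer k) : Transformer k where
  toFun f := PGF.ofFun (fun σ => ⨆ n, ((iter φ S n).toFun f).coeff σ)
    (iSup_nonneg φ S f) (iSup_summable φ S f) ((iSup_tsum_le φ S f).trans f.mass_le_one)
  mass_le f := iSup_tsum_le φ S f

/-- `lfp φ S` is the least among all functions `ψ : PGF → PGF` with
`ψ(f) = (f - f_φ) + ψ(S(f_φ))` for all `f`, in the pointwise order. -/
theorem lfp_isLeast (φ : Guard k) (S : Transformer k) :
    IsLeast {ψ : PGF (Fin k) → PGF (Fin k) | ∀ f, (ψ f : MvPowerSeries (Fin k) ℝ) =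
      (f.1 - (f.restrict φ.eval).1) + (ψ (S.toFun (f.restrict φ.eval))).1}
      (lfp φ S).toFun := by
  have hneg : ∀ (f : PGF (Fin k)) (σ : Fin k →₀ ℕ), (f.restrict φ.neg.eval).coeff σ
      = f.coeff σ - (f.restrict φ.eval).coeff σ := by
    intro f σ
    simp only [PGF.coeff_restrict, Guard.eval]
    cases φ.eval σ <;> simp
  constructor
  · intro f
    refine MvPowerSeries.ext fun σ => ?_
    rw [map_add, map_sub]
    change (⨆ n, ((iter φ S n).toFun f).coeff σ) = (f.coeff σ - (f.restrict φ.eval).coeff σ)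
      + ⨆ n, ((iter φ S n).toFun (S.toFun (f.restrict φ.eval))).coeff σ
    rw [← hneg]
    refine tendsto_nhds_unique ((Filter.tendsto_add_atTop_iff_nat 1).2 (iter_tendsto φ S f σ)) ?_
    simp only [iter_succ]
    exact (iter_tendsto φ S _ σ).const_add _
  · intro ψ hψ f σ
    refine ciSup_le fun n => ?_
    induction n generalizing f σ with
    | zero => exact PGF.coeff_nonneg _ _
    | succ n ih =>
      have h := congrArg (MvPowerSeries.coeff σ) (hψ f)
      rw [map_add, map_sub] at h
      change (ψ f).coeff σ = (f.coeff σ - (f.restrict φ.eval).coeff σ)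
        + (ψ (S.toFun (f.restrict φ.eval))).coeff σ at h
      rw [h, iter_succ, hneg]
      exact add_le_add le_rfl (ih _ _)

end Transformer

/-- The transformer of a program, with the proof that it does not create mass. -/
noncomputable def Prog.transformer {k : ℕ} : Prog k → Transformer k
  | .assign x n =>
    { toFun := fun g => g.subst₁ x 1 * PGF.X x ^ n
      mass_le := fun _ => (PGF.mass_mul _ _).le.trans
        ((mul_le_of_le_one_right (PGF.mass_nonneg _) (PGF.mass_le_one _)).trans
          (PGF.mass_subst_le _ _)) }
  | .decr x =>
    { toFun := fun g => g.decr x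
      mass_le := fun g => (g.mass_decr x).le }
  | .iid x D y =>
    { toFun := fun g => g.subst₁ y (PGF.X y * D.sem.subst fun _ => PGF.X x)
      mass_le := fun _ => PGF.mass_subst_le _ _ }
  | .ite φ P Q =>
    { toFun := fun g => PGF.add (P.transformer.toFun (g.restrict φ.eval))
        (Q.transformer.toFun (g.restrict φ.neg.eval))
        ((add_le_add (P.transformer.mass_le _) (Q.transformer.mass_le _)).trans
          ((g.mass_restrict_add φ.eval).le.trans g.mass_le_one))
      mass_le := fun g => (PGF.mass_add _ _ _).le.trans
        ((add_le_add (P.transformer.mass_le _) (Q.transformer.mass_le _)).trans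
          (g.mass_restrict_add φ.eval).le) }
  | .seq P Q =>
    { toFun := fun g => Q.transformer.toFun (P.transformer.toFun g)
      mass_le := fun g => (Q.transformer.mass_le _).trans (P.transformer.mass_le g) }
  | .loop φ P => Transformer.lfp φ P.transformer

/-- The PGF transformer `⟦P⟧ : PGF → PGF`. -/
noncomputable def Prog.sem {k : ℕ} (P : Prog k) : PGF (Fin k) → PGF (Fin k) :=
  P.transformer.toFun

/-- Universal almost-sure termination: no probability mass is lost on any input PGF. -/
def Prog.UAST {k : ℕ} (P : Prog k) : Prop := ∀ g : PGF (Fin k), (P.sem g).mass = g.mass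

/-! ### Programs as inputs of algorithms: Gödel numbers of the syntax trees -/

/-- The code of a rational number `(a - b) / c`. -/
def ratCode (q : ℚ) : ℕ := Nat.pair q.num.toNat (Nat.pair (-q.num).toNat q.den)

/-- The code of the two coefficient lists of a distribution expression. -/
def DistExpr.code (D : DistExpr) : ℕ :=
  Nat.pair (Encodable.encode (D.num.map ratCode)) (Encodable.encode (D.den.map ratCode))

/-- The code of a guard. -/
def Guard.code {k : ℕ} : Guard k → ℕ
  | .lt x n => Nat.pair 0 (Nat.pair x n)
  | .neg φ => Nat.pair 1 φ.code
  | .and φ ψ => Nat.pair 2 (Nat.pair φ.code ψ.code)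
  | .or φ ψ => Nat.pair 3 (Nat.pair φ.code ψ.code)

/-- The code of a program. -/
def Prog.code {k : ℕ} : Prog k → ℕ
  | .assign x n => Nat.pair 0 (Nat.pair x n)
  | .decr x => Nat.pair 1 x
  | .iid x D y => Nat.pair 2 (Nat.pair x (Nat.pair D.code y))
  | .ite φ P Q => Nat.pair 3 (Nat.pair φ.code (Nat.pair P.code Q.code))
  | .seq P Q => Nat.pair 4 (Nat.pair P.code Q.code)
  | .loop φ P => Nat.pair 5 (Nat.pair φ.code P.code)

/-! The first step is Park induction. If `I` satisfies the fixed point equation of the loop, the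
least solution `L` lies below `I`; since `L` loses no mass and `I` creates none, they coincide
(`sem_loop_eq_iff`). Loop-free transformers are given by nonnegative kernels, so the equation only
has to hold on the monomials X^u (`HasKernel.eq_of_monomial`).

All these inputs are handled at once by applying the transformers to the product of the series 1/(1
- X_i U_i), where U_i remembers the initial value of x_i. An assignment would put 1 for X_i, which
is not a legitimate operation on formal power series. A ghost variable Z is put in its place, and Z
= 1 is taken only at the end, by summing over the exponents of Z (`Simulates.ghostOp`). The
resulting formal operators preserve rational series and enlarge degrees by a computable amount
(`Prog.linBound`). So the defect of the fixed point equation is a series F with M F = N, where M and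
N are polynomials of total degree at most a computable B and M has nonzero constant term. Its slices
are power series in Z, one for every exponent vector α of the other variables; what has to be
decided is whether all their coefficient sums d_α vanish.

Only the α of degree at most B matter (`RatBound.sum_slice_eq_zero`). Expand M F = N in the
variables other than Z and put Z = 1. Suppose that d vanishes up to degree B. Then the product of M
at Z = 1 with the series d is zero: in degrees up to B because d is zero there, in higher degrees
because N has no terms there. Power series over the reals form an integral domain, so d = 0 unless M
vanishes at Z = 1. In that case N vanishes there too, and Z - 1 can be cancelled from both; the
degree in Z of the constant slice of M drops, so this ends.

Each of the finitely many remaining slices is a univariate rational series of bounded degree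
(`RatBound.exists_slice_quotient`) with rational coefficients that can be computed exactly
(`qval_defectCoeff`). Its sum is tested through a Padé approximant a/b over ℚ with a(1) and b(1) not
both zero: the slice equals a/b, and its sum vanishes exactly if a(1) = 0 (`hasSum_zero_iff_pade`).
Such an approximant exists and is found by search. The coefficients come from pulling coefficient
functionals back through the program (`ev_runPaths`), a primitive recursive computation on codes. -/

set_option linter.unusedSectionVars false

/-! ### Rational power series with bounded degree -/

section Rational

variable {ι : Type}

/-- `F` is a quotient of polynomials of total degree at most `B`, the denominator being a unit. -/
def RatBound (B : ℕ) (F : MvPowerSeries ι ℝ) : Prop :=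
  ∃ M N : MvPolynomial ι ℝ, M.totalDegree ≤ B ∧ N.totalDegree ≤ B ∧
    MvPolynomial.constantCoeff M ≠ 0 ∧ (M : MvPowerSeries ι ℝ) * F = N

theorem RatBound.mono {B C : ℕ} {F : MvPowerSeries ι ℝ} (h : RatBound B F) (hBC : B ≤ C) :
    RatBound C F := by
  obtain ⟨M, N, h1, h2, h3, h4⟩ := h
  exact ⟨M, N, h1.trans hBC, h2.trans hBC, h3, h4⟩

theorem RatBound.zero : RatBound 0 (0 : MvPowerSeries ι ℝ) :=
  ⟨1, 0, by simp, by simp, by simp, by simp⟩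

theorem RatBound.add {B C : ℕ} {F G : MvPowerSeries ι ℝ} (hF : RatBound B F)
    (hG : RatBound C G) : RatBound (B + C) (F + G) := by
  obtain ⟨M, N, h1, h2, h3, h4⟩ := hF
  obtain ⟨M', N', h1', h2', h3', h4'⟩ := hG
  refine ⟨M * M', N * M' + N' * M, ?_, ?_, ?_, ?_⟩
  · exact (MvPolynomial.totalDegree_mul _ _).trans (add_le_add h1 h1')
  · refine (MvPolynomial.totalDegree_add _ _).trans (max_le ?_ ?_)
    · exact (MvPolynomial.totalDegree_mul _ _).trans (add_le_add h2 h1')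
    · refine (MvPolynomial.totalDegree_mul _ _).trans ?_
      rw [add_comm B C]
      exact add_le_add h2' h1
  · rw [map_mul]; exact mul_ne_zero h3 h3'
  · push_cast
    rw [← h4, ← h4']
    ring

theorem RatBound.neg {B : ℕ} {F : MvPowerSeries ι ℝ} (hF : RatBound B F) : RatBound B (-F) := by
  obtain ⟨M, N, h1, h2, h3, h4⟩ := hF
  refine ⟨M, -N, h1, by rwa [MvPolynomial.totalDegree_neg], h3, ?_⟩
  rw [mul_neg, h4]
  have := (MvPolynomial.coeToMvPowerSeries.ringHom (σ := ι) (R := ℝ)).map_neg N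
  simpa using this.symm

theorem RatBound.sub {B C : ℕ} {F G : MvPowerSeries ι ℝ} (hF : RatBound B F)
    (hG : RatBound C G) : RatBound (B + C) (F - G) := by
  rw [sub_eq_add_neg]; exact hF.add hG.neg

theorem RatBound.mul_X_pow {B : ℕ} {F : MvPowerSeries ι ℝ} (hF : RatBound B F) (i : ι) (n : ℕ) :
    RatBound (B + n) (F * MvPowerSeries.X i ^ n) := by
  obtain ⟨M, N, h1, h2, h3, h4⟩ := hF
  refine ⟨M, N * MvPolynomial.X i ^ n, h1.trans (Nat.le_add_right _ _), ?_, h3, ?_⟩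
  · refine (MvPolynomial.totalDegree_mul _ _).trans (add_le_add h2 ?_)
    exact (MvPolynomial.totalDegree_X_pow i n).le
  · push_cast
    rw [← h4]; ring

/-- Homogenization: a monomial of degree s acquires the denominator Q^s when every a_i is A_i / Q,
and Q^B clears all of these at once. Since the a_i have no constant term, the constant terms of M
and Q^B simply multiply, which keeps denominators invertible. -/
theorem exists_polynomial_subst_mul_pow {a : ι → MvPowerSeries ι ℝ}
    (ha0 : ∀ i, MvPowerSeries.constantCoeff (a i) = 0) {Q : MvPolynomial ι ℝ} {A : ι → MvPolynomial ι ℝ} {c : ℕ}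
    (hA : ∀ i, (A i).totalDegree ≤ c) (hQ : Q.totalDegree ≤ c)
    (haA : ∀ i, a i * Q = A i) {B : ℕ} (M : MvPolynomial ι ℝ) (hM : M.totalDegree ≤ B) :
    ∃ M' : MvPolynomial ι ℝ, M'.totalDegree ≤ B * c ∧
      MvPolynomial.constantCoeff M' = MvPolynomial.constantCoeff M * MvPolynomial.constantCoeff Q ^ B ∧
      MvPowerSeries.subst a (M : MvPowerSeries ι ℝ) * (Q : MvPowerSeries ι ℝ) ^ B = M' := by
  have hdeg : ∀ s ∈ M.support, s.degree ≤ B := fun s hs => by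
    have := MvPolynomial.le_totalDegree hs
    rw [Finsupp.sum, ← Finsupp.degree_apply] at this
    exact this.trans hM
  have key : MvPowerSeries.subst a (M : MvPowerSeries ι ℝ) * (Q : MvPowerSeries ι ℝ) ^ B
      = ((∑ s ∈ M.support, MvPolynomial.C (M.coeff s) * (s.prod fun i n => A i ^ n)
          * Q ^ (B - s.degree) : MvPolynomial ι ℝ) : MvPowerSeries ι ℝ) := by
    rw [MvPowerSeries.subst_coe, MvPolynomial.aeval_def, MvPolynomial.eval₂_eq,
      Finset.sum_mul]
    simp only [← MvPolynomial.coeToMvPowerSeries.ringHom_apply]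
    rw [map_sum]
    refine Finset.sum_congr rfl fun s hs => ?_
    have hB : B = s.degree + (B - s.degree) := by have := hdeg s hs; omega
    rw [map_mul, map_mul, map_pow, Finsupp.prod, map_prod]
    simp only [map_pow, MvPolynomial.coeToMvPowerSeries.ringHom_apply, MvPolynomial.coe_C]
    conv_lhs => rw [hB, pow_add]
    rw [Finsupp.degree_apply, ← Finset.prod_pow_eq_pow_sum]
    simp only [← haA, mul_pow, Finset.prod_mul_distrib]
    rw [MvPowerSeries.algebraMap_apply, Algebra.algebraMap_self_apply]
    ring
  refine ⟨_, ?_, ?_, key⟩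
  · refine MvPolynomial.totalDegree_finsetSum_le fun s hs => ?_
    have hB : B * c = 0 + s.degree * c + (B - s.degree) * c := by
      have := hdeg s hs
      rw [zero_add, ← add_mul]; congr 1; omega
    rw [hB]
    refine (MvPolynomial.totalDegree_mul _ _).trans (add_le_add
      ((MvPolynomial.totalDegree_mul _ _).trans (add_le_add (MvPolynomial.totalDegree_C _).le ?_))
      ((MvPolynomial.totalDegree_pow _ _).trans (Nat.mul_le_mul_left _ hQ)))
    refine (MvPolynomial.totalDegree_finsetProd _ _).trans ?_
    rw [Finsupp.degree_apply, Finset.sum_mul]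
    exact Finset.sum_le_sum fun i _ =>
      (MvPolynomial.totalDegree_pow _ _).trans (Nat.mul_le_mul_left _ (hA i))
  · have h := congrArg MvPowerSeries.constantCoeff key
    have hc : ∀ p : MvPolynomial ι ℝ, MvPowerSeries.constantCoeff (p : MvPowerSeries ι ℝ)
        = MvPolynomial.constantCoeff p := fun p => by
      rw [← MvPowerSeries.coeff_zero_eq_constantCoeff_apply, MvPolynomial.coeff_coe]; rfl
    rw [hc, map_mul, map_pow, hc, MvPowerSeries.subst_coe, MvPolynomial.aeval_def,
      MvPolynomial.hom_eval₂] at h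
    rw [← h, MvPolynomial.constantCoeff_eq]
    congr 1
    have h0 : (fun i => MvPowerSeries.constantCoeff (a i)) = 0 := funext ha0
    have h1 : (MvPowerSeries.constantCoeff (σ := ι) (R := ℝ)).comp (algebraMap ℝ _)
        = RingHom.id ℝ := by
      ext x
      simp
    change MvPolynomial.eval₂ _ (fun i => MvPowerSeries.constantCoeff (a i)) M = _
    rw [h0, h1]
    exact MvPolynomial.eval₂_zero_apply _ _

/-- Numerator and denominator are multiplied by the same power Q^B after the substitution. All
degree bounds for substitution operators come from here. -/
theorem RatBound.subst {a : ι → MvPowerSeries ι ℝ} (ha : MvPowerSeries.HasSubst a)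
    (ha0 : ∀ i, MvPowerSeries.constantCoeff (a i) = 0) {Q : MvPolynomial ι ℝ} {A : ι → MvPolynomial ι ℝ} {c : ℕ}
    (hA : ∀ i, (A i).totalDegree ≤ c) (hQ : Q.totalDegree ≤ c)
    (hQ0 : MvPolynomial.constantCoeff Q ≠ 0)
    (haA : ∀ i, a i * Q = A i) {B : ℕ} {F : MvPowerSeries ι ℝ} (hF : RatBound B F) :
    RatBound (B * c) (MvPowerSeries.subst a F) := by
  obtain ⟨M, N, h1, h2, h3, h4⟩ := hF
  obtain ⟨M', hM1, hM2, hM3⟩ := exists_polynomial_subst_mul_pow ha0 hA hQ haA M h1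
  obtain ⟨N', hN1, hN2, hN3⟩ := exists_polynomial_subst_mul_pow ha0 hA hQ haA N h2
  refine ⟨M', N', hM1, hN1, ?_, ?_⟩
  · rw [hM2]; exact mul_ne_zero h3 (pow_ne_zero _ hQ0)
  · rw [← hM3, ← hN3, ← h4, MvPowerSeries.subst_mul ha]; ring

end Rational


/-! ### Coefficient formulas for the elementary operators -/

section Operators

variable {ι : Type} [DecidableEq ι]

/-- `G[X_x/X_z] X_x^n`, where `x ≠ z`. -/
noncomputable def asgOp (x z : ι) (n : ℕ) (G : MvPowerSeries ι ℝ) : MvPowerSeries ι ℝ :=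
  fun e => if e x = n then ∑ p ∈ Finset.HasAntidiagonal.antidiagonal (e z),
    MvPowerSeries.coeff ((e.update x p.1).update z p.2) G else 0

/-- The coefficients of `G` shifted down in dimension `x`. -/
noncomputable def shiftOp (x : ι) (G : MvPowerSeries ι ℝ) : MvPowerSeries ι ℝ :=
  fun e => MvPowerSeries.coeff (e + Finsupp.single x 1) G

/-- `G[X_x/0]`. -/
noncomputable def zeroOp (x : ι) (G : MvPowerSeries ι ℝ) : MvPowerSeries ι ℝ :=
  fun e => if e x = 0 then MvPowerSeries.coeff e G else 0

/-- `G[X_y/X_y d(X_x)]`. -/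
noncomputable def iidOp (x y : ι) (d : PowerSeries ℝ) (G : MvPowerSeries ι ℝ) :
    MvPowerSeries ι ℝ :=
  fun e => ∑ p ∈ Finset.HasAntidiagonal.antidiagonal (e x),
    MvPowerSeries.coeff (e.update x p.1) G * PowerSeries.coeff p.2 (d ^ (e.update x p.1) y)

/-- The part of `G` on the exponents that satisfy `p`. -/
noncomputable def resOp (p : (ι →₀ ℕ) → Bool) (G : MvPowerSeries ι ℝ) : MvPowerSeries ι ℝ :=
  fun e => if p e then MvPowerSeries.coeff e G else 0

theorem coeff_asgOp (x z : ι) (n : ℕ) (G : MvPowerSeries ι ℝ) (e : ι →₀ ℕ) :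
    MvPowerSeries.coeff e (asgOp x z n G) = if e x = n then ∑ p ∈ Finset.HasAntidiagonal.antidiagonal (e z),
      MvPowerSeries.coeff ((e.update x p.1).update z p.2) G else 0 := rfl

theorem coeff_shiftOp (x : ι) (G : MvPowerSeries ι ℝ) (e : ι →₀ ℕ) :
    MvPowerSeries.coeff e (shiftOp x G) = MvPowerSeries.coeff (e + Finsupp.single x 1) G := rfl

theorem coeff_zeroOp (x : ι) (G : MvPowerSeries ι ℝ) (e : ι →₀ ℕ) :
    MvPowerSeries.coeff e (zeroOp x G) = if e x = 0 then MvPowerSeries.coeff e G else 0 := rfl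

theorem coeff_iidOp (x y : ι) (d : PowerSeries ℝ) (G : MvPowerSeries ι ℝ) (e : ι →₀ ℕ) :
    MvPowerSeries.coeff e (iidOp x y d G) = ∑ p ∈ Finset.HasAntidiagonal.antidiagonal (e x),
      MvPowerSeries.coeff (e.update x p.1) G * PowerSeries.coeff p.2 (d ^ (e.update x p.1) y) :=
  rfl

theorem coeff_resOp (p : (ι →₀ ℕ) → Bool) (G : MvPowerSeries ι ℝ) (e : ι →₀ ℕ) :
    MvPowerSeries.coeff e (resOp p G) = if p e then MvPowerSeries.coeff e G else 0 := rfl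

theorem resOp_not (p : (ι →₀ ℕ) → Bool) (G : MvPowerSeries ι ℝ) :
    resOp (fun e => !p e) G = G - resOp p G := by
  ext e
  rw [map_sub, coeff_resOp, coeff_resOp]
  cases p e <;> simp

theorem resOp_and (p q : (ι →₀ ℕ) → Bool) (G : MvPowerSeries ι ℝ) :
    resOp (fun e => p e && q e) G = resOp q (resOp p G) := by
  ext e
  simp only [coeff_resOp]
  cases p e <;> cases q e <;> simp

theorem resOp_or (p q : (ι →₀ ℕ) → Bool) (G : MvPowerSeries ι ℝ) :
    resOp (fun e => p e || q e) G = resOp p G + resOp q (resOp (fun e => !p e) G) := by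
  ext e
  simp only [coeff_resOp, map_add]
  cases p e <;> cases q e <;> simp

/-- This presents the shift as the exact quotient (G - G[X_x/0]) / X_x, the form in which its
rationality can be seen. -/
theorem zeroOp_add_X_mul_shiftOp (x : ι) (G : MvPowerSeries ι ℝ) :
    zeroOp x G + MvPowerSeries.X x * shiftOp x G = G := by
  ext e
  rw [map_add, coeff_zeroOp, MvPowerSeries.X, MvPowerSeries.coeff_monomial_mul, one_mul,
    coeff_shiftOp]
  simp only [Finsupp.single_le_iff]
  by_cases h : e x = 0
  · simp [h]
  · have h1 : 1 ≤ e x := by omega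
    rw [if_neg h, if_pos h1, zero_add, tsub_add_cancel_of_le (Finsupp.single_le_iff.2 h1)]

/-- Peeling off the terms without X_x leaves a comparison with a smaller bound on the shifted
series, so comparison guards reduce to zeroing and shifting. -/
theorem resOp_lt_succ (x : ι) (n : ℕ) (G : MvPowerSeries ι ℝ) :
    resOp (fun e => decide (e x < n + 1)) G
      = zeroOp x G + resOp (fun e => decide (e x < n)) (shiftOp x G) * MvPowerSeries.X x ^ 1 := by
  ext e
  rw [map_add, coeff_zeroOp, pow_one, mul_comm, MvPowerSeries.X, MvPowerSeries.coeff_monomial_mul,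
    one_mul, coeff_resOp, coeff_resOp, coeff_shiftOp]
  simp only [Finsupp.single_le_iff]
  by_cases h : e x = 0
  · simp [h]
  · have h1 : 1 ≤ e x := by omega
    rw [if_neg h, if_pos h1, zero_add, tsub_add_cancel_of_le (Finsupp.single_le_iff.2 h1)]
    simp only [Finsupp.tsub_apply, Finsupp.single_eq_same]
    congr 1
    simp only [decide_eq_true_eq, eq_iff_iff]
    omega

/-! ### Coefficient formulas versus formal substitution -/

theorem prod_update_pow {R : Type} [CommRing R] (a : ι → R) (i : ι) (b : R) (σ : ι →₀ ℕ) :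
    (σ.prod fun j (n : ℕ) => (Function.update a i b j) ^ n)
      = (σ.erase i).prod (fun j (n : ℕ) => a j ^ n) * b ^ σ i := by
  rw [← Finsupp.mul_prod_erase' σ i _ (fun _ => pow_zero _), Function.update_self, mul_comm]
  congr 1
  refine Finsupp.prod_congr fun j hj => ?_
  rw [Function.update_of_ne]
  rintro rfl
  simp at hj

theorem prod_X_pow_eq_monomial (σ : ι →₀ ℕ) :
    (σ.prod fun j n => (MvPowerSeries.X j : MvPowerSeries ι ℝ) ^ n) = MvPowerSeries.monomial σ 1 := by
  rw [← MvPolynomial.coe_monomial, MvPolynomial.monomial_eq, MvPolynomial.C_1, one_mul,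
    Finsupp.prod, Finsupp.prod, ← MvPolynomial.coeToMvPowerSeries.ringHom_apply, map_prod]
  simp

/-- An exponent that differs from e only at x, and is not larger there, amounts to a splitting of e
x into two summands. -/
theorem finsum_antidiagonal_update {M : Type} [AddCommMonoid M] (e : ι →₀ ℕ) (x : ι)
    (f : (ι →₀ ℕ) → M)
    (hf : ∀ σ, f σ ≠ 0 → (∀ i ≠ x, σ i = e i) ∧ σ x ≤ e x) :
    ∑ᶠ σ, f σ = ∑ p ∈ Finset.HasAntidiagonal.antidiagonal (e x), f (e.update x p.1) := by
  rw [finsum_eq_sum_of_support_subset (s := (Finset.HasAntidiagonal.antidiagonal (e x)).image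
    fun p => e.update x p.1), Finset.sum_image]
  · rintro ⟨a, b⟩ hp ⟨c, d⟩ hq h
    have h1 := DFunLike.congr_fun h x
    simp at h1 hp hq
    ext <;> simp <;> omega
  · intro σ hσ
    obtain ⟨h1, h2⟩ := hf σ hσ
    simp only [Finset.coe_image, Set.mem_image, Finset.mem_coe, Finset.HasAntidiagonal.mem_antidiagonal]
    refine ⟨(σ x, e x - σ x), by simp; omega, ?_⟩
    ext i
    by_cases hi : i = x
    · subst hi; simp
    · simp [hi, h1 i hi]

open Classical in
theorem coeff_monomial_mul_subst (x : ι) (f : PowerSeries ℝ) (σ e : ι →₀ ℕ) :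
    MvPowerSeries.coeff e (MvPowerSeries.monomial σ 1 * PowerSeries.subst (MvPowerSeries.X x) f)
      = if (∀ i ≠ x, σ i = e i) ∧ σ x ≤ e x then PowerSeries.coeff (e x - σ x) f else 0 := by
  rw [MvPowerSeries.coeff_monomial_mul, one_mul]
  by_cases h : σ ≤ e
  · rw [if_pos h, PowerSeries.coeff_subst_single, Finsupp.tsub_apply]
    congr 1
    simp only [eq_iff_iff]
    constructor
    · intro h'
      refine ⟨fun i hi => ?_, h x⟩
      have := DFunLike.congr_fun h' i
      rw [Finsupp.tsub_apply, Finsupp.single_eq_of_ne hi] at this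
      have := h i
      omega
    · rintro ⟨h1, h2⟩
      ext i
      by_cases hi : i = x
      · subst hi; simp
      · rw [Finsupp.tsub_apply, Finsupp.single_eq_of_ne hi, h1 i hi, tsub_self]
  · rw [if_neg h, if_neg]
    rintro ⟨h1, h2⟩
    refine h fun i => ?_
    by_cases hi : i = x
    · subst hi; exact h2
    · exact (h1 i hi).le

theorem prod_update_X_mul_subst (x y : ι) (d : PowerSeries ℝ) (σ : ι →₀ ℕ) :
    (σ.prod fun j n => (Function.update MvPowerSeries.X y
        (MvPowerSeries.X y * PowerSeries.subst (MvPowerSeries.X x) d) j : MvPowerSeries ι ℝ) ^ n)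
      = MvPowerSeries.monomial σ 1 * PowerSeries.subst (MvPowerSeries.X x) (d ^ σ y) := by
  rw [prod_update_pow, mul_pow, PowerSeries.subst_pow (PowerSeries.HasSubst.X x), ← mul_assoc,
    ← prod_X_pow_eq_monomial]
  congr 1
  rw [← Finsupp.mul_prod_erase' σ y _ (fun _ => pow_zero _), mul_comm]

variable [Finite ι]

theorem hasSubst_update_X {x : ι} {b : MvPowerSeries ι ℝ} (hb : MvPowerSeries.constantCoeff b = 0) :
    MvPowerSeries.HasSubst (Function.update MvPowerSeries.X x b) := by
  refine MvPowerSeries.hasSubst_of_constantCoeff_zero fun i => ?_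
  by_cases hi : i = x
  · subst hi; simpa
  · simp [hi]

/-- The factor X_y kills the constant term of the substituted series, so the substitution is
legitimate on every formal power series. The variables x and y may coincide. -/
theorem iidOp_eq_subst (x y : ι) (d : PowerSeries ℝ) (G : MvPowerSeries ι ℝ) :
    iidOp x y d G = MvPowerSeries.subst (Function.update MvPowerSeries.X y
      (MvPowerSeries.X y * PowerSeries.subst (MvPowerSeries.X x) d)) G := by
  ext e
  rw [MvPowerSeries.coeff_subst (hasSubst_update_X (by simp)), coeff_iidOp]
  simp only [prod_update_X_mul_subst, coeff_monomial_mul_subst]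
  rw [finsum_antidiagonal_update e x]
  · refine Finset.sum_congr rfl fun p hp => ?_
    rw [Finset.HasAntidiagonal.mem_antidiagonal] at hp
    have h : e x - (e.update x p.1) x = p.2 := by simp; omega
    rw [if_pos, smul_eq_mul, h]
    exact ⟨fun i hi => by simp [hi], by simp; omega⟩
  · intro σ hσ
    by_contra h
    rw [if_neg h, smul_zero] at hσ
    exact hσ rfl

theorem zeroOp_eq_subst (x : ι) (G : MvPowerSeries ι ℝ) :
    zeroOp x G = MvPowerSeries.subst (Function.update MvPowerSeries.X x 0) G := by
  ext e
  rw [MvPowerSeries.coeff_subst (hasSubst_update_X (by simp)), coeff_zeroOp]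
  simp only [prod_update_pow, prod_X_pow_eq_monomial]
  have h : ∀ d : ι →₀ ℕ, MvPowerSeries.coeff e
      (MvPowerSeries.monomial (d.erase x) (1 : ℝ) * (0 : MvPowerSeries ι ℝ) ^ d x)
        = if d = e ∧ e x = 0 then 1 else 0 := by
    intro d
    by_cases hd : d x = 0
    · have h1 : d.erase x = d := Finsupp.erase_of_notMem_support (by simpa using hd)
      rw [hd, pow_zero, mul_one, MvPowerSeries.coeff_monomial, h1]
      congr 1
      simp only [eq_iff_iff]
      constructor
      · rintro rfl; exact ⟨rfl, hd⟩
      · rintro ⟨rfl, _⟩; rfl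
    · rw [zero_pow hd, mul_zero, map_zero, if_neg]
      rintro ⟨rfl, h⟩; exact hd h
  simp only [h]
  rw [finsum_eq_single _ e fun d hd => by simp [hd]]
  simp

/-- Here the ghost variable earns its place: X_z has constant term zero, while 1 could not be
substituted into an arbitrary series. The splitting of the exponent of z records the overwritten
value and the earlier ghost exponent. -/
theorem asgOp_eq_subst {x z : ι} (hxz : x ≠ z) (n : ℕ) (G : MvPowerSeries ι ℝ) :
    asgOp x z n G = MvPowerSeries.subst (Function.update MvPowerSeries.X x (MvPowerSeries.X z)) G
      * MvPowerSeries.X x ^ n := by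
  ext e
  rw [coeff_asgOp, MvPowerSeries.X_pow_eq, MvPowerSeries.coeff_mul_monomial, mul_one,
    MvPowerSeries.coeff_subst (hasSubst_update_X (by simp))]
  simp only [prod_update_pow, prod_X_pow_eq_monomial]
  simp only [MvPowerSeries.X_pow_eq, MvPowerSeries.monomial_mul_monomial, mul_one, MvPowerSeries.coeff_monomial,
    Finsupp.single_le_iff]
  by_cases hn : e x = n
  · rw [if_pos hn, if_pos hn.ge]
    rw [finsum_eq_sum_of_support_subset (s := (Finset.HasAntidiagonal.antidiagonal (e z)).image
      fun p => (e.update x p.1).update z p.2), Finset.sum_image]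
    · refine Finset.sum_congr rfl fun p hp => ?_
      rw [Finset.HasAntidiagonal.mem_antidiagonal] at hp
      rw [if_pos, smul_eq_mul, mul_one]
      ext i
      by_cases hi : i = x
      · subst hi; simp [hxz, hn]
      · by_cases hi' : i = z
        · subst hi'; simp [hxz, hi, hp.symm, add_comm]
        · simp [hi, hi']
    · rintro ⟨a, b⟩ hp ⟨c, d⟩ hq h
      have h1 := DFunLike.congr_fun h x
      have h2 := DFunLike.congr_fun h z
      simp [hxz] at h1 h2
      ext <;> simp [h1, h2]
    · intro σ hσ
      rw [Function.mem_support] at hσ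
      have h : e - Finsupp.single x n = σ.erase x + Finsupp.single z (σ x) := by
        by_contra h
        rw [if_neg h, smul_zero] at hσ
        exact hσ rfl
      have h0 : ∀ i, i ≠ x → e i = σ i + Finsupp.single z (σ x) i := fun i hi => by
        have := DFunLike.congr_fun h i
        simpa [hi, Ne.symm hi] using this
      simp only [Finset.coe_image, Set.mem_image, Finset.mem_coe, Finset.HasAntidiagonal.mem_antidiagonal]
      refine ⟨(σ x, σ z), ?_, ?_⟩
      · rw [h0 z hxz.symm]; simp [add_comm]
      · ext i
        by_cases hi' : i = z
        · subst hi'; simp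
        · by_cases hi : i = x
          · subst hi; simp [hi']
          · simp [hi, hi', h0 i hi]
  · rw [if_neg hn]
    split_ifs with h1
    · symm
      refine finsum_eq_zero_of_forall_eq_zero fun σ => ?_
      rw [if_neg, smul_zero]
      intro h
      have := DFunLike.congr_fun h x
      simp [hxz] at this
      omega
    · rfl

end Operators


/-! ### Degree bounds for the elementary operators -/

section OperatorBounds

variable {ι : Type} [DecidableEq ι] [Finite ι]

theorem RatBound.zeroOp {B : ℕ} {F : MvPowerSeries ι ℝ} (hF : RatBound B F) (x : ι) :
    RatBound B (zeroOp x F) := by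
  rw [zeroOp_eq_subst]
  have h := hF.subst (a := Function.update MvPowerSeries.X x 0) (hasSubst_update_X (by simp))
    (Q := 1) (A := Function.update MvPolynomial.X x 0) (c := 1) ?_ ?_ ?_ ?_ ?_
  · rwa [mul_one] at h
  · intro i
    by_cases hi : i = x
    · subst hi; simp
    · simp [hi]
  · intro i
    by_cases hi : i = x
    · subst hi; simp
    · simp [hi]
  · simp
  · simp
  · intro i
    by_cases hi : i = x
    · subst hi; simp
    · simp [hi]

theorem RatBound.asgOp {B : ℕ} {F : MvPowerSeries ι ℝ} (hF : RatBound B F) {x z : ι} (hxz : x ≠ z)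
    (n : ℕ) : RatBound (B + n) (asgOp x z n F) := by
  rw [asgOp_eq_subst hxz]
  refine RatBound.mul_X_pow ?_ _ _
  have h := hF.subst (a := Function.update MvPowerSeries.X x (MvPowerSeries.X z))
    (hasSubst_update_X (by simp))
    (Q := 1) (A := Function.update MvPolynomial.X x (MvPolynomial.X z)) (c := 1) ?_ ?_ ?_ ?_ ?_
  · rwa [mul_one] at h
  · intro i
    by_cases hi : i = x
    · subst hi; simp
    · simp [hi]
  · intro i
    by_cases hi : i = x
    · subst hi; simp
    · simp [hi]
  · simp
  · simp
  · intro i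
    by_cases hi : i = x
    · subst hi; simp
    · simp [hi]

/-- Divisibility of a polynomial by a variable can be read off from its coefficients, so the
quotient in power series is already a polynomial, of no larger degree. -/
theorem MvPolynomial.exists_X_mul_of_coe_eq {P : MvPolynomial ι ℝ} {x : ι}
    {S : MvPowerSeries ι ℝ} (h : (MvPowerSeries.X x : MvPowerSeries ι ℝ) * S = P) :
    ∃ P' : MvPolynomial ι ℝ, P'.totalDegree ≤ P.totalDegree ∧ S = P' := by
  refine ⟨P.divMonomial (Finsupp.single x 1), ?_, ?_⟩
  · refine Finset.sup_le fun s hs => ?_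
    rw [MvPolynomial.mem_support_iff, MvPolynomial.coeff_divMonomial] at hs
    have h1 := MvPolynomial.le_totalDegree (MvPolynomial.mem_support_iff.2 hs)
    refine le_trans ?_ h1
    rw [Finsupp.sum, Finsupp.sum, ← Finsupp.degree_apply, ← Finsupp.degree_apply, map_add]
    exact Nat.le_add_left _ _
  · ext e
    rw [MvPolynomial.coeff_coe, MvPolynomial.coeff_divMonomial, ← MvPolynomial.coeff_coe, ← h,
      MvPowerSeries.X, MvPowerSeries.coeff_add_monomial_mul, one_mul]

/-- Over a common denominator, the numerator of F - F[X_x/0] is divisible by X_x. The factor 2 comes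
from that common denominator. -/
theorem RatBound.shiftOp {B : ℕ} {F : MvPowerSeries ι ℝ} (hF : RatBound B F) (x : ι) :
    RatBound (2 * B) (shiftOp x F) := by
  have h : RatBound (B + B) (F - _root_.zeroOp x F) := hF.sub (hF.zeroOp x)
  rw [two_mul]
  have hx : MvPowerSeries.X x * _root_.shiftOp x F = F - _root_.zeroOp x F :=
    eq_sub_of_add_eq' (zeroOp_add_X_mul_shiftOp x F)
  rw [← hx] at h
  obtain ⟨M, N, h1, h2, h3, h4⟩ := h
  rw [mul_left_comm] at h4
  obtain ⟨N', h5, h6⟩ := MvPolynomial.exists_X_mul_of_coe_eq h4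
  exact ⟨M, N', h1, h5.trans h2, h3, h6⟩

/-- With d = p / q, the common denominator of the substitution is q(X_x): the variable X_y becomes
X_y p(X_x) and every other X_i becomes X_i q(X_x), whence the degree c + 1. -/
theorem RatBound.iidOp {B : ℕ} {F : MvPowerSeries ι ℝ} (hF : RatBound B F) (x y : ι)
    {d : PowerSeries ℝ} {p q : Polynomial ℝ} (hq : q.coeff 0 ≠ 0) (hd : d * q = p) {c : ℕ}
    (hp : p.natDegree ≤ c) (hqc : q.natDegree ≤ c) :
    RatBound (B * (c + 1)) (iidOp x y d F) := by
  rw [iidOp_eq_subst]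
  have hdeg : ∀ r : Polynomial ℝ, (Polynomial.aeval (MvPolynomial.X x : MvPolynomial ι ℝ) r).totalDegree
      ≤ r.natDegree := by
    intro r
    rw [Polynomial.aeval_eq_sum_range]
    refine MvPolynomial.totalDegree_finsetSum_le fun i hi => ?_
    refine (MvPolynomial.totalDegree_smul_le _ _).trans ?_
    rw [MvPolynomial.totalDegree_X_pow]
    rw [Finset.mem_range] at hi; omega
  have hsub : ∀ r : Polynomial ℝ, ((Polynomial.aeval (MvPolynomial.X x : MvPolynomial ι ℝ) r :
      MvPolynomial ι ℝ) : MvPowerSeries ι ℝ) = PowerSeries.subst (MvPowerSeries.X x) (r : PowerSeries ℝ) := by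
    intro r
    rw [PowerSeries.subst_coe (PowerSeries.HasSubst.X x)]
    have := Polynomial.aeval_algHom_apply (MvPolynomial.coeToMvPowerSeries.algHom (σ := ι) ℝ (R := ℝ))
      (MvPolynomial.X x) r
    simpa using this.symm
  have hmul : PowerSeries.subst (MvPowerSeries.X x) d
      * PowerSeries.subst (MvPowerSeries.X x : MvPowerSeries ι ℝ) (q : PowerSeries ℝ)
        = PowerSeries.subst (MvPowerSeries.X x) (p : PowerSeries ℝ) := by
    rw [← hd, PowerSeries.subst_mul (PowerSeries.HasSubst.X x)]
  refine hF.subst (hasSubst_update_X (by simp))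
    (Q := Polynomial.aeval (MvPolynomial.X x) q)
    (A := Function.update (fun i => MvPolynomial.X i * Polynomial.aeval (MvPolynomial.X x) q) y
      (MvPolynomial.X y * Polynomial.aeval (MvPolynomial.X x) p)) (c := c + 1) ?_ ?_ ?_ ?_ ?_
  · intro i
    by_cases hi : i = y
    · subst hi; simp
    · simp [hi]
  · intro i
    by_cases hi : i = y
    · subst hi
      rw [Function.update_self]
      refine (MvPolynomial.totalDegree_mul _ _).trans ?_
      rw [MvPolynomial.totalDegree_X, add_comm]
      exact Nat.add_le_add_right ((hdeg _).trans hp) 1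
    · rw [Function.update_of_ne hi]
      refine (MvPolynomial.totalDegree_mul _ _).trans ?_
      rw [MvPolynomial.totalDegree_X, add_comm]
      exact Nat.add_le_add_right ((hdeg _).trans hqc) 1
  · exact ((hdeg _).trans hqc).trans (Nat.le_succ _)
  · rw [Polynomial.aeval_def, Polynomial.hom_eval₂]
    simpa [Polynomial.eval₂_eq_sum_range, Polynomial.coeff_zero_eq_eval_zero,
      Polynomial.eval_eq_sum_range] using hq
  · intro i
    by_cases hi : i = y
    · subst hi
      rw [Function.update_self, Function.update_self, MvPolynomial.coe_mul, MvPolynomial.coe_X,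
        hsub, hsub, mul_assoc, hmul]
    · rw [Function.update_of_ne hi, Function.update_of_ne hi, MvPolynomial.coe_mul,
        MvPolynomial.coe_X]

/-- The operator is bounded on rational series by a linear function of the degree. -/
def LinBound (c : ℕ) (T : MvPowerSeries ι ℝ → MvPowerSeries ι ℝ) : Prop :=
  ∀ B G, RatBound B G → RatBound (c * (B + 1)) (T G)

theorem LinBound.mono {c c' : ℕ} {T : MvPowerSeries ι ℝ → MvPowerSeries ι ℝ} (h : LinBound c T)
    (hc : c ≤ c') : LinBound c' T :=
  fun B G hG => (h B G hG).mono (Nat.mul_le_mul_right _ hc)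

theorem LinBound.comp {c c' : ℕ} {S T : MvPowerSeries ι ℝ → MvPowerSeries ι ℝ}
    (hS : LinBound c S) (hT : LinBound c' T) : LinBound (c * (c' + 1)) fun G => S (T G) := by
  intro B G hG
  refine (hS _ _ (hT _ _ hG)).mono ?_
  rw [mul_assoc]
  exact Nat.mul_le_mul_left _ (by nlinarith)

theorem LinBound.add {c c' : ℕ} {S T : MvPowerSeries ι ℝ → MvPowerSeries ι ℝ}
    (hS : LinBound c S) (hT : LinBound c' T) : LinBound (c + c') fun G => S G + T G := by
  intro B G hG
  rw [add_mul]
  exact (hS _ _ hG).add (hT _ _ hG)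

theorem LinBound.resOp_not {c : ℕ} {p : (ι →₀ ℕ) → Bool} (h : LinBound c (resOp p)) :
    LinBound (c + 1) (resOp fun e => !p e) := by
  intro B G hG
  rw [_root_.resOp_not]
  exact (hG.sub (h _ _ hG)).mono (by nlinarith)

theorem LinBound.resOp_and {c c' : ℕ} {p q : (ι →₀ ℕ) → Bool} (h : LinBound c (resOp p))
    (h' : LinBound c' (resOp q)) : LinBound (c' * (c + 1)) (resOp fun e => p e && q e) := by
  have := h'.comp h
  intro B G hG
  rw [_root_.resOp_and]
  exact this B G hG

theorem LinBound.resOp_or {c c' : ℕ} {p q : (ι →₀ ℕ) → Bool} (h : LinBound c (resOp p))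
    (h' : LinBound c' (resOp q)) : LinBound (c + c' * (c + 2)) (resOp fun e => p e || q e) := by
  have := h.add (h'.comp h.resOp_not)
  intro B G hG
  rw [_root_.resOp_or]
  exact this B G hG

theorem LinBound.resOp_lt (x : ι) (n : ℕ) :
    LinBound (2 ^ n) (resOp (ι := ι) fun e => decide (e x < n)) := by
  -- This sharper affine bound is what the recursion reproduces: B for the terms without X_x, a
  -- doubled B under the induction hypothesis for the shift, and 1 for the factor X_x.
  have key : ∀ B G, RatBound B G →
      RatBound ((2 ^ n - 1) * B + n) (resOp (ι := ι) (fun e => decide (e x < n)) G) := by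
    induction n with
    | zero =>
      intro B G _
      have h : resOp (fun e : ι →₀ ℕ => decide (e x < 0)) G = 0 := by
        ext e; simp [coeff_resOp]
      rw [h]
      exact RatBound.zero.mono (Nat.zero_le _)
    | succ n ih =>
      intro B G hG
      rw [resOp_lt_succ]
      refine ((hG.zeroOp x).add ((ih _ _ (hG.shiftOp x)).mul_X_pow x 1)).mono (le_of_eq ?_)
      obtain ⟨m, hm⟩ : ∃ m, 2 ^ n = m + 1 := ⟨2 ^ n - 1, by have := Nat.pow_pos (n := n) two_pos; omega⟩
      have h2 : 2 ^ (n + 1) - 1 = 2 * m + 1 := by rw [pow_succ]; omega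
      rw [h2, hm, Nat.add_sub_cancel]; ring
  intro B G hG
  refine (key B G hG).mono ?_
  have h1 : n < 2 ^ n := Nat.lt_two_pow_self
  obtain ⟨m, hm⟩ : ∃ m, 2 ^ n = m + 1 := ⟨2 ^ n - 1, by omega⟩
  rw [hm, Nat.add_sub_cancel]
  nlinarith

end OperatorBounds


/-! ### The operator of a program with a ghost variable -/

section GhostSemantics

variable {ι : Type} [DecidableEq ι] {k : ℕ}

/-- The program state contained in an exponent vector. -/
noncomputable def pullState (v : Fin k → ι) (e : ι →₀ ℕ) : Fin k →₀ ℕ :=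
  Finsupp.equivFunOnFinite.symm fun i => e (v i)

@[simp] theorem pullState_apply (v : Fin k → ι) (e : ι →₀ ℕ) (i : Fin k) :
    pullState v e i = e (v i) := rfl

/-- The power series of a distribution expression over `ℝ`. -/
noncomputable def DistExpr.ser (D : DistExpr) : PowerSeries ℝ :=
  PowerSeries.map (algebraMap ℚ ℝ) (listSeries D.num * (listSeries D.den)⁻¹)

/-- The operator of a loop-free program on formal power series; the program variables are `X_(v i)`,
and values that are overwritten by an assignment are collected in the variable `X_z`. -/
noncomputable def ghostOp (v : Fin k → ι) (z : ι) : Prog k → MvPowerSeries ι ℝ → MvPowerSeries ι ℝ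
  | .assign x n => asgOp (v x) z n
  | .decr x => fun G => shiftOp (v x) G + zeroOp (v x) G
  | .iid x D y => iidOp (v x) (v y) D.ser
  | .ite φ P Q => fun G => ghostOp v z P (resOp (fun e => φ.eval (pullState v e)) G)
      + ghostOp v z Q (resOp (fun e => !φ.eval (pullState v e)) G)
  | .seq P Q => fun G => ghostOp v z Q (ghostOp v z P G)
  | .loop _ _ => id

/-- The polynomial with the given list of coefficients. -/
noncomputable def listPoly (l : List ℚ) : Polynomial ℝ :=
  ∑ i ∈ Finset.range l.length, Polynomial.monomial i (algebraMap ℚ ℝ (l.getD i 0))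

theorem coeff_listPoly (l : List ℚ) (i : ℕ) :
    (listPoly l).coeff i = algebraMap ℚ ℝ (l.getD i 0) := by
  rw [listPoly, Polynomial.finsetSum_coeff]
  simp only [Polynomial.coeff_monomial]
  rw [Finset.sum_ite_eq']
  split_ifs with h
  · rfl
  · rw [Finset.mem_range, not_lt] at h
    rw [List.getD_eq_default _ _ h, map_zero]

theorem coe_listPoly (l : List ℚ) :
    (listPoly l : PowerSeries ℝ) = PowerSeries.map (algebraMap ℚ ℝ) (listSeries l) := by
  ext i
  rw [Polynomial.coeff_coe, coeff_listPoly, PowerSeries.coeff_map, listSeries,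
    PowerSeries.coeff_mk]

theorem natDegree_listPoly_le (l : List ℚ) : (listPoly l).natDegree ≤ l.length := by
  refine Polynomial.natDegree_sum_le_of_forall_le _ _ fun i hi => ?_
  rw [Finset.mem_range] at hi
  exact (Polynomial.natDegree_monomial_le _).trans hi.le

theorem DistExpr.ser_mul (D : DistExpr) : D.ser * (listPoly D.den) = listPoly D.num := by
  rw [coe_listPoly, coe_listPoly, DistExpr.ser, ← map_mul, mul_assoc,
    PowerSeries.inv_mul_cancel _ D.den_ne, mul_one]

theorem DistExpr.coeff_zero_listPoly_den (D : DistExpr) : (listPoly D.den).coeff 0 ≠ 0 := by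
  have h := D.den_ne
  rw [← PowerSeries.coeff_zero_eq_constantCoeff_apply, listSeries, PowerSeries.coeff_mk] at h
  rw [coeff_listPoly]
  simpa using h

/-- A crude bound for the growth of degrees in terms of the size of codes. -/
def codeBound (n : ℕ) : ℕ := 2 ^ 2 ^ n

theorem codeBound_mono {m n : ℕ} (h : m ≤ n) : codeBound m ≤ codeBound n :=
  Nat.pow_le_pow_right two_pos (Nat.pow_le_pow_right two_pos h)

theorem two_pow_le_codeBound (n : ℕ) : 2 ^ n ≤ codeBound n :=
  Nat.pow_le_pow_right two_pos Nat.lt_two_pow_self.le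

theorem two_le_codeBound (n : ℕ) : 2 ≤ codeBound n := by
  have : 2 ^ 1 ≤ 2 ^ 2 ^ n := Nat.pow_le_pow_right two_pos Nat.one_le_two_pow
  simpa [codeBound] using this

theorem lt_codeBound (n : ℕ) : n < codeBound n :=
  Nat.lt_two_pow_self.trans_le (two_pow_le_codeBound n)

theorem codeBound_succ (n : ℕ) : codeBound (n + 1) = codeBound n * codeBound n := by
  rw [codeBound, codeBound, pow_succ, mul_two, pow_add]

/-- A compound term contributes at most about the product of the bounds of its parts. Its code
exceeds theirs by at least 2 because of the constructor tag, which leaves room for this product and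
the factor 4. -/
theorem four_mul_codeBound_le (n : ℕ) :
    4 * (codeBound n * codeBound n) ≤ codeBound (n + 2) := by
  rw [codeBound_succ, codeBound_succ]
  have := two_le_codeBound n
  exact Nat.mul_le_mul_right _ (by nlinarith)

theorem add_le_natPair (a b : ℕ) : a + b ≤ Nat.pair a b := Nat.add_le_pair a b

/-- Structural induction; a pairing is at least the sum of its entries, so measuring by codes
absorbs the growth at each connective. -/
theorem Guard.linBound [Finite ι] (v : Fin k → ι) (φ : Guard k) :
    LinBound (codeBound φ.code) (resOp fun e => φ.eval (pullState v e)) := by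
  induction φ with
  | lt x n =>
    refine (LinBound.resOp_lt (v x) n).mono ((two_pow_le_codeBound n).trans (codeBound_mono ?_))
    have h1 := add_le_natPair 0 (Nat.pair x n)
    have h2 := add_le_natPair x n
    simp only [Guard.code]
    omega
  | neg φ ih =>
    refine ih.resOp_not.mono ?_
    have h1 := add_le_natPair 1 φ.code
    refine le_trans ?_ (codeBound_mono (show φ.code + 1 ≤ _ by simp only [Guard.code]; omega))
    rw [codeBound_succ]
    have := two_le_codeBound φ.code
    nlinarith
  | and φ ψ ih ih' =>
    refine (ih.resOp_and ih').mono ?_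
    have h1 := add_le_natPair 2 (Nat.pair φ.code ψ.code)
    have h2 := add_le_natPair φ.code ψ.code
    set m := max φ.code ψ.code with hm
    refine le_trans ?_ (codeBound_mono (show m + 2 ≤ _ by simp only [Guard.code]; omega))
    refine le_trans ?_ (four_mul_codeBound_le m)
    have h3 := codeBound_mono (show φ.code ≤ m by omega)
    have h4 := codeBound_mono (show ψ.code ≤ m by omega)
    have := two_le_codeBound m
    calc _ ≤ codeBound m * (codeBound m + 1) := by gcongr
      _ ≤ _ := by nlinarith
  | or φ ψ ih ih' =>
    refine (ih.resOp_or ih').mono ?_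
    have h1 := add_le_natPair 3 (Nat.pair φ.code ψ.code)
    have h2 := add_le_natPair φ.code ψ.code
    set m := max φ.code ψ.code with hm
    refine le_trans ?_ (codeBound_mono (show m + 2 ≤ _ by simp only [Guard.code]; omega))
    refine le_trans ?_ (four_mul_codeBound_le m)
    have h3 := codeBound_mono (show φ.code ≤ m by omega)
    have h4 := codeBound_mono (show ψ.code ≤ m by omega)
    have := two_le_codeBound m
    calc _ ≤ codeBound m + codeBound m * (codeBound m + 2) := by gcongr
      _ ≤ _ := by nlinarith

theorem length_le_encode {α : Type} [Encodable α] (l : List α) : l.length ≤ Encodable.encode l := by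
  induction l with
  | nil => simp
  | cons a l ih =>
    rw [Encodable.encode_list_cons, List.length_cons]
    have := add_le_natPair (Encodable.encode a) (Encodable.encode l)
    omega

/-- The degrees of numerator and denominator are at most the lengths of their coefficient lists, and
a list is no longer than its code. -/
theorem LinBound.iidOp [Finite ι] (x y : ι) (D : DistExpr) :
    LinBound (D.code + 1) (iidOp x y D.ser) := by
  intro B G hG
  have h1 := length_le_encode (D.num.map ratCode)
  have h2 := length_le_encode (D.den.map ratCode)
  rw [List.length_map] at h1 h2
  have h3 := add_le_natPair (Encodable.encode (D.num.map ratCode))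
    (Encodable.encode (D.den.map ratCode))
  change _ ≤ D.code at h3
  refine (hG.iidOp x y D.coeff_zero_listPoly_den D.ser_mul (c := D.code)
    ((natDegree_listPoly_le _).trans (by omega)) ((natDegree_listPoly_le _).trans (by omega))).mono ?_
  nlinarith

theorem Prog.linBound [Finite ι] {v : Fin k → ι} {z : ι} (hv : ∀ i, v i ≠ z) (P : Prog k) :
    LinBound (codeBound P.code) (ghostOp v z P) := by
  induction P with
  | assign x n =>
    intro B G hG
    refine (hG.asgOp (hv x) n).mono ?_
    have h1 := add_le_natPair 0 (Nat.pair x n)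
    have h2 := add_le_natPair x n
    have h3 := lt_codeBound n
    have h4 := codeBound_mono (show n ≤ (Prog.assign x n).code by simp only [Prog.code]; omega)
    nlinarith
  | decr x =>
    intro B G hG
    refine ((hG.shiftOp (v x)).add (hG.zeroOp (v x))).mono ?_
    have h1 := add_le_natPair 1 x
    have h4 := codeBound_mono (show 1 ≤ (Prog.decr x).code by simp only [Prog.code]; omega)
    have h5 : codeBound 1 = 4 := rfl
    nlinarith
  | iid x D y =>
    refine (LinBound.iidOp (v x) (v y) D).mono ?_
    have h1 := add_le_natPair 2 (Nat.pair x (Nat.pair D.code y))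
    have h2 := add_le_natPair x (Nat.pair D.code y)
    have h3 := add_le_natPair D.code y
    exact (lt_codeBound D.code).trans_le (codeBound_mono (by simp only [Prog.code]; omega))
  | ite φ P Q ihP ihQ =>
    refine ((ihP.comp (φ.linBound v)).add (ihQ.comp (φ.linBound v).resOp_not)).mono ?_
    have h1 := add_le_natPair 3 (Nat.pair φ.code (Nat.pair P.code Q.code))
    have h2 := add_le_natPair φ.code (Nat.pair P.code Q.code)
    have h3 := add_le_natPair P.code Q.code
    set m := max φ.code (max P.code Q.code) with hm
    refine le_trans ?_ (codeBound_mono (show m + 2 ≤ _ by simp only [Prog.code]; omega))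
    refine le_trans ?_ (four_mul_codeBound_le m)
    have h3 := codeBound_mono (show φ.code ≤ m by omega)
    have h4 := codeBound_mono (show P.code ≤ m by omega)
    have h5 := codeBound_mono (show Q.code ≤ m by omega)
    have := two_le_codeBound m
    calc _ ≤ codeBound m * (codeBound m + 1) + codeBound m * (codeBound m + 1 + 1) := by gcongr
      _ ≤ _ := by nlinarith
  | seq P Q ihP ihQ =>
    refine (ihQ.comp ihP).mono ?_
    have h1 := add_le_natPair 4 (Nat.pair P.code Q.code)
    have h2 := add_le_natPair P.code Q.code
    set m := max P.code Q.code with hm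
    refine le_trans ?_ (codeBound_mono (show m + 2 ≤ _ by simp only [Prog.code]; omega))
    refine le_trans ?_ (four_mul_codeBound_le m)
    have h3 := codeBound_mono (show P.code ≤ m by omega)
    have h4 := codeBound_mono (show Q.code ≤ m by omega)
    have := two_le_codeBound m
    calc _ ≤ codeBound m * (codeBound m + 1) := by gcongr
      _ ≤ _ := by nlinarith
  -- The operator is the identity here by convention, so any bound will do.
  | loop φ P ih =>
    intro B G hG
    refine hG.mono ?_
    have := two_le_codeBound (Prog.loop φ P).code
    nlinarith

end GhostSemantics


/-! ### Univariate slices of rational power series -/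

section Slices

variable {m : ℕ}

/-- The coefficient of `X_1^(α 0) ⋯ X_m^(α (m-1))`, a power series in `X_0`. -/
noncomputable def slice (α : Fin m →₀ ℕ) (F : MvPowerSeries (Fin (m + 1)) ℝ) : PowerSeries ℝ :=
  PowerSeries.mk fun ζ => MvPowerSeries.coeff (Finsupp.cons ζ α) F

@[simp] theorem coeff_slice (α : Fin m →₀ ℕ) (F : MvPowerSeries (Fin (m + 1)) ℝ) (ζ : ℕ) :
    PowerSeries.coeff ζ (slice α F) = MvPowerSeries.coeff (Finsupp.cons ζ α) F :=
  PowerSeries.coeff_mk _ _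

theorem slice_mul (α : Fin m →₀ ℕ) (F G : MvPowerSeries (Fin (m + 1)) ℝ) :
    slice α (F * G) = ∑ p ∈ Finset.HasAntidiagonal.antidiagonal α, slice p.1 F * slice p.2 G := by
  ext ζ
  rw [map_sum]
  simp only [PowerSeries.coeff_mul, coeff_slice, ← MvPowerSeries.coeff_coeff_finSuccEquiv]
  rw [map_mul, PowerSeries.coeff_mul, map_sum, Finset.sum_comm]
  simp only [MvPowerSeries.coeff_mul]

theorem degree_cons (ζ : ℕ) (α : Fin m →₀ ℕ) : (Finsupp.cons ζ α).degree = ζ + α.degree := by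
  rw [Finsupp.degree_eq_sum, Finsupp.degree_eq_sum, Fin.sum_univ_succ]
  simp

theorem exists_slice_polynomial {B : ℕ} (M : MvPolynomial (Fin (m + 1)) ℝ) (hM : M.totalDegree ≤ B) :
    ∃ p : (Fin m →₀ ℕ) → Polynomial ℝ, (∀ α, (p α : PowerSeries ℝ) = slice α M) ∧
      (∀ α, (p α).natDegree ≤ B) ∧ ∀ α, B < α.degree → p α = 0 := by
  have h0 : ∀ ζ α, B < ζ + α.degree → M.coeff (Finsupp.cons ζ α) = 0 := by
    intro ζ α h
    refine MvPolynomial.coeff_eq_zero_of_totalDegree_lt (hM.trans_lt ?_)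
    rw [← degree_cons, Finsupp.degree_apply] at h
    exact h
  refine ⟨fun α => ∑ i ∈ Finset.range (B + 1), Polynomial.monomial i (M.coeff (Finsupp.cons i α)),
    fun α => ?_, fun α => ?_, fun α hα => ?_⟩
  · ext ζ
    rw [Polynomial.coeff_coe, Polynomial.finsetSum_coeff, coeff_slice, MvPolynomial.coeff_coe]
    simp only [Polynomial.coeff_monomial]
    rw [Finset.sum_ite_eq']
    split_ifs with h
    · rfl
    · rw [Finset.mem_range] at h
      rw [h0]; omega
  · refine Polynomial.natDegree_sum_le_of_forall_le _ _ fun i hi => ?_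
    rw [Finset.mem_range] at hi
    exact (Polynomial.natDegree_monomial_le _).trans (by omega)
  · refine Finset.sum_eq_zero fun i _ => ?_
    rw [h0 i α (by omega), map_zero]

/-- Multiplication by X only shifts the sequence of coefficients and so preserves its sum; the rest
is linearity. This makes setting the variable to 1 rigorous without a discussion of radii of
convergence. -/
theorem hasSum_coeff_polynomial_mul (p : Polynomial ℝ) {s : PowerSeries ℝ} {S : ℝ}
    (hs : HasSum (fun i => PowerSeries.coeff i s) S) :
    HasSum (fun i => PowerSeries.coeff i ((p : PowerSeries ℝ) * s)) (p.eval 1 * S) := by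
  induction p using Polynomial.induction_on with
  | C a =>
    simpa using hs.mul_left a
  | add p q hp hq =>
    simpa [add_mul] using hp.add hq
  | monomial n a ih =>
    rw [← hasSum_nat_add_iff' 1]
    have h : ((Polynomial.C a * Polynomial.X ^ (n + 1) : Polynomial ℝ) : PowerSeries ℝ) * s
        = PowerSeries.X * (((Polynomial.C a * Polynomial.X ^ n : Polynomial ℝ) : PowerSeries ℝ) * s) := by
      push_cast; ring
    simp only [h, PowerSeries.coeff_succ_X_mul]
    simpa using ih

/-- Evaluating the recurrence at 1 turns it into a product of two power series, and the absence of
zero divisors forces d = 0. If the first factor degenerates at 1, a common factor X - 1 is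
cancelled, by induction on the degree of M 0. -/
theorem sum_eq_zero_of_polynomial_recurrence {B : ℕ} {M N : (Fin m →₀ ℕ) → Polynomial ℝ}
    {D : (Fin m →₀ ℕ) → PowerSeries ℝ} {d : (Fin m →₀ ℕ) → ℝ}
    (hN : ∀ α, B < α.degree → N α = 0) (hM0 : M 0 ≠ 0)
    (hMD : ∀ α, ∑ p ∈ Finset.HasAntidiagonal.antidiagonal α, (M p.1 : PowerSeries ℝ) * D p.2 = N α)
    (hd : ∀ α, HasSum (fun i => PowerSeries.coeff i (D α)) (d α))
    (h0 : ∀ α, α.degree ≤ B → d α = 0) (α : Fin m →₀ ℕ) : d α = 0 := by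
  induction hn : (M 0).natDegree using Nat.strong_induction_on generalizing M N with
  | _ n ih =>
  have hev : ∀ α, (N α).eval 1
      = ∑ p ∈ Finset.HasAntidiagonal.antidiagonal α, (M p.1).eval 1 * d p.2 := by
    intro α
    have h1 : HasSum (fun i => PowerSeries.coeff i (N α : PowerSeries ℝ))
        (∑ p ∈ Finset.HasAntidiagonal.antidiagonal α, (M p.1).eval 1 * d p.2) := by
      rw [← hMD]
      simp only [map_sum]
      exact hasSum_sum fun p _ => hasSum_coeff_polynomial_mul _ (hd _)
    have h2 : HasSum (fun i => PowerSeries.coeff i (N α : PowerSeries ℝ)) ((N α).eval 1) := by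
      have h3 : HasSum (fun i => PowerSeries.coeff i (1 : PowerSeries ℝ)) 1 := by
        simp only [PowerSeries.coeff_one]
        exact hasSum_ite_eq 0 1
      simpa using hasSum_coeff_polynomial_mul (N α) h3
    exact h2.unique h1
  by_cases hm : ∃ β, (M β).eval 1 ≠ 0
  · obtain ⟨β, hβ⟩ := hm
    let m1 : MvPowerSeries (Fin m) ℝ := fun β => (M β).eval 1
    let d1 : MvPowerSeries (Fin m) ℝ := d
    -- In degrees above B the product is N evaluated at 1, hence zero; in degrees up to B every d
    -- that occurs has degree at most B itself.
    have hprod : m1 * d1 = 0 := by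
      ext α
      rw [MvPowerSeries.coeff_mul, map_zero]
      change ∑ p ∈ Finset.HasAntidiagonal.antidiagonal α, (M p.1).eval 1 * d p.2 = 0
      by_cases hα : B < α.degree
      · rw [← hev, hN α hα, Polynomial.eval_zero]
      · refine Finset.sum_eq_zero fun p hp => ?_
        rw [Finset.HasAntidiagonal.mem_antidiagonal] at hp
        rw [h0, mul_zero]
        have := congrArg Finsupp.degree hp
        rw [map_add] at this
        omega
    have hm1 : m1 ≠ 0 := fun h => hβ (congrFun h β)
    have hd1 : d1 = 0 := (mul_eq_zero.1 hprod).resolve_left hm1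
    exact congrFun hd1 α
  -- All M β vanish at 1, hence by `hev` so do all N β. Cancelling X - 1 leaves D and d untouched.
  · push Not at hm
    have hM' : ∀ β, ∃ q, M β = (Polynomial.X - Polynomial.C 1) * q := fun β =>
      Polynomial.dvd_iff_isRoot.2 (hm β)
    have hN' : ∀ β, ∃ q, N β = (Polynomial.X - Polynomial.C 1) * q := fun β =>
      Polynomial.dvd_iff_isRoot.2 (by rw [Polynomial.IsRoot, hev]; simp [hm])
    choose M' hM' using hM'
    choose N' hN' using hN'
    have hX : (Polynomial.X - Polynomial.C 1 : Polynomial ℝ) ≠ 0 := Polynomial.X_sub_C_ne_zero 1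
    have hX' : ((Polynomial.X - Polynomial.C 1 : Polynomial ℝ) : PowerSeries ℝ) ≠ 0 := by
      rwa [Ne, Polynomial.coe_eq_zero_iff]
    have hM'0 : M' 0 ≠ 0 := by
      intro h
      rw [hM', h, mul_zero] at hM0
      exact hM0 rfl
    refine ih (M' 0).natDegree ?_ (M := M') (N := N') ?_ hM'0 ?_ rfl
    · rw [← hn, hM' 0, Polynomial.natDegree_mul hX hM'0, Polynomial.natDegree_X_sub_C]
      omega
    · intro α hα
      have := hN α hα
      rw [hN'] at this
      exact (mul_eq_zero.1 this).resolve_left hX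
    · intro α
      have h := hMD α
      simp only [hM', hN', Polynomial.coe_mul, mul_assoc] at h
      rw [← Finset.mul_sum] at h
      exact mul_left_cancel₀ hX' h

theorem RatBound.sum_slice_eq_zero {B : ℕ} {F : MvPowerSeries (Fin (m + 1)) ℝ} (hF : RatBound B F)
    {d : (Fin m →₀ ℕ) → ℝ} (hd : ∀ α, HasSum (fun i => PowerSeries.coeff i (slice α F)) (d α))
    (h0 : ∀ α, α.degree ≤ B → d α = 0) (α : Fin m →₀ ℕ) : d α = 0 := by
  obtain ⟨M, N, hM, hN, hM0, hMN⟩ := hF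
  obtain ⟨p, hp1, hp2, hp3⟩ := exists_slice_polynomial M hM
  obtain ⟨q, hq1, hq2, hq3⟩ := exists_slice_polynomial N hN
  refine sum_eq_zero_of_polynomial_recurrence hq3 (M := p) ?_ ?_ hd h0 α
  · intro h
    have h1 := congrArg (PowerSeries.coeff 0) (hp1 0)
    rw [h, coeff_slice, MvPolynomial.coeff_coe] at h1
    refine hM0 ?_
    rw [MvPolynomial.constantCoeff_eq]
    simpa using h1.symm
  · intro α
    rw [hq1, ← hMN, slice_mul]
    simp only [hp1]

/-- The recurrence expresses p_0 times a slice by slices of smaller degree, so p_0^(|α| + 1) is a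
denominator for the slice at α. Its constant term is a power of that of M, hence nonzero. -/
theorem RatBound.exists_slice_quotient {B : ℕ} {F : MvPowerSeries (Fin (m + 1)) ℝ}
    (hF : RatBound B F) (α : Fin m →₀ ℕ) :
    ∃ a b : Polynomial ℝ, a.natDegree ≤ (α.degree + 1) * B ∧ b.natDegree ≤ (α.degree + 1) * B ∧
      b.coeff 0 ≠ 0 ∧ (b : PowerSeries ℝ) * slice α F = a := by
  obtain ⟨M, N, hM, hN, hM0, hMN⟩ := hF
  obtain ⟨p, hp1, hp2, hp3⟩ := exists_slice_polynomial M hM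
  obtain ⟨q, hq1, hq2, hq3⟩ := exists_slice_polynomial N hN
  have hp0 : (p 0).coeff 0 ≠ 0 := by
    have h1 := congrArg (PowerSeries.coeff 0) (hp1 0)
    rw [coeff_slice, MvPolynomial.coeff_coe, Polynomial.coeff_coe] at h1
    rw [h1]
    rw [MvPolynomial.constantCoeff_eq] at hM0
    simpa using hM0
  have hrec : ∀ α, ∑ x ∈ Finset.HasAntidiagonal.antidiagonal α,
      (p x.1 : PowerSeries ℝ) * slice x.2 F = q α := by
    intro α
    rw [hq1, ← hMN, slice_mul]
    simp only [hp1]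
  have key : ∀ n, ∀ α : Fin m →₀ ℕ, α.degree = n → ∃ a : Polynomial ℝ,
      a.natDegree ≤ (n + 1) * B ∧ (p 0 ^ (n + 1) : PowerSeries ℝ) * slice α F = a := by
    intro n
    induction n using Nat.strong_induction_on with
    | _ n ih =>
    intro α hα
    have hterm : ∀ x ∈ (Finset.HasAntidiagonal.antidiagonal α).erase (0, α), ∃ a : Polynomial ℝ,
        a.natDegree ≤ (n + 1) * B ∧
          (p 0 ^ n : PowerSeries ℝ) * ((p x.1 : PowerSeries ℝ) * slice x.2 F) = a := by
      rintro ⟨β, γ⟩ hx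
      rw [Finset.mem_erase, Finset.HasAntidiagonal.mem_antidiagonal] at hx
      obtain ⟨hne, hsum⟩ := hx
      have hdeg := congrArg Finsupp.degree hsum
      simp only [map_add] at hdeg hsum
      have hβ : β.degree ≠ 0 := by
        rw [Ne, Finsupp.degree_eq_zero_iff]
        rintro rfl
        rw [zero_add] at hsum
        exact hne (by rw [hsum])
      obtain ⟨a, ha1, ha2⟩ := ih γ.degree (by omega) γ rfl
      -- As β ≠ 0, the degree of γ is below n; the spare factor p_0^j brings all terms to the same
      -- denominator.
      obtain ⟨j, hj⟩ : ∃ j, n = j + (γ.degree + 1) := ⟨n - (γ.degree + 1), by omega⟩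
      refine ⟨p 0 ^ j * p β * a, ?_, ?_⟩
      · calc _ ≤ j * B + B + (γ.degree + 1) * B := by
              refine Polynomial.natDegree_mul_le.trans (add_le_add
                (Polynomial.natDegree_mul_le.trans (add_le_add ?_ (hp2 β))) ha1)
              exact Polynomial.natDegree_pow_le.trans (Nat.mul_le_mul_left _ (hp2 0))
          _ = _ := by rw [hj]; ring
      · push_cast
        rw [← ha2, hj, pow_add]
        ring
    choose! f hf1 hf2 using hterm
    refine ⟨p 0 ^ n * q α - ∑ x ∈ (Finset.HasAntidiagonal.antidiagonal α).erase (0, α), f x, ?_, ?_⟩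
    · refine (Polynomial.natDegree_sub_le _ _).trans (max_le ?_ ?_)
      · refine Polynomial.natDegree_mul_le.trans ?_
        rw [add_mul, one_mul]
        exact add_le_add (Polynomial.natDegree_pow_le.trans (Nat.mul_le_mul_left _ (hp2 0))) (hq2 α)
      · exact Polynomial.natDegree_sum_le_of_forall_le _ _ fun x hx => hf1 x hx
    · have h := hrec α
      rw [← Finset.add_sum_erase _ _ (show ((0 : Fin m →₀ ℕ), α) ∈
        Finset.HasAntidiagonal.antidiagonal α by
          rw [Finset.HasAntidiagonal.mem_antidiagonal]; exact zero_add α)] at h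
      have h1 : ((∑ x ∈ (Finset.HasAntidiagonal.antidiagonal α).erase (0, α), f x : Polynomial ℝ) :
          PowerSeries ℝ) = ∑ x ∈ (Finset.HasAntidiagonal.antidiagonal α).erase (0, α),
            (p 0 ^ n : PowerSeries ℝ) * ((p x.1 : PowerSeries ℝ) * slice x.2 F) := by
        rw [← Polynomial.coeToPowerSeries.ringHom_apply, map_sum]
        exact Finset.sum_congr rfl fun x hx => by
          rw [Polynomial.coeToPowerSeries.ringHom_apply, hf2 x hx]
      rw [Polynomial.coe_sub, h1, ← Finset.mul_sum, Polynomial.coe_mul, Polynomial.coe_pow, ← h]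
      ring
  obtain ⟨a, ha1, ha2⟩ := key α.degree α rfl
  refine ⟨a, p 0 ^ (α.degree + 1), ha1, ?_, ?_, ?_⟩
  · exact Polynomial.natDegree_pow_le.trans (Nat.mul_le_mul_left _ (hp2 0))
  · rw [Polynomial.coeff_zero_eq_eval_zero, Polynomial.eval_pow,
      ← Polynomial.coeff_zero_eq_eval_zero]
    exact pow_ne_zero _ hp0
  · rw [Polynomial.coe_pow]; exact ha2

end Slices


/-! ### The generating function of all inputs and the defect of a loop invariant -/

section Defect

variable {k : ℕ}

/-- The index of the indeterminate of a program variable; the index `0` is the ghost variable. -/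
def progVar (i : Fin k) : Fin (k + k + 1) := (Fin.castAdd k i).succ

/-- The index of the indeterminate that records the input value of a program variable. -/
def inputVar (i : Fin k) : Fin (k + k + 1) := (Fin.natAdd k i).succ

theorem progVar_ne_zero (i : Fin k) : progVar i ≠ 0 := Fin.succ_ne_zero _

theorem inputVar_ne_zero (i : Fin k) : inputVar i ≠ 0 := Fin.succ_ne_zero _

theorem progVar_ne_inputVar (i j : Fin k) : progVar i ≠ inputVar j := by
  intro h
  have := congrArg Fin.val h
  simp [progVar, inputVar] at this
  omega

theorem progVar_injective : Function.Injective (progVar (k := k)) := fun i j h => by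
  simpa [progVar] using h

theorem inputVar_injective : Function.Injective (inputVar (k := k)) := fun i j h => by
  simpa [inputVar] using h

theorem eq_zero_or_progVar_or_inputVar (j : Fin (k + k + 1)) :
    j = 0 ∨ (∃ i, j = progVar i) ∨ ∃ i, j = inputVar (k := k) i := by
  refine Fin.cases (Or.inl rfl) (fun j => Or.inr ?_) j
  refine Fin.addCases (fun i => Or.inl ⟨i, rfl⟩) (fun i => Or.inr ⟨i, rfl⟩) j

open Classical in
/-- The product of the geometric series `1 / (1 - X_i U_i)` over all `i ∈ S`. -/
noncomputable def diagSeries (S : Finset (Fin k)) : MvPowerSeries (Fin (k + k + 1)) ℝ :=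
  fun e => if e 0 = 0 ∧ (∀ i, e (progVar i) = e (inputVar i)) ∧ ∀ i ∉ S, e (progVar i) = 0
    then 1 else 0

open Classical in
theorem coeff_diagSeries (S : Finset (Fin k)) (e : Fin (k + k + 1) →₀ ℕ) :
    MvPowerSeries.coeff e (diagSeries S) = if e 0 = 0 ∧
      (∀ i, e (progVar i) = e (inputVar i)) ∧ ∀ i ∉ S, e (progVar i) = 0 then 1 else 0 := rfl

theorem diagSeries_empty : diagSeries (∅ : Finset (Fin k)) = 1 := by
  classical
  ext e
  rw [coeff_diagSeries, MvPowerSeries.coeff_one]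
  congr 1
  simp only [eq_iff_iff]
  constructor
  · rintro ⟨h0, h1, h2⟩
    ext j
    rcases eq_zero_or_progVar_or_inputVar j with rfl | ⟨i, rfl⟩ | ⟨i, rfl⟩
    · exact h0
    · exact h2 i (by simp)
    · rw [← h1]; exact h2 i (by simp)
  · rintro rfl
    simp

/-- A geometric series telescopes: multiplication by X_i U_i moves along the diagonal in direction
i, and only the terms with exponent zero in that direction survive the difference. -/
theorem one_sub_mul_diagSeries_insert (S : Finset (Fin k)) {i : Fin k} (hi : i ∉ S) :
    (1 - MvPowerSeries.X (progVar i) * MvPowerSeries.X (inputVar i)) * diagSeries (insert i S)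
      = diagSeries S := by
  classical
  have hpi := progVar_ne_inputVar i i
  ext e
  rw [sub_mul, one_mul, map_sub, MvPowerSeries.X, MvPowerSeries.X,
    MvPowerSeries.monomial_mul_monomial, MvPowerSeries.coeff_monomial_mul, mul_one, one_mul]
  set s : Fin (k + k + 1) →₀ ℕ := Finsupp.single (progVar i) 1 + Finsupp.single (inputVar i) 1 with hs
  have hs1 : s (progVar i) = 1 := by simp [hs, hpi]
  have hs2 : s (inputVar i) = 1 := by simp [hs, hpi.symm]
  have hs3 : ∀ j, j ≠ progVar i → j ≠ inputVar i → s j = 0 := fun j h1 h2 => by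
    simp [hs, h1.symm, h2.symm]
  have hle : s ≤ e ↔ 1 ≤ e (progVar i) ∧ 1 ≤ e (inputVar i) := by
    constructor
    · intro h
      exact ⟨hs1.symm.le.trans (h _), hs2.symm.le.trans (h _)⟩
    · rintro ⟨h1, h2⟩ j
      by_cases hj : j = progVar i
      · subst hj; omega
      · by_cases hj' : j = inputVar i
        · subst hj'; omega
        · rw [hs3 j hj hj']; exact Nat.zero_le _
  simp only [coeff_diagSeries]
  by_cases h1 : e (progVar i) = 0
  · rw [if_neg (c := s ≤ e) (fun h => by have := (hle.1 h).1; omega), sub_zero]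
    congr 1
    simp only [eq_iff_iff, Finset.mem_insert, not_or]
    refine and_congr_right fun _ => and_congr_right fun _ => ⟨fun h j hj => ?_, fun h j hj => h j hj.2⟩
    by_cases hji : j = i
    · subst hji; exact h1
    · exact h j ⟨hji, hj⟩
  · have hR : ¬ (e 0 = 0 ∧ (∀ j, e (progVar j) = e (inputVar j)) ∧
        ∀ j ∉ S, e (progVar j) = 0) := fun h => h1 (h.2.2 i hi)
    rw [if_neg hR]
    by_cases h2 : e (inputVar i) = 0
    · rw [if_neg (c := s ≤ e) (fun h => by have := (hle.1 h).2; omega), sub_zero, if_neg]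
      rintro ⟨-, h, -⟩
      exact h1 ((h i).trans h2)
    · rw [if_pos (c := s ≤ e) (hle.2 ⟨by omega, by omega⟩), sub_eq_zero]
      congr 1
      simp only [eq_iff_iff, Finsupp.tsub_apply, hs3 0 (progVar_ne_zero i).symm
        (inputVar_ne_zero i).symm, Nat.sub_zero, Finset.mem_insert, not_or]
      refine and_congr_right fun _ => and_congr (forall_congr' fun j => ?_)
        (forall_congr' fun j => ⟨fun h hj => ?_, fun h hj => ?_⟩)
      · by_cases hji : j = i
        · subst hji; rw [hs1, hs2]; omega
        · rw [hs3 _ (progVar_injective.ne hji) (progVar_ne_inputVar _ _),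
            hs3 _ (progVar_ne_inputVar _ _).symm (inputVar_injective.ne hji)]
          rfl
      · rw [h hj, Nat.zero_sub]
      · have := h hj
        rwa [hs3 _ (progVar_injective.ne hj.1) (progVar_ne_inputVar _ _), Nat.sub_zero] at this

/-- The denominator is a product of at most k factors 1 - X_i U_i, each of degree at most 2 and with
constant term 1. -/
theorem RatBound.diagSeries (S : Finset (Fin k)) : RatBound (2 * k) (diagSeries S) := by
  have key : ∀ S : Finset (Fin k), (((∏ i ∈ S,
      (1 - MvPolynomial.X (progVar i) * MvPolynomial.X (inputVar i)) :
      MvPolynomial (Fin (k + k + 1)) ℝ)) : MvPowerSeries (Fin (k + k + 1)) ℝ)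
        * _root_.diagSeries S = 1 := by
    intro S
    induction S using Finset.induction_on with
    | empty => simp [diagSeries_empty]
    | insert i S hi ih =>
      rw [Finset.prod_insert hi, MvPolynomial.coe_mul, mul_right_comm, mul_comm _ (_root_.diagSeries _)]
      have h : ((1 - MvPolynomial.X (progVar i) * MvPolynomial.X (inputVar i) :
          MvPolynomial (Fin (k + k + 1)) ℝ) : MvPowerSeries (Fin (k + k + 1)) ℝ)
          = 1 - MvPowerSeries.X (progVar i) * MvPowerSeries.X (inputVar i) := by
        rw [← MvPolynomial.coeToMvPowerSeries.ringHom_apply, map_sub, map_mul, map_one]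
        simp
      rw [h, mul_comm (_root_.diagSeries _), one_sub_mul_diagSeries_insert S hi, mul_comm, ih]
  refine ⟨_, 1, ?_, by simp, ?_, by rw [key S, MvPolynomial.coe_one]⟩
  · refine (MvPolynomial.totalDegree_finsetProd _ _).trans ?_
    have h1 : ∀ i ∈ S, (1 - MvPolynomial.X (progVar i) * MvPolynomial.X (inputVar i) :
        MvPolynomial (Fin (k + k + 1)) ℝ).totalDegree ≤ 2 := by
      intro i _
      refine (MvPolynomial.totalDegree_sub _ _).trans (max_le (by simp) ?_)
      refine (MvPolynomial.totalDegree_mul _ _).trans ?_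
      simp
    refine (Finset.sum_le_card_nsmul _ _ 2 h1).trans ?_
    have := Finset.card_le_univ S
    rw [Fintype.card_fin] at this
    rw [smul_eq_mul]; omega
  · rw [map_prod]
    refine Finset.prod_ne_zero_iff.2 fun i _ => ?_
    simp

/-- The difference of `⟦I⟧` and `if (φ) {P; I}`, with ghost variable, on the generating function of
all inputs. -/
noncomputable def defectSeries (φ : Guard k) (P I : Prog k) : MvPowerSeries (Fin (k + k + 1)) ℝ :=
  ghostOp progVar 0 I (diagSeries Finset.univ)
    - (resOp (fun e => !φ.eval (pullState progVar e)) (diagSeries Finset.univ)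
      + ghostOp progVar 0 I (ghostOp progVar 0 P
        (resOp (fun e => φ.eval (pullState progVar e)) (diagSeries Finset.univ))))

/-- A degree bound for `defectSeries` in terms of codes. -/
def defectBound (k a b c : ℕ) : ℕ :=
  (codeBound c + (codeBound a + 1 + codeBound c * (codeBound b * (codeBound a + 1) + 1)))
    * (2 * k + 1)

theorem RatBound.defectSeries (φ : Guard k) (P I : Prog k) :
    RatBound (defectBound k φ.code P.code I.code) (defectSeries φ P I) := by
  have hg := RatBound.diagSeries (Finset.univ : Finset (Fin k))
  have hI := I.linBound (v := progVar) (z := 0) progVar_ne_zero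
  have hP := P.linBound (v := progVar) (z := 0) progVar_ne_zero
  have hφ := φ.linBound (progVar (k := k))
  have h := (hI _ _ hg).sub ((hφ.resOp_not.add (hI.comp (hP.comp hφ))) _ _ hg)
  rw [← add_mul] at h
  exact h

end Defect


/-! ### Coefficients of the transformers of elementary programs -/

namespace PGF

variable {ι : Type} [DecidableEq ι]

theorem coe_prod_pow (h : ι → PGF ι) (σ : ι →₀ ℕ) :
    ((σ.prod fun i n => h i ^ n : PGF ι) : MvPowerSeries ι ℝ) = σ.prod fun i n => (h i).1 ^ n := by
  simp [Finsupp.prod]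

theorem coeff_eq (g : PGF ι) (σ : ι →₀ ℕ) : g.coeff σ = MvPowerSeries.coeff σ g.1 := rfl

theorem coeff_subst (g : PGF ι) (h : ι → PGF ι) (τ : ι →₀ ℕ) :
    (g.subst h).coeff τ = ∑' σ, g.coeff σ *
      MvPowerSeries.coeff τ (σ.prod fun i n => (h i).1 ^ n) := by
  simp only [← coe_prod_pow]
  rfl

theorem update_coe (h : ι → PGF ι) (x : ι) (b : PGF ι) (i : ι) :
    (Function.update h x b i).1 = Function.update (fun i => (h i).1) x b.1 i := by
  by_cases hi : i = x
  · subst hi; simp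
  · simp [hi]

theorem coe_X (i : ι) : (X i : PGF ι).1 = MvPowerSeries.X i := rfl

/-- Substituting 1 marginalizes over x: the states that contribute to τ are exactly those that agree
with it off x. -/
theorem coeff_subst_one (g : PGF ι) (x : ι) (τ : ι →₀ ℕ) :
    (g.subst₁ x 1).coeff τ = if τ x = 0 then ∑' i, g.coeff (τ.update x i) else 0 := by
  rw [subst₁, coeff_subst]
  simp only [update_coe, coe_X]
  have h : ∀ σ : ι →₀ ℕ, MvPowerSeries.coeff τ (σ.prod fun i n =>
      (Function.update (fun i => MvPowerSeries.X i) x (1 : PGF ι).1 i : MvPowerSeries ι ℝ) ^ n)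
        = if τ = σ.erase x then 1 else 0 := by
    intro σ
    rw [prod_update_pow, prod_X_pow_eq_monomial]
    rw [show (1 : PGF ι).1 = 1 from rfl, one_pow, mul_one, MvPowerSeries.coeff_monomial]
  simp only [h]
  split_ifs with hx
  · have hinj : Function.Injective fun i => τ.update x i := fun i j hij => by
      simpa using DFunLike.congr_fun hij x
    rw [← hinj.tsum_eq]
    · refine tsum_congr fun i => ?_
      rw [if_pos, mul_one]
      ext j
      by_cases hj : j = x
      · subst hj; simp [hx]
      · simp [hj]
    · intro σ hσ
      rw [Function.mem_support] at hσ
      have h1 : τ = σ.erase x := by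
        by_contra h1
        rw [if_neg h1, mul_zero] at hσ
        exact hσ rfl
      refine ⟨σ x, ?_⟩
      ext j
      by_cases hj : j = x
      · subst hj; simp
      · simp [h1]
  · have h0 : ∀ σ : ι →₀ ℕ, g.coeff σ * (if τ = σ.erase x then 1 else 0) = 0 := fun σ => by
      rw [if_neg, mul_zero]
      rintro rfl
      simp at hx
    simp only [h0, tsum_zero]

theorem coeff_assign (g : PGF ι) (x : ι) (n : ℕ) (τ : ι →₀ ℕ) :
    (g.subst₁ x 1 * X x ^ n).coeff τ = if τ x = n then ∑' i, g.coeff (τ.update x i) else 0 := by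
  have h : (g.subst₁ x 1 * X x ^ n).1 = (g.subst₁ x 1).1 * MvPowerSeries.X x ^ n := rfl
  rw [coeff_eq, h, MvPowerSeries.X_pow_eq, MvPowerSeries.coeff_mul_monomial, mul_one, ← coeff_eq,
    coeff_subst_one]
  simp only [Finsupp.single_le_iff]
  by_cases h1 : τ x = n
  · rw [if_pos h1, if_pos h1.ge, if_pos (by simp [h1])]
    refine tsum_congr fun i => congrArg _ ?_
    ext j
    by_cases hj : j = x
    · subst hj; simp
    · simp [hj]
  · rw [if_neg h1]
    split_ifs with h2 h3
    · simp at h3; omega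
    · rfl
    · rfl

theorem coe_subst_X (D : DistExpr) (x : ι) :
    (D.sem.subst fun _ => X x).1 = PowerSeries.subst (MvPowerSeries.X x) D.ser := by
  ext τ
  rw [PowerSeries.coeff_subst_single]
  have h : ∀ s : Unit →₀ ℕ, (s.prod fun _ n => (X x : PGF ι) ^ n).coeff τ
      = if τ = Finsupp.single x (s ()) then 1 else 0 := by
    intro s
    have h1 : (s.prod fun _ n => (X x : PGF ι) ^ n) = X x ^ s () := by
      rw [Finsupp.prod_fintype _ _ (fun _ => pow_zero _)]
      simp
    rw [h1]
    change MvPowerSeries.coeff τ ((MvPowerSeries.X x : MvPowerSeries ι ℝ) ^ s ()) = _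
    rw [MvPowerSeries.coeff_X_pow]
  change ∑' s, D.sem.coeff s * (s.prod fun _ n => (X x : PGF ι) ^ n).coeff τ = _
  simp only [h]
  rw [tsum_eq_single (Finsupp.single () (τ x))]
  · simp only [Finsupp.single_eq_same]
    split_ifs
    · rw [mul_one]; rfl
    · rw [mul_zero]
  · intro s hs
    rw [if_neg, mul_zero]
    intro h1
    refine hs ?_
    ext
    simp [h1]

theorem coeff_iid (g : PGF ι) (x : ι) (D : DistExpr) (y : ι) (τ : ι →₀ ℕ) :
    (g.subst₁ y (X y * D.sem.subst fun _ => X x)).coeff τ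
      = ∑ p ∈ Finset.HasAntidiagonal.antidiagonal (τ x),
        g.coeff (τ.update x p.1) * PowerSeries.coeff p.2 (D.ser ^ (τ.update x p.1) y) := by
  have h1 : (X y * D.sem.subst fun _ => X x : PGF ι).1
      = MvPowerSeries.X y * PowerSeries.subst (MvPowerSeries.X x) D.ser := by
    rw [← coe_subst_X]; rfl
  have h2 : ∀ σ : ι →₀ ℕ, (σ.prod fun i n =>
      (Function.update X y (X y * D.sem.subst fun _ => X x) i : PGF ι).1 ^ n)
        = MvPowerSeries.monomial σ 1 * PowerSeries.subst (MvPowerSeries.X x) (D.ser ^ σ y) := by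
    intro σ
    rw [← prod_update_X_mul_subst]
    simp only [update_coe, coe_X, h1]
  rw [subst₁, coeff_subst]
  simp only [h2, coeff_monomial_mul_subst]
  have hne : ∀ σ : ι →₀ ℕ, g.coeff σ * (open Classical in if (∀ i ≠ x, σ i = τ i) ∧ σ x ≤ τ x then
      PowerSeries.coeff (τ x - σ x) (D.ser ^ σ y) else 0) ≠ 0 →
      (∀ i ≠ x, σ i = τ i) ∧ σ x ≤ τ x := by
    intro σ hσ
    by_contra h
    rw [if_neg h, mul_zero] at hσ
    exact hσ rfl
  -- Only finitely many states contribute to τ, since the variable x never decreases and the others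
  -- keep their values.
  rw [tsum_eq_finsum, finsum_antidiagonal_update τ x _ hne]
  · refine Finset.sum_congr rfl fun p hp => ?_
    rw [Finset.HasAntidiagonal.mem_antidiagonal] at hp
    have h : τ x - (τ.update x p.1) x = p.2 := by simp; omega
    rw [if_pos, h]
    exact ⟨fun i hi => by simp [hi], by simp; omega⟩
  · refine Set.Finite.subset ((Finset.HasAntidiagonal.antidiagonal (τ x)).image
      fun p => τ.update x p.1).finite_toSet fun σ hσ => ?_
    obtain ⟨h3, h4⟩ := hne σ hσ
    simp only [Finset.coe_image, Set.mem_image, Finset.mem_coe,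
      Finset.HasAntidiagonal.mem_antidiagonal]
    refine ⟨(σ x, τ x - σ x), by simp; omega, ?_⟩
    ext i
    by_cases hi : i = x
    · subst hi; simp
    · simp [hi, h3 i hi]

theorem coeff_decr (g : PGF ι) (x : ι) (τ : ι →₀ ℕ) :
    (g.decr x).coeff τ = g.coeff (τ + Finsupp.single x 1) + if τ x = 0 then g.coeff τ else 0 :=
  coeff_decr_aux g x τ

end PGF

/-- Powers of a PGF are again PGF. -/
theorem DistExpr.coeff_ser_pow_nonneg (D : DistExpr) (n m : ℕ) :
    0 ≤ PowerSeries.coeff m (D.ser ^ n) :=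
  (D.sem ^ n).coeff_nonneg (Finsupp.single () m)

/-! ### Linearity of the transformers of loop-free programs -/

section Linearity

variable {ι : Type}

/-- `T` is given by a nonnegative kernel. -/
def HasKernel (T : PGF ι → (ι →₀ ℕ) → ℝ) : Prop :=
  (∀ g τ, 0 ≤ T g τ) ∧ ∃ κ : (ι →₀ ℕ) → (ι →₀ ℕ) → ENNReal,
    ∀ g τ, ENNReal.ofReal (T g τ) = ∑' σ, ENNReal.ofReal (g.coeff σ) * κ σ τ

/-- Different indices b may point to the same input state; the kernel collects their weights. The
sum is taken in `ENNReal`, where no summability in σ or τ has to be checked. -/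
theorem HasKernel.of_hasSum {T : PGF ι → (ι →₀ ℕ) → ℝ} {β : Type} (s : (ι →₀ ℕ) → β → ι →₀ ℕ)
    (w : (ι →₀ ℕ) → β → ℝ) (hw : ∀ τ b, 0 ≤ w τ b)
    (hT : ∀ g τ, HasSum (fun b => g.coeff (s τ b) * w τ b) (T g τ)) : HasKernel T := by
  classical
  refine ⟨fun g τ => (hT g τ).nonneg fun b => mul_nonneg (g.coeff_nonneg _) (hw _ _),
    fun σ τ => ∑' b, if σ = s τ b then ENNReal.ofReal (w τ b) else 0, fun g τ => ?_⟩
  rw [← (hT g τ).tsum_eq, ENNReal.ofReal_tsum_of_nonneg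
    (fun b => mul_nonneg (g.coeff_nonneg _) (hw _ _)) (hT g τ).summable]
  simp only [← ENNReal.tsum_mul_left]
  rw [ENNReal.tsum_comm]
  refine tsum_congr fun b => ?_
  rw [tsum_eq_single (s τ b) fun σ hσ => by rw [if_neg hσ, mul_zero], if_pos rfl,
    ENNReal.ofReal_mul (g.coeff_nonneg _)]

/-- The value on the monomial with exponent σ is the row of the kernel at σ. Hence the kernels
agree, and with them the transformers. -/
theorem HasKernel.eq_of_monomial {T T' : PGF ι → (ι →₀ ℕ) → ℝ} (hT : HasKernel T)
    (hT' : HasKernel T') (h : ∀ σ τ, T (PGF.monomial σ) τ = T' (PGF.monomial σ) τ) : T = T' := by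
  classical
  obtain ⟨h0, κ, hκ⟩ := hT
  obtain ⟨h0', κ', hκ'⟩ := hT'
  have hmon : ∀ (κ : (ι →₀ ℕ) → (ι →₀ ℕ) → ENNReal) (σ τ : ι →₀ ℕ),
      ∑' ρ, ENNReal.ofReal ((PGF.monomial σ).coeff ρ) * κ ρ τ = κ σ τ := by
    intro κ σ τ
    have h1 : ∀ ρ, (PGF.monomial σ).coeff ρ = if ρ = σ then 1 else 0 := fun ρ =>
      MvPowerSeries.coeff_monomial _ _ _
    rw [tsum_eq_single σ fun ρ hρ => by rw [h1, if_neg hρ]; simp, h1, if_pos rfl]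
    simp
  have hk : κ = κ' := by
    ext σ τ
    rw [← hmon κ, ← hmon κ', ← hκ, ← hκ', h]
  funext g τ
  have := (hκ g τ).trans ((hk ▸ rfl : _ = _).trans (hκ' g τ).symm)
  rwa [ENNReal.ofReal_eq_ofReal_iff (h0 _ _) (h0' _ _)] at this

theorem HasKernel.comp {S : PGF ι → (ι →₀ ℕ) → ℝ} {T : PGF ι → PGF ι} (hS : HasKernel S)
    (hT : HasKernel fun g => (T g).coeff) : HasKernel fun g => S (T g) := by
  obtain ⟨h0, κ, hκ⟩ := hS
  obtain ⟨h0', κ', hκ'⟩ := hT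
  refine ⟨fun g => h0 _, fun σ τ => ∑' ρ, κ' σ ρ * κ ρ τ, fun g τ => ?_⟩
  rw [hκ]
  simp only [hκ', ← ENNReal.tsum_mul_left, ← ENNReal.tsum_mul_right]
  rw [ENNReal.tsum_comm]
  simp only [mul_assoc]

theorem HasKernel.add {S T : PGF ι → (ι →₀ ℕ) → ℝ} (hS : HasKernel S) (hT : HasKernel T) :
    HasKernel fun g τ => S g τ + T g τ := by
  obtain ⟨h0, κ, hκ⟩ := hS
  obtain ⟨h0', κ', hκ'⟩ := hT
  refine ⟨fun g τ => add_nonneg (h0 _ _) (h0' _ _), fun σ τ => κ σ τ + κ' σ τ, fun g τ => ?_⟩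
  rw [ENNReal.ofReal_add (h0 _ _) (h0' _ _), hκ, hκ', ← ENNReal.tsum_add]
  simp only [mul_add]

theorem HasKernel.restrict (p : (ι →₀ ℕ) → Bool) :
    HasKernel fun g : PGF ι => (g.restrict p).coeff := by
  refine HasKernel.of_hasSum (β := Unit) (fun τ _ => τ) (fun τ _ => if p τ then 1 else 0)
    (fun τ _ => by split_ifs <;> norm_num) fun g τ => ?_
  simp [PGF.coeff_restrict]

theorem Prog.hasKernel {k : ℕ} {P : Prog k} (hP : P.LoopFree) :
    HasKernel fun g => (P.sem g).coeff := by
  induction P with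
  | assign x n =>
    refine HasKernel.of_hasSum (β := ℕ) (fun τ i => τ.update x i)
      (fun τ _ => if τ x = n then 1 else 0) (fun τ _ => by split_ifs <;> norm_num) fun g τ => ?_
    change HasSum _ ((g.subst₁ x 1 * PGF.X x ^ n).coeff τ)
    rw [PGF.coeff_assign]
    split_ifs with h
    · simp only [mul_one]
      refine (g.summable_coeff.comp_injective (i := fun i => τ.update x i) fun i j hij => ?_).hasSum
      simpa using DFunLike.congr_fun hij x
    · simp
  | decr x =>
    -- The index `true` stands for the mass that moves down by one, `false` for the mass that stays
    -- at zero.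
    refine HasKernel.of_hasSum (β := Bool) (fun τ b => if b then τ + Finsupp.single x 1 else τ)
      (fun τ b => if b then 1 else if τ x = 0 then 1 else 0)
      (fun τ b => by split_ifs <;> norm_num) fun g τ => ?_
    change HasSum _ ((g.decr x).coeff τ)
    rw [PGF.coeff_decr]
    simpa using hasSum_fintype fun b : Bool => g.coeff (if b then τ + Finsupp.single x 1 else τ) *
      if b then (1 : ℝ) else if τ x = 0 then 1 else 0
  | iid x D y =>
    exact HasKernel.of_hasSum (β := Fin k →₀ ℕ) (fun _ σ => σ)
      (fun τ σ => PGF.coeff (σ.prod fun i n => Function.update PGF.X y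
        (PGF.X y * D.sem.subst fun _ => PGF.X x) i ^ n) τ) (fun τ σ => PGF.coeff_nonneg _ _)
      fun g τ => (g.summable_family fun σ => (σ.prod fun i n => Function.update PGF.X y
        (PGF.X y * D.sem.subst fun _ => PGF.X x) i ^ n)).prod_symm.prod_factor τ |>.hasSum
  | ite φ P Q ihP ihQ =>
    exact ((ihP hP.1).comp (HasKernel.restrict φ.eval)).add
      ((ihQ hP.2).comp (HasKernel.restrict φ.neg.eval))
  | seq P Q ihP ihQ => exact (ihQ hP.2).comp (ihP hP.1)
  | loop φ P _ => exact hP.elim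

end Linearity


/-! ### Summing over the ghost variable -/

section Simulation

/-- Nonnegative double series may be summed along antidiagonals instead of rows. -/
theorem hasSum_sum_antidiagonal {f : ℕ × ℕ → ℝ} (h0 : ∀ p, 0 ≤ f p) {r : ℕ → ℝ}
    (h1 : ∀ i, HasSum (fun j => f (i, j)) (r i)) (h2 : Summable r) :
    HasSum (fun n => ∑ p ∈ Finset.HasAntidiagonal.antidiagonal n, f p) (∑' i, r i) := by
  have h3 : Summable f := by
    refine (summable_prod_of_nonneg h0).2 ⟨fun i => (h1 i).summable, ?_⟩
    simpa only [(h1 _).tsum_eq] using h2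
  have h4 : HasSum f (∑' i, r i) := by
    rw [(h3.hasSum.prod_fiberwise h1).tsum_eq]
    exact h3.hasSum
  have h6 := Finset.HasAntidiagonal.sigmaAntidiagonalEquivProd.hasSum_iff.2 h4
  exact h6.sigma fun n => Finset.hasSum (Finset.HasAntidiagonal.antidiagonal n) f

variable {ι : Type} [DecidableEq ι] {k : ℕ}

/-- On the exponents that satisfy `C`, the coefficients of `G` sum up to those of `g` over all
exponents of the ghost variable. -/
def Simulates (v : Fin k → ι) (z : ι) (C : (ι →₀ ℕ) → Prop) (G : MvPowerSeries ι ℝ)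
    (g : PGF (Fin k)) : Prop :=
  (∀ e, 0 ≤ MvPowerSeries.coeff e G) ∧
    ∀ e, C e → HasSum (fun ζ => MvPowerSeries.coeff (e.update z ζ) G) (g.coeff (pullState v e))

variable {v : Fin k → ι} {z : ι} {C : (ι →₀ ℕ) → Prop}

theorem pullState_update (hv : Function.Injective v) (e : ι →₀ ℕ) (x : Fin k) (n : ℕ) :
    pullState v (e.update (v x) n) = (pullState v e).update x n := by
  ext i
  by_cases hi : i = x
  · subst hi; simp
  · simp [hi, hv.ne hi]

theorem pullState_update_ghost (hz : ∀ i, v i ≠ z) (e : ι →₀ ℕ) (n : ℕ) :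
    pullState v (e.update z n) = pullState v e := by
  ext i
  simp [hz i]

theorem add_single_eq_update (e : ι →₀ ℕ) (x : ι) : e + Finsupp.single x 1 = e.update x (e x + 1) := by
  ext i
  by_cases hi : i = x
  · subst hi; simp
  · simp [hi]

theorem update_comm' (e : ι →₀ ℕ) {x y : ι} (h : x ≠ y) (a b : ℕ) :
    (e.update x a).update y b = (e.update y b).update x a := by
  ext i
  by_cases hi : i = y
  · subst hi; simp [h.symm]
  · by_cases hi' : i = x
    · subst hi'; simp [hi]
    · simp [hi, hi']

theorem update_update (e : ι →₀ ℕ) (x : ι) (a b : ℕ) :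
    (e.update x a).update x b = e.update x b := by
  ext i
  by_cases hi : i = x
  · subst hi; simp
  · simp [hi]

/-- The new ghost exponent is the overwritten value plus the old ghost exponent. Summing over it
amounts to a double sum over both, whose inner sums are the coefficients of g and whose outer sum is
the marginalization in the semantics. -/
theorem Simulates.asgOp (hv : Function.Injective v) (hz : ∀ i, v i ≠ z)
    (hC : ∀ e x n, C e → C (e.update (v x) n)) {G : MvPowerSeries ι ℝ} {g : PGF (Fin k)}
    (h : Simulates v z C G g) (x : Fin k) (n : ℕ) :
    Simulates v z C (asgOp (v x) z n G) (g.subst₁ x 1 * PGF.X x ^ n) := by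
  refine ⟨fun e => ?_, fun e he => ?_⟩
  · rw [coeff_asgOp]
    split_ifs
    · exact Finset.sum_nonneg fun _ _ => h.1 _
    · exact le_rfl
  · rw [PGF.coeff_assign]
    simp only [coeff_asgOp, Finsupp.update_apply, hz x, if_false, if_true, pullState_apply]
    have hu : ∀ ζ a b, ((e.update z ζ).update (v x) a).update z b = (e.update (v x) a).update z b := by
      intro ζ a b
      rw [update_comm' e (hz x).symm, update_update]
    simp only [hu]
    by_cases hn : e (v x) = n
    · simp only [hn, if_true]
      have h1 : ∀ i, HasSum (fun j => MvPowerSeries.coeff ((e.update (v x) i).update z j) G)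
          (g.coeff ((pullState v e).update x i)) := by
        intro i
        rw [← pullState_update hv]
        exact h.2 (e.update (v x) i) (hC e x i he)
      have h2 : Summable fun i => g.coeff ((pullState v e).update x i) := by
        refine g.summable_coeff.comp_injective (i := fun i => (pullState v e).update x i) fun i j hij => ?_
        simpa using DFunLike.congr_fun hij x
      exact hasSum_sum_antidiagonal (f := fun p =>
        MvPowerSeries.coeff ((e.update (v x) p.1).update z p.2) G) (fun p => h.1 _) h1 h2
    · simpa only [hn, if_false] using hasSum_zero

theorem Simulates.shiftOp_add_zeroOp (hv : Function.Injective v) (hz : ∀ i, v i ≠ z)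
    (hC : ∀ e x n, C e → C (e.update (v x) n)) {G : MvPowerSeries ι ℝ} {g : PGF (Fin k)}
    (h : Simulates v z C G g) (x : Fin k) :
    Simulates v z C (shiftOp (v x) G + zeroOp (v x) G) (g.decr x) := by
  refine ⟨fun e => ?_, fun e he => ?_⟩
  · rw [map_add, coeff_shiftOp, coeff_zeroOp]
    refine add_nonneg (h.1 _) ?_
    split_ifs
    · exact h.1 _
    · exact le_rfl
  · rw [PGF.coeff_decr]
    simp only [map_add, coeff_shiftOp, coeff_zeroOp, add_single_eq_update, Finsupp.update_apply, hz x,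
      if_false, pullState_apply]
    refine HasSum.add ?_ ?_
    · have := h.2 _ (hC e x (e (v x) + 1) he)
      rw [pullState_update hv] at this
      simpa only [update_comm' e (hz x)] using this
    · by_cases hx : e (v x) = 0
      · simpa only [hx, if_true] using h.2 _ he
      · simpa only [hx, if_false] using hasSum_zero

/-- The finitely many weights do not involve the ghost exponent, so they can be taken out of the
sum. -/
theorem Simulates.iidOp (hv : Function.Injective v) (hz : ∀ i, v i ≠ z)
    (hC : ∀ e x n, C e → C (e.update (v x) n)) {G : MvPowerSeries ι ℝ} {g : PGF (Fin k)}
    (h : Simulates v z C G g) (x y : Fin k) (D : DistExpr) :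
    Simulates v z C (iidOp (v x) (v y) D.ser G)
      (g.subst₁ y (PGF.X y * D.sem.subst fun _ => PGF.X x)) := by
  refine ⟨fun e => ?_, fun e he => ?_⟩
  · rw [coeff_iidOp]
    exact Finset.sum_nonneg fun p _ => mul_nonneg (h.1 _) (D.coeff_ser_pow_nonneg _ _)
  · rw [PGF.coeff_iid]
    have hzx : (e.update z 0) (v x) = e (v x) := by simp [hz x]
    simp only [coeff_iidOp, Finsupp.update_apply, hz x, if_false, pullState_apply]
    refine hasSum_sum fun p _ => ?_
    have h1 := h.2 _ (hC e x p.1 he)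
    rw [pullState_update hv] at h1
    simp only [update_comm' e (hz x)] at h1
    have h2 : ((e (v y) : ℕ)) = pullState v e y := rfl
    simp only [hv.eq_iff, hz y, if_false]
    exact h1.mul_right _

theorem Simulates.resOp (hz : ∀ i, v i ≠ z) {G : MvPowerSeries ι ℝ} {g : PGF (Fin k)}
    (h : Simulates v z C G g) (p : (Fin k →₀ ℕ) → Bool) :
    Simulates v z C (resOp (fun e => p (pullState v e)) G) (g.restrict p) := by
  refine ⟨fun e => ?_, fun e he => ?_⟩
  · rw [coeff_resOp]
    split_ifs
    · exact h.1 _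
    · exact le_rfl
  · rw [PGF.coeff_restrict]
    simp only [coeff_resOp, pullState_update_ghost hz]
    split_ifs
    · exact h.2 _ he
    · exact hasSum_zero

/-- This justifies deferring the evaluation at 1. The condition C serves to freeze the input
exponents, so it has to be stable under changes of the program variables. -/
theorem Simulates.ghostOp (hv : Function.Injective v) (hz : ∀ i, v i ≠ z)
    (hC : ∀ e x n, C e → C (e.update (v x) n)) {P : Prog k} (hP : P.LoopFree)
    {G : MvPowerSeries ι ℝ} {g : PGF (Fin k)} (h : Simulates v z C G g) :
    Simulates v z C (ghostOp v z P G) (P.sem g) := by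
  induction P generalizing G g with
  | assign x n => exact h.asgOp hv hz hC x n
  | decr x => exact h.shiftOp_add_zeroOp hv hz hC x
  | iid x D y => exact h.iidOp hv hz hC x y D
  | ite φ P Q ihP ihQ =>
    have h1 := ihP hP.1 (h.resOp hz φ.eval)
    have h2 := ihQ hP.2 (h.resOp hz φ.neg.eval)
    refine ⟨fun e => ?_, fun e he => ?_⟩
    · exact add_nonneg (h1.1 e) (h2.1 e)
    · exact (h1.2 e he).add (h2.2 e he)
  | seq P Q ihP ihQ => exact ihQ hP.2 (ihP hP.1 h)
  | loop φ P _ => exact hP.elim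

/-- With the input exponents frozen at u, the diagonal series reduces to the single monomial with
exponent u and involves no ghost variable. -/
theorem simulates_diagSeries (u : Fin k →₀ ℕ) :
    Simulates progVar 0 (fun e => ∀ i, e (inputVar i) = u i) (diagSeries Finset.univ)
      (PGF.monomial u) := by
  classical
  refine ⟨fun e => ?_, fun e he => ?_⟩
  · rw [coeff_diagSeries]
    split_ifs <;> norm_num
  · have h1 : (PGF.monomial u).coeff (pullState progVar e)
        = if pullState progVar e = u then 1 else 0 := MvPowerSeries.coeff_monomial _ _ _
    rw [h1]
    have h2 : ∀ ζ, MvPowerSeries.coeff (e.update 0 ζ) (diagSeries (Finset.univ : Finset (Fin k)))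
        = if ζ = 0 then (if pullState progVar e = u then 1 else 0) else 0 := by
      intro ζ
      rw [coeff_diagSeries, ← ite_and]
      congr 1
      simp only [Finsupp.update_apply, if_true, progVar_ne_zero, inputVar_ne_zero, if_false, he,
        Finset.mem_univ, not_true, false_imp_iff, implies_true, and_true, eq_iff_iff]
      exact and_congr_right fun _ => ⟨fun h => Finsupp.ext h, fun h i => DFunLike.congr_fun h i⟩
    simp only [h2]
    exact hasSum_ite_eq 0 _

end Simulation

/-! ### The defect characterizes the invariants of terminating loops -/

section Characterization

variable {k : ℕ}

/-- The coefficient at `τ` of the difference of `⟦I⟧(X^u)` and `⟦if (φ) {P; I}⟧(X^u)`. -/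
noncomputable def defectAt (φ : Guard k) (P I : Prog k) (u τ : Fin k →₀ ℕ) : ℝ :=
  (I.sem (PGF.monomial u)).coeff τ - (((PGF.monomial u).restrict φ.neg.eval).coeff τ
    + (I.sem (P.sem ((PGF.monomial u).restrict φ.eval))).coeff τ)

/-- The part of an exponent vector that belongs to the program variables. -/
noncomputable def progPart (α : Fin (k + k) →₀ ℕ) : Fin k →₀ ℕ :=
  Finsupp.equivFunOnFinite.symm fun i => α (Fin.castAdd k i)

/-- The part of an exponent vector that belongs to the inputs. -/
noncomputable def inputPart (α : Fin (k + k) →₀ ℕ) : Fin k →₀ ℕ :=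
  Finsupp.equivFunOnFinite.symm fun i => α (Fin.natAdd k i)

theorem hasSum_slice_defectSeries {φ : Guard k} {P I : Prog k} (hP : P.LoopFree) (hI : I.LoopFree)
    (α : Fin (k + k) →₀ ℕ) :
    HasSum (fun ζ => PowerSeries.coeff ζ (slice α (defectSeries φ P I)))
      (defectAt φ P I (inputPart α) (progPart α)) := by
  -- Programs never touch the variables that record the input.
  have hC : ∀ (e : Fin (k + k + 1) →₀ ℕ) (x : Fin k) (n : ℕ),
      (∀ i, e (inputVar i) = inputPart α i) →
        ∀ i, (e.update (progVar x) n) (inputVar i) = inputPart α i := by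
    intro e x n he i
    rw [Finsupp.update_apply, if_neg (progVar_ne_inputVar x i).symm, he]
  have h := simulates_diagSeries (inputPart α)
  have hI' := h.ghostOp progVar_injective progVar_ne_zero hC hI
  have hn := h.resOp progVar_ne_zero φ.neg.eval
  have hPI := ((h.resOp progVar_ne_zero φ.eval).ghostOp progVar_injective progVar_ne_zero hC
    hP).ghostOp progVar_injective progVar_ne_zero hC hI
  have he : ∀ i, (Finsupp.cons 0 α : Fin (k + k + 1) →₀ ℕ) (inputVar i) = inputPart α i :=
    fun i => Finsupp.cons_succ _ _ _
  have hs : pullState progVar (Finsupp.cons 0 α : Fin (k + k + 1) →₀ ℕ) = progPart α := by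
    ext i
    exact Finsupp.cons_succ (Fin.castAdd k i) 0 α
  have hu : ∀ ζ, (Finsupp.cons 0 α : Fin (k + k + 1) →₀ ℕ).update 0 ζ = Finsupp.cons ζ α := by
    intro ζ
    ext j
    refine Fin.cases (by simp) (fun j => by simp) j
  have := (hI'.2 _ he).sub ((hn.2 _ he).add (hPI.2 _ he))
  rw [hs] at this
  simp only [hu] at this
  simp only [coeff_slice, defectSeries, map_sub, map_add]
  exact this

/-- A zero defect says that the fixed point equation holds for I on monomials, and kernels extend it
to all inputs. Leastness then gives one inequality, and conservation of mass by the loop makes it an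
equality. -/
theorem sem_loop_eq_iff {φ : Guard k} {P I : Prog k} (hP : P.LoopFree) (hI : I.LoopFree)
    (hL : (Prog.loop φ P).UAST) :
    (Prog.loop φ P).sem = I.sem ↔ ∀ u τ, defectAt φ P I u τ = 0 := by
  have hleast := Transformer.lfp_isLeast φ P.transformer
  have hneg : ∀ (f : PGF (Fin k)) τ, (f.restrict φ.neg.eval).coeff τ
      = f.coeff τ - (f.restrict φ.eval).coeff τ := by
    intro f τ
    simp only [PGF.coeff_restrict, Guard.eval]
    cases φ.eval τ <;> simp
  constructor
  · intro h u τ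
    have h1 := congrArg (MvPowerSeries.coeff τ) (hleast.1 (PGF.monomial u))
    rw [map_add, map_sub] at h1
    change ((Prog.loop φ P).sem (PGF.monomial u)).coeff τ = (PGF.monomial u).coeff τ
      - ((PGF.monomial u).restrict φ.eval).coeff τ
      + ((Prog.loop φ P).sem (P.sem ((PGF.monomial u).restrict φ.eval))).coeff τ at h1
    rw [h, ← hneg] at h1
    rw [defectAt, h1, sub_self]
  · intro h
    have hfix : (fun f => (I.sem f).coeff) = fun f τ => (f.restrict φ.neg.eval).coeff τ
        + (I.sem (P.sem (f.restrict φ.eval))).coeff τ := by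
      refine (Prog.hasKernel hI).eq_of_monomial ((HasKernel.restrict φ.neg.eval).add
        (((Prog.hasKernel hI).comp (Prog.hasKernel hP)).comp (HasKernel.restrict φ.eval)))
        fun u τ => ?_
      exact sub_eq_zero.1 (h u τ)
    have hle : (Prog.loop φ P).sem ≤ I.sem := hleast.2 fun f => by
      refine MvPowerSeries.ext fun τ => ?_
      rw [map_add, map_sub]
      change (I.sem f).coeff τ = f.coeff τ - (f.restrict φ.eval).coeff τ
        + (I.sem (P.sem (f.restrict φ.eval))).coeff τ
      rw [← hneg]
      exact congrFun (congrFun hfix f) τ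
    funext f
    -- The image under I has at most the mass of f, and the loop retains exactly that mass; a strict
    -- inequality at one coefficient would make the mass of the image under I larger.
    have h1 : (I.sem f).mass ≤ ((Prog.loop φ P).sem f).mass := (I.transformer.mass_le f).trans (hL f).ge
    refine PGF.ext fun τ => ?_
    by_contra hne
    have hlt := Summable.tsum_lt_tsum (hle f) (lt_of_le_of_ne (hle f τ) hne)
      (PGF.summable_coeff _) (PGF.summable_coeff _)
    exact absurd h1 (not_le.2 hlt)

theorem sem_loop_eq_iff_forall_slice {φ : Guard k} {P I : Prog k} (hP : P.LoopFree)
    (hI : I.LoopFree) (hL : (Prog.loop φ P).UAST) :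
    (Prog.loop φ P).sem = I.sem ↔ ∀ α : Fin (k + k) →₀ ℕ,
      (∀ i, α i ≤ defectBound k φ.code P.code I.code) →
        HasSum (fun ζ => PowerSeries.coeff ζ (slice α (defectSeries φ P I))) 0 := by
  rw [sem_loop_eq_iff hP hI hL]
  constructor
  · intro h α _
    have := hasSum_slice_defectSeries (φ := φ) hP hI α
    rwa [h] at this
  · intro h
    -- The box of exponent vectors with entries at most the bound contains all those of total degree
    -- at most the bound.
    have h1 := (RatBound.defectSeries φ P I).sum_slice_eq_zero (hasSum_slice_defectSeries hP hI)
      fun α hα => (hasSum_slice_defectSeries hP hI α).unique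
        (h α fun i => (Finsupp.le_degree i α).trans hα)
    intro u τ
    have h2 := h1 (Finsupp.equivFunOnFinite.symm (Fin.append τ u))
    have h3 : inputPart (Finsupp.equivFunOnFinite.symm (Fin.append τ u)) = u := by
      ext i; exact Fin.append_right _ _ _
    have h4 : progPart (Finsupp.equivFunOnFinite.symm (Fin.append τ u)) = τ := by
      ext i; exact Fin.append_left _ _ _
    rwa [h3, h4] at h2

end Characterization


/-! ### A test for the value of a rational power series at `1` -/

section Pade

/-- Linear algebra: b has B + 1 free coefficients, and the coefficients of b d in degrees B + 1 to
2B impose B homogeneous conditions. The numerator a is the truncation of b d. -/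
theorem exists_pade_ne_zero (B : ℕ) (d : PowerSeries ℚ) :
    ∃ a b : Polynomial ℚ, b ≠ 0 ∧ b.natDegree ≤ B ∧ a.natDegree ≤ B ∧
      (PowerSeries.X : PowerSeries ℚ) ^ (2 * B + 1) ∣ b * d - a := by
  let L : (Fin (B + 1) → ℚ) →ₗ[ℚ] (Fin B → ℚ) :=
    { toFun := fun β j => ∑ i : Fin (B + 1), β i * PowerSeries.coeff (B + 1 + j - i) d
      map_add' := fun β γ => by
        funext j; simp only [Pi.add_apply, add_mul, Finset.sum_add_distrib]
      map_smul' := fun c β => by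
        funext j
        simp only [Pi.smul_apply, smul_eq_mul, mul_assoc, Finset.mul_sum, RingHom.id_apply] }
  have hker : LinearMap.ker L ≠ ⊥ := LinearMap.ker_ne_bot_of_finrank_lt (by simp)
  obtain ⟨β, hβ, hβ0⟩ := (Submodule.ne_bot_iff _).1 hker
  rw [LinearMap.mem_ker] at hβ
  set b : Polynomial ℚ := ∑ i : Fin (B + 1), Polynomial.monomial (i : ℕ) (β i) with hb
  have hcoeff : ∀ i : Fin (B + 1), b.coeff i = β i := by
    intro i
    rw [hb, Polynomial.finsetSum_coeff]
    simp only [Polynomial.coeff_monomial, Fin.val_inj]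
    rw [Finset.sum_ite_eq', if_pos (Finset.mem_univ i)]
  have hdeg : b.natDegree ≤ B := Polynomial.natDegree_sum_le_of_forall_le _ _ fun i _ =>
    (Polynomial.natDegree_monomial_le _).trans (Nat.lt_succ_iff.1 i.2)
  refine ⟨PowerSeries.trunc (B + 1) (b * d), b, ?_, hdeg, ?_, ?_⟩
  · intro h
    refine hβ0 (funext fun i => ?_)
    rw [← hcoeff, h, Polynomial.coeff_zero, Pi.zero_apply]
  · exact Nat.lt_succ_iff.1 (PowerSeries.natDegree_trunc_lt _ _)
  · rw [PowerSeries.X_pow_dvd_iff]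
    intro n hn
    rw [map_sub, Polynomial.coeff_coe, PowerSeries.coeff_trunc]
    split_ifs with h
    · rw [sub_self]
    · obtain ⟨j, rfl⟩ : ∃ j, n = B + 1 + j := ⟨n - (B + 1), by omega⟩
      have hj := congrFun hβ ⟨j, by omega⟩
      change ∑ i : Fin (B + 1), β i * PowerSeries.coeff (B + 1 + j - i) d = 0 at hj
      have h1 : (b : PowerSeries ℚ) * d = ∑ i : Fin (B + 1),
          ((Polynomial.monomial (i : ℕ) (β i) : Polynomial ℚ) : PowerSeries ℚ) * d := by
        rw [hb, ← Polynomial.coeToPowerSeries.ringHom_apply, map_sum, Finset.sum_mul]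
        rfl
      rw [sub_zero, h1, map_sum, ← hj]
      refine Finset.sum_congr rfl fun i _ => ?_
      have h2 : (i : ℕ) ≤ B + 1 + j := by omega
      rw [← Polynomial.C_mul_X_pow_eq_monomial, Polynomial.coe_mul, Polynomial.coe_C,
        Polynomial.coe_pow, Polynomial.coe_X, mul_assoc, PowerSeries.coeff_C_mul,
        PowerSeries.coeff_X_pow_mul', if_pos h2]

/-- A common factor X - 1 of a and b can be removed, because X - 1 is a unit among power series and
so does not affect the order of contact with d. The degree of b drops each time. -/
theorem exists_pade_eval_ne_zero (B : ℕ) (d : PowerSeries ℚ) :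
    ∃ a b : Polynomial ℚ, (b.eval 1 ≠ 0 ∨ a.eval 1 ≠ 0) ∧ b.natDegree ≤ B ∧ a.natDegree ≤ B ∧
      (PowerSeries.X : PowerSeries ℚ) ^ (2 * B + 1) ∣ b * d - a := by
  obtain ⟨a, b, h0, hb, ha, h⟩ := exists_pade_ne_zero B d
  induction hn : b.natDegree using Nat.strong_induction_on generalizing a b with
  | _ n ih =>
  by_cases h1 : b.eval 1 ≠ 0 ∨ a.eval 1 ≠ 0
  · exact ⟨a, b, h1, hb, ha, h⟩
  · push Not at h1
    obtain ⟨b', hb'⟩ := Polynomial.dvd_iff_isRoot.2 h1.1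
    obtain ⟨a', ha'⟩ := Polynomial.dvd_iff_isRoot.2 h1.2
    have hX : (Polynomial.X - Polynomial.C 1 : Polynomial ℚ) ≠ 0 := Polynomial.X_sub_C_ne_zero 1
    have hb0 : b' ≠ 0 := by
      rintro rfl
      rw [mul_zero] at hb'
      exact h0 hb'
    have hbn : b.natDegree = 1 + b'.natDegree := by
      rw [hb', Polynomial.natDegree_mul hX hb0, Polynomial.natDegree_X_sub_C]
    have han : a'.natDegree ≤ B := by
      by_cases ha0 : a' = 0
      · rw [ha0, Polynomial.natDegree_zero]; exact Nat.zero_le _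
      · rw [ha', Polynomial.natDegree_mul hX ha0] at ha
        omega
    refine ih b'.natDegree (by omega) a' b' hb0 (by omega) han ?_ rfl
    have hunit : IsUnit ((Polynomial.X - Polynomial.C 1 : Polynomial ℚ) : PowerSeries ℚ) := by
      rw [PowerSeries.isUnit_iff_constantCoeff]
      simp
    rw [hb', ha', Polynomial.coe_mul, Polynomial.coe_mul, mul_assoc, ← mul_sub] at h
    exact (hunit.dvd_mul_left).1 h

theorem exists_pade_coeff (B : ℕ) (d : ℕ → ℚ) :
    ∃ β : ℕ → ℚ, (∀ i, B < i → β i = 0) ∧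
      (∀ n, B < n → n ≤ 2 * B → ∑ p ∈ Finset.HasAntidiagonal.antidiagonal n, β p.1 * d p.2 = 0) ∧
      (∑ i ∈ Finset.range (B + 1), β i ≠ 0 ∨ ∑ n ∈ Finset.range (B + 1),
        ∑ p ∈ Finset.HasAntidiagonal.antidiagonal n, β p.1 * d p.2 ≠ 0) := by
  obtain ⟨a, b, h0, hb, ha, h⟩ := exists_pade_eval_ne_zero B (PowerSeries.mk d)
  rw [PowerSeries.X_pow_dvd_iff] at h
  have hc : ∀ n < 2 * B + 1, ∑ p ∈ Finset.HasAntidiagonal.antidiagonal n, b.coeff p.1 * d p.2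
      = a.coeff n := by
    intro n hn
    have := h n hn
    rw [map_sub, sub_eq_zero, PowerSeries.coeff_mul] at this
    simpa only [Polynomial.coeff_coe, PowerSeries.coeff_mk] using this
  refine ⟨b.coeff, fun i hi => Polynomial.coeff_eq_zero_of_natDegree_lt (by omega),
    fun n hn hn' => ?_, ?_⟩
  · rw [hc n (by omega)]
    exact Polynomial.coeff_eq_zero_of_natDegree_lt (by omega)
  · rw [Polynomial.eval_eq_sum_range' (show b.natDegree < B + 1 by omega),
      Polynomial.eval_eq_sum_range' (show a.natDegree < B + 1 by omega)] at h0
    simp only [one_pow, mul_one] at h0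
    refine h0.imp id fun h1 => ?_
    rw [Finset.sum_congr rfl fun n hn => hc n ?_]
    · exact h1
    · rw [Finset.mem_range] at hn; omega

/-- The polynomial b p - a q has degree at most 2B and is divisible by X^(2B + 1), so it vanishes
and b d = a holds exactly. Summation gives b(1) S = a(1); as a(1) and b(1) are not both zero, b(1) ≠
0, and S = 0 exactly if a(1) = 0. The polynomials p and q only have to exist: the criterion does not
mention them. -/
theorem hasSum_zero_iff_pade {B : ℕ} {d : ℕ → ℝ} {S : ℝ} (hd : HasSum d S) {p q : Polynomial ℝ}
    (hp : p.natDegree ≤ B) (hq : q.natDegree ≤ B) (hq0 : q.coeff 0 ≠ 0)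
    (hpq : (q : PowerSeries ℝ) * PowerSeries.mk d = p) {β : ℕ → ℝ} (hβ : ∀ i, B < i → β i = 0)
    (hrec : ∀ n, B < n → n ≤ 2 * B →
      ∑ p ∈ Finset.HasAntidiagonal.antidiagonal n, β p.1 * d p.2 = 0)
    (h0 : ∑ i ∈ Finset.range (B + 1), β i ≠ 0 ∨ ∑ n ∈ Finset.range (B + 1),
      ∑ p ∈ Finset.HasAntidiagonal.antidiagonal n, β p.1 * d p.2 ≠ 0) :
    HasSum d 0 ↔ ∑ n ∈ Finset.range (B + 1),
      ∑ p ∈ Finset.HasAntidiagonal.antidiagonal n, β p.1 * d p.2 = 0 := by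
  set b : Polynomial ℝ := ∑ i ∈ Finset.range (B + 1), Polynomial.monomial i (β i) with hb
  set a : Polynomial ℝ := ∑ n ∈ Finset.range (B + 1), Polynomial.monomial n
    (∑ p ∈ Finset.HasAntidiagonal.antidiagonal n, β p.1 * d p.2) with ha
  have hbc : ∀ i, b.coeff i = β i := by
    intro i
    rw [hb, Polynomial.finsetSum_coeff]
    simp only [Polynomial.coeff_monomial]
    rw [Finset.sum_ite_eq']
    split_ifs with h
    · rfl
    · rw [Finset.mem_range] at h; exact (hβ i (by omega)).symm
  have hac : ∀ n, n ≤ B → a.coeff n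
      = ∑ p ∈ Finset.HasAntidiagonal.antidiagonal n, β p.1 * d p.2 := by
    intro n hn
    rw [ha, Polynomial.finsetSum_coeff]
    simp only [Polynomial.coeff_monomial]
    rw [Finset.sum_ite_eq', if_pos (Finset.mem_range.2 (by omega))]
  have hbd : b.natDegree ≤ B := Polynomial.natDegree_sum_le_of_forall_le _ _ fun i hi =>
    (Polynomial.natDegree_monomial_le _).trans (by rw [Finset.mem_range] at hi; omega)
  have had : a.natDegree ≤ B := Polynomial.natDegree_sum_le_of_forall_le _ _ fun i hi =>
    (Polynomial.natDegree_monomial_le _).trans (by rw [Finset.mem_range] at hi; omega)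
  have hb1 : b.eval 1 = ∑ i ∈ Finset.range (B + 1), β i := by
    simp [hb, Polynomial.eval_finsetSum]
  have ha1 : a.eval 1 = ∑ n ∈ Finset.range (B + 1),
      ∑ p ∈ Finset.HasAntidiagonal.antidiagonal n, β p.1 * d p.2 := by
    simp [ha, Polynomial.eval_finsetSum]
  have hdvd : (PowerSeries.X : PowerSeries ℝ) ^ (2 * B + 1) ∣ b * PowerSeries.mk d - a := by
    rw [PowerSeries.X_pow_dvd_iff]
    intro n hn
    rw [map_sub, PowerSeries.coeff_mul, Polynomial.coeff_coe]
    simp only [Polynomial.coeff_coe, PowerSeries.coeff_mk, hbc]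
    by_cases h : n ≤ B
    · rw [hac n h, sub_self]
    · rw [hrec n (by omega) (by omega), Polynomial.coeff_eq_zero_of_natDegree_lt (by omega), sub_zero]
  have hbp : b * p = a * q := by
    rw [← sub_eq_zero]
    have h1 : (PowerSeries.X : PowerSeries ℝ) ^ (2 * B + 1) ∣
        ((b * p - a * q : Polynomial ℝ) : PowerSeries ℝ) := by
      have h2 : ((b * p - a * q : Polynomial ℝ) : PowerSeries ℝ)
          = (b * PowerSeries.mk d - a) * q := by
        rw [Polynomial.coe_sub, Polynomial.coe_mul, Polynomial.coe_mul, ← hpq]; ring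
      rw [h2]
      exact Dvd.dvd.mul_right hdvd _
    rw [PowerSeries.X_pow_dvd_iff] at h1
    ext n
    rw [Polynomial.coeff_zero]
    by_cases h : n < 2 * B + 1
    · rw [← h1 n h, Polynomial.coeff_coe]
    · refine Polynomial.coeff_eq_zero_of_natDegree_lt ?_
      refine lt_of_le_of_lt ((Polynomial.natDegree_sub_le _ _).trans (max_le
        (Polynomial.natDegree_mul_le.trans (add_le_add hbd hp))
        (Polynomial.natDegree_mul_le.trans (add_le_add had hq)))) (by omega)
  have hq' : (q : PowerSeries ℝ) ≠ 0 := by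
    rw [Ne, Polynomial.coe_eq_zero_iff]
    rintro rfl
    exact hq0 rfl
  have hba : (b : PowerSeries ℝ) * PowerSeries.mk d = a := by
    refine mul_right_cancel₀ hq' ?_
    rw [← Polynomial.coe_mul a q, ← hbp, Polynomial.coe_mul, ← hpq]; ring
  have hS : b.eval 1 * S = a.eval 1 := by
    have h1 := hasSum_coeff_polynomial_mul b (s := PowerSeries.mk d) (S := S)
      (by simpa only [PowerSeries.coeff_mk] using hd)
    rw [hba] at h1
    have h3 : HasSum (fun i => PowerSeries.coeff i (1 : PowerSeries ℝ)) 1 := by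
      simp only [PowerSeries.coeff_one]
      exact hasSum_ite_eq 0 1
    exact h1.unique (by simpa using hasSum_coeff_polynomial_mul a h3)
  rw [← ha1, ← hb1] at h0
  rw [← ha1, ← hS]
  have hb0 : b.eval 1 ≠ 0 := by
    rcases h0 with h0 | h0
    · exact h0
    · intro h
      rw [← hS, h, zero_mul] at h0
      exact h0 rfl
  constructor
  · intro h
    rw [hd.unique h, mul_zero]
  · intro h
    rwa [(mul_eq_zero.1 h).resolve_left hb0] at hd

end Pade


/-! ### Exact rational arithmetic on triples of natural numbers -/

section QCode

/-- The triple `(a, b, c)` stands for the rational number `(a - b) / (c + 1)`. -/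
abbrev QCode : Type := ℕ × ℕ × ℕ

/-- The rational number of a triple. -/
def qval (r : QCode) : ℚ := ((r.1 : ℚ) - r.2.1) / (r.2.2 + 1)

/-- Denominators are stored decreased by one, so the last entry is (c + 1)(c' + 1) - 1. -/
def qadd (r s : QCode) : QCode :=
  (r.1 * (s.2.2 + 1) + s.1 * (r.2.2 + 1), r.2.1 * (s.2.2 + 1) + s.2.1 * (r.2.2 + 1),
    r.2.2 * s.2.2 + r.2.2 + s.2.2)

def qmul (r s : QCode) : QCode :=
  (r.1 * s.1 + r.2.1 * s.2.1, r.1 * s.2.1 + r.2.1 * s.1, r.2.2 * s.2.2 + r.2.2 + s.2.2)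

def qneg (r : QCode) : QCode := (r.2.1, r.1, r.2.2)

/-- The sign of the number moves to the new numerator so that the denominator stays positive; zero
is inverted to zero, as in ℚ. -/
def qinv (r : QCode) : QCode :=
  if r.2.1 < r.1 then (r.2.2 + 1, 0, r.1 - r.2.1 - 1) else
    if r.1 < r.2.1 then (0, r.2.2 + 1, r.2.1 - r.1 - 1) else (0, 0, 0)

/-- The sum of the first `n` values of a function. -/
def qsum (n : ℕ) (f : ℕ → QCode) : QCode :=
  Nat.rec (0, 0, 0) (fun i r => qadd r (f i)) n

/-- The sum of a list. -/
def qlsum (l : List QCode) : QCode := l.foldr qadd (0, 0, 0)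

/-- The rational number with the code `n`. -/
def qdecode (n : ℕ) : QCode := (n.unpair.1, n.unpair.2.unpair.1, n.unpair.2.unpair.2 - 1)

theorem qval_add (r s : QCode) : qval (qadd r s) = qval r + qval s := by
  simp only [qval, qadd]
  push_cast
  have h1 : (r.2.2 : ℚ) + 1 ≠ 0 := by positivity
  have h2 : (s.2.2 : ℚ) + 1 ≠ 0 := by positivity
  have h3 : (r.2.2 : ℚ) * s.2.2 + r.2.2 + s.2.2 + 1 = (r.2.2 + 1) * (s.2.2 + 1) := by ring
  rw [h3]
  field_simp
  ring

theorem qval_mul (r s : QCode) : qval (qmul r s) = qval r * qval s := by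
  simp only [qval, qmul]
  push_cast
  have h1 : (r.2.2 : ℚ) + 1 ≠ 0 := by positivity
  have h2 : (s.2.2 : ℚ) + 1 ≠ 0 := by positivity
  have h3 : (r.2.2 : ℚ) * s.2.2 + r.2.2 + s.2.2 + 1 = (r.2.2 + 1) * (s.2.2 + 1) := by ring
  rw [h3]
  field_simp
  ring

theorem qval_neg (r : QCode) : qval (qneg r) = -qval r := by
  simp only [qval, qneg]
  ring

theorem qval_zero : qval (0, 0, 0) = 0 := by simp [qval]

theorem qval_one : qval (1, 0, 0) = 1 := by simp [qval]

theorem qval_eq_zero_iff (r : QCode) : qval r = 0 ↔ r.1 = r.2.1 := by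
  have h1 : (r.2.2 : ℚ) + 1 ≠ 0 := by positivity
  rw [qval, div_eq_zero_iff, or_iff_left h1, sub_eq_zero, Nat.cast_inj]

theorem qval_inv (r : QCode) : qval (qinv r) = (qval r)⁻¹ := by
  have h1 : (r.2.2 : ℚ) + 1 ≠ 0 := by positivity
  unfold qinv
  split_ifs with h h'
  · simp only [qval]
    obtain ⟨c, hc⟩ : ∃ c, r.1 = r.2.1 + c + 1 := ⟨r.1 - r.2.1 - 1, by omega⟩
    have : r.1 - r.2.1 - 1 = c := by omega
    rw [this, hc]
    push_cast
    have h2 : (c : ℚ) + 1 ≠ 0 := by positivity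
    rw [inv_div, show (r.2.1 : ℚ) + c + 1 - r.2.1 = c + 1 by ring, sub_zero]
  · simp only [qval]
    obtain ⟨c, hc⟩ : ∃ c, r.2.1 = r.1 + c + 1 := ⟨r.2.1 - r.1 - 1, by omega⟩
    have : r.2.1 - r.1 - 1 = c := by omega
    rw [this, hc]
    push_cast
    have h2 : (c : ℚ) + 1 ≠ 0 := by positivity
    rw [inv_div, show (r.1 : ℚ) - (r.1 + c + 1) = -(c + 1) by ring, div_neg, zero_sub, neg_div]
  · rw [qval_zero, (qval_eq_zero_iff r).2 (by omega), inv_zero]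

theorem qval_sum (n : ℕ) (f : ℕ → QCode) : qval (qsum n f) = ∑ i ∈ Finset.range n, qval (f i) := by
  induction n with
  | zero => exact qval_zero
  | succ n ih => rw [Finset.sum_range_succ, ← ih, ← qval_add]; rfl

theorem qval_decode_ratCode (q : ℚ) : qval (qdecode (ratCode q)) = q := by
  simp only [qval, qdecode, ratCode, Nat.unpair_pair]
  have h1 : ((q.den - 1 : ℕ) : ℚ) + 1 = q.den := by
    have := q.den_pos
    rw [Nat.cast_sub this]; simp
  have h2 : ((q.num.toNat : ℕ) : ℚ) - ((-q.num).toNat : ℕ) = q.num := by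
    have := Int.toNat_sub_toNat_neg q.num
    exact_mod_cast this
  rw [h1, h2, Rat.num_div_den]

end QCode

/-! ### Course-of-values recursion -/

section CourseOfValues

variable {α β : Type}

/-- The first `n` values of the function defined by course-of-values recursion from `step`. -/
def covList (step : α → List β → β) (a : α) (n : ℕ) : List β :=
  Nat.rec [] (fun _ l => l ++ [step a l]) n

/-- The function defined by course-of-values recursion from `step`. -/
def cov (step : α → List β → β) (a : α) (n : ℕ) : β := step a (covList step a n)

theorem length_covList (step : α → List β → β) (a : α) (n : ℕ) : (covList step a n).length = n := by
  induction n with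
  | zero => rfl
  | succ n ih =>
    change (covList step a n ++ [_]).length = n + 1
    rw [List.length_append, ih]; rfl

theorem getD_covList (step : α → List β → β) (a : α) (n : ℕ) {i : ℕ} (hi : i < n) (d : β) :
    (covList step a n).getD i d = cov step a i := by
  induction n with
  | zero => omega
  | succ n ih =>
    change (covList step a n ++ [cov step a n]).getD i d = _
    have hl := length_covList step a n
    by_cases h : i < n
    · rw [List.getD_append _ _ _ _ (by omega), ih h]
    · have : i = n := by omega
      subst this
      rw [List.getD_append_right _ _ _ _ (by omega), hl, Nat.sub_self]
      rfl

end CourseOfValues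

/-! ### Coefficients of powers of distribution expressions -/

section DistCoeff

/-- The list of naturals with a given code. -/
def decodeList (n : ℕ) : List ℕ := (Encodable.decode (α := List ℕ) n).getD []

/-- Long division of power series: l holds the coefficients already found, and its length is the
index of the next one. -/
def distStep (c : ℕ) (l : List QCode) : QCode :=
  qmul (qadd (qdecode ((decodeList c.unpair.1).getD l.length 0))
    (qneg (qsum l.length fun i => qmul (l.getD i (0, 0, 0))
      (qdecode ((decodeList c.unpair.2).getD (l.length - i) 0)))))
    (qinv (qdecode ((decodeList c.unpair.2).getD 0 0)))

/-- The coefficients of the distribution expression with code `c`. -/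
def distCoeff (c n : ℕ) : QCode := cov distStep c n

/-- The coefficients up to degree `m` of the `s`-th power of the distribution expression with
code `c`. -/
def distPowList (c m s : ℕ) : List QCode :=
  Nat.rec ((List.range (m + 1)).map fun i => if i = 0 then (1, 0, 0) else (0, 0, 0))
    (fun _ l => (List.range (m + 1)).map fun n => qsum (n + 1) fun i =>
      qmul (l.getD i (0, 0, 0)) (distCoeff c (n - i))) s

def distPow (c s m : ℕ) : QCode := (distPowList c m s).getD m (0, 0, 0)

theorem qval_decode_getD (l : List ℚ) (n : ℕ) :
    qval (qdecode ((decodeList (Encodable.encode (l.map ratCode))).getD n 0)) = l.getD n 0 := by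
  rw [decodeList, Encodable.encodek, Option.getD_some]
  by_cases h : n < l.length
  · rw [List.getD_eq_getElem _ _ (by simpa using h), List.getElem_map, qval_decode_ratCode,
      List.getD_eq_getElem _ _ h]
  · rw [List.getD_eq_default _ _ (by simpa using h), List.getD_eq_default _ _ (by simpa using h)]
    simp [qval, qdecode]

theorem qval_distCoeff (D : DistExpr) (n : ℕ) : qval (distCoeff D.code n)
    = PowerSeries.coeff n (listSeries D.num * (listSeries D.den)⁻¹) := by
  have hmul : listSeries D.num * (listSeries D.den)⁻¹ * listSeries D.den = listSeries D.num := by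
    rw [mul_assoc, PowerSeries.inv_mul_cancel _ D.den_ne, mul_one]
  set F := listSeries D.num * (listSeries D.den)⁻¹ with hF
  induction n using Nat.strong_induction_on with
  | _ n ih =>
  have hq0 : D.den.getD 0 0 ≠ 0 := by
    have h := D.den_ne
    rwa [← PowerSeries.coeff_zero_eq_constantCoeff_apply, listSeries, PowerSeries.coeff_mk] at h
  rw [distCoeff, cov, distStep, length_covList, qval_mul, qval_add, qval_neg, qval_sum, qval_inv,
    DistExpr.code, Nat.unpair_pair, qval_decode_getD, qval_decode_getD]
  have h1 : ∀ i ∈ Finset.range n, qval (qmul ((covList distStep (Nat.pair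
      (Encodable.encode (D.num.map ratCode)) (Encodable.encode (D.den.map ratCode))) n).getD i (0, 0, 0))
      (qdecode ((decodeList (Encodable.encode (D.den.map ratCode))).getD (n - i) 0)))
        = PowerSeries.coeff i F * D.den.getD (n - i) 0 := by
    intro i hi
    rw [Finset.mem_range] at hi
    rw [qval_mul, getD_covList _ _ _ hi, qval_decode_getD, ← ih i hi]
    rfl
  rw [Finset.sum_congr rfl h1]
  -- The term with index n in this Cauchy product contains the unknown coefficient times the
  -- constant term of the denominator; the other terms are known by induction.
  have h2 := congrArg (PowerSeries.coeff n) hmul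
  rw [PowerSeries.coeff_mul, Finset.Nat.sum_antidiagonal_eq_sum_range_succ
    (fun i j => PowerSeries.coeff i F * PowerSeries.coeff j (listSeries D.den)),
    Finset.sum_range_succ] at h2
  simp only [listSeries, PowerSeries.coeff_mk, Nat.sub_self] at h2
  rw [← div_eq_mul_inv, div_eq_iff hq0, ← h2]
  ring

/-- Truncation at degree m is harmless, since a coefficient of a product depends only on
coefficients of no higher degree. -/
theorem qval_getD_distPowList (D : DistExpr) (m s : ℕ) {n : ℕ} (hn : n ≤ m) :
    qval ((distPowList D.code m s).getD n (0, 0, 0))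
      = PowerSeries.coeff n ((listSeries D.num * (listSeries D.den)⁻¹) ^ s) := by
  induction s generalizing n with
  | zero =>
    have h : n < (List.range (m + 1)).length := by rw [List.length_range]; omega
    change qval (((List.range (m + 1)).map _).getD n _) = _
    rw [List.getD_eq_getElem _ _ (by simpa using h), List.getElem_map, List.getElem_range, pow_zero,
      PowerSeries.coeff_one]
    split_ifs
    · exact qval_one
    · exact qval_zero
  | succ s ih =>
    have h : n < (List.range (m + 1)).length := by rw [List.length_range]; omega
    change qval (((List.range (m + 1)).map _).getD n _) = _
    rw [List.getD_eq_getElem _ _ (by simpa using h), List.getElem_map, List.getElem_range, qval_sum,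
      pow_succ, PowerSeries.coeff_mul, Finset.Nat.sum_antidiagonal_eq_sum_range_succ
        (fun i j => PowerSeries.coeff i ((listSeries D.num * (listSeries D.den)⁻¹) ^ s)
          * PowerSeries.coeff j (listSeries D.num * (listSeries D.den)⁻¹))]
    refine Finset.sum_congr rfl fun i hi => ?_
    rw [Finset.mem_range] at hi
    rw [qval_mul, qval_distCoeff, ← ih (show i ≤ m by omega)]
    rfl

theorem qval_distPow (D : DistExpr) (s m : ℕ) :
    (qval (distPow D.code s m) : ℝ) = PowerSeries.coeff m (D.ser ^ s) := by
  rw [distPow, qval_getD_distPowList D m s le_rfl, DistExpr.ser, ← map_pow, PowerSeries.coeff_map]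
  rfl

end DistCoeff


/-! ### Exponent vectors as lists -/

section ListStates

/-- The list `l` with the entry `v` at index `j`, extended by zeros if necessary. -/
def lset (l : List ℕ) (j v : ℕ) : List ℕ :=
  (List.range (max l.length (j + 1))).map fun i => if i = j then v else l.getD i 0

theorem getD_lset (l : List ℕ) (j v i : ℕ) :
    (lset l j v).getD i 0 = if i = j then v else l.getD i 0 := by
  unfold lset
  by_cases h : i < max l.length (j + 1)
  · rw [List.getD_eq_getElem _ _ (by simpa using h), List.getElem_map, List.getElem_range]
  · rw [List.getD_eq_default _ _ (by simpa using h), if_neg (by omega),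
      List.getD_eq_default _ _ (by omega)]

/-- The exponent vector given by a list. -/
noncomputable def toExp (m : ℕ) (l : List ℕ) : Fin m →₀ ℕ :=
  Finsupp.equivFunOnFinite.symm fun i => l.getD i 0

theorem toExp_apply (m : ℕ) (l : List ℕ) (i : Fin m) : toExp m l i = l.getD i 0 := rfl

theorem toExp_lset (m : ℕ) (l : List ℕ) (i : Fin m) (v : ℕ) :
    toExp m (lset l i v) = (toExp m l).update i v := by
  ext j
  rw [toExp_apply, getD_lset, Finsupp.update_apply, toExp_apply]
  simp only [Fin.ext_iff]

theorem toExp_lset_add_one (m : ℕ) (l : List ℕ) (i : Fin m) :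
    toExp m (lset l i (l.getD i 0 + 1)) = toExp m l + Finsupp.single i 1 := by
  ext j
  rw [toExp_apply, getD_lset, Finsupp.add_apply, toExp_apply, Finsupp.single_apply]
  by_cases h : i = j
  · subst h; simp
  · rw [if_neg (by rw [Fin.ext_iff] at h; omega), if_neg h, add_zero]

theorem toExp_cons (m : ℕ) (l : List ℕ) (ζ : ℕ) :
    toExp (m + 1) (ζ :: l) = Finsupp.cons ζ (toExp m l) := by
  ext j
  refine Fin.cases ?_ (fun i => ?_) j
  · rw [Finsupp.cons_zero]; rfl
  · rw [Finsupp.cons_succ]; rfl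

theorem toExp_ofFn {m : ℕ} (e : Fin m →₀ ℕ) : toExp m (List.ofFn e) = e := by
  ext j
  rw [toExp_apply, List.getD_eq_getElem _ _ (by simp)]
  simp

/-- All lists of length `n` with entries at most `B`. -/
def boxes (B n : ℕ) : List (List ℕ) :=
  Nat.rec [[]] (fun _ L => L.flatMap fun l => (List.range (B + 1)).map fun i => i :: l) n

theorem mem_boxes (B n : ℕ) (l : List ℕ) : l ∈ boxes B n ↔ l.length = n ∧ ∀ i ∈ l, i ≤ B := by
  induction n generalizing l with
  | zero =>
    change l ∈ [[]] ↔ _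
    rw [List.mem_singleton, List.length_eq_zero_iff]
    exact ⟨fun h => ⟨h, by simp [h]⟩, fun h => h.1⟩
  | succ n ih =>
    change l ∈ (boxes B n).flatMap _ ↔ _
    simp only [List.mem_flatMap, List.mem_map, List.mem_range, ih]
    constructor
    · rintro ⟨l, ⟨rfl, h2⟩, i, hi, rfl⟩
      refine ⟨rfl, fun j hj => ?_⟩
      rcases List.mem_cons.1 hj with rfl | hj
      · omega
      · exact h2 j hj
    · rintro ⟨h1, h2⟩
      cases l with
      | nil => simp at h1
      | cons i l =>
        refine ⟨l, ⟨by simpa using h1, fun j hj => h2 j (List.mem_cons_of_mem _ hj)⟩, i, ?_, rfl⟩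
        have := h2 i List.mem_cons_self
        omega

end ListStates

/-! ### The transposed action of loop-free programs on linear functionals -/

section Functionals

/-- A finite rational linear combination of coefficient functionals. -/
abbrev FL : Type := List (List ℕ × QCode)

/-- The value of a functional on a power series. -/
noncomputable def ev (m : ℕ) (fl : FL) (G : MvPowerSeries (Fin m) ℝ) : ℝ :=
  (fl.map fun p => (qval p.2 : ℝ) * MvPowerSeries.coeff (toExp m p.1) G).sum

theorem ev_nil (m : ℕ) (G : MvPowerSeries (Fin m) ℝ) : ev m [] G = 0 := rfl

theorem ev_cons (m : ℕ) (p : List ℕ × QCode) (fl : FL) (G : MvPowerSeries (Fin m) ℝ) :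
    ev m (p :: fl) G = qval p.2 * MvPowerSeries.coeff (toExp m p.1) G + ev m fl G := by
  rw [ev, List.map_cons, List.sum_cons, ev]

theorem ev_append (m : ℕ) (fl fl' : FL) (G : MvPowerSeries (Fin m) ℝ) :
    ev m (fl ++ fl') G = ev m fl G + ev m fl' G := by
  rw [ev, List.map_append, List.sum_append, ev, ev]

theorem ev_add (m : ℕ) (fl : FL) (G H : MvPowerSeries (Fin m) ℝ) :
    ev m fl (G + H) = ev m fl G + ev m fl H := by
  induction fl with
  | nil => simp [ev_nil]
  | cons p fl ih => rw [ev_cons, ev_cons, ev_cons, ih, map_add]; ring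

theorem ev_flatMap {α : Type} (m : ℕ) (l : List α) (f : α → FL) (G : MvPowerSeries (Fin m) ℝ) :
    ev m (l.flatMap f) G = (l.map fun a => ev m (f a) G).sum := by
  induction l with
  | nil => rfl
  | cons a l ih => rw [List.flatMap_cons, ev_append, ih, List.map_cons, List.sum_cons]

/-- The transposition principle: to pull a functional back through an operator, replace each
coefficient functional by the corresponding row of the operator. -/
theorem ev_flatMap_eq (m : ℕ) (fl : FL) (f : List ℕ × QCode → FL) (G H : MvPowerSeries (Fin m) ℝ)
    (h : ∀ p, ev m (f p) G = qval p.2 * MvPowerSeries.coeff (toExp m p.1) H) :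
    ev m (fl.flatMap f) G = ev m fl H := by
  rw [ev_flatMap, ev]
  simp only [h]

theorem List.sum_map_range_eq {M : Type} [AddCommMonoid M] (f : ℕ → M) (n : ℕ) :
    ((List.range n).map f).sum = ∑ i ∈ Finset.range n, f i := by
  induction n with
  | zero => rfl
  | succ n ih => rw [List.range_succ, List.map_append, List.sum_append, ih,
      Finset.sum_range_succ, List.map_singleton, List.sum_singleton]

theorem ev_map_range (m n : ℕ) (f : ℕ → List ℕ × QCode) (G : MvPowerSeries (Fin m) ℝ) :
    ev m ((List.range n).map f) G = ∑ i ∈ Finset.range n,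
      (qval (f i).2 : ℝ) * MvPowerSeries.coeff (toExp m (f i).1) G := by
  rw [ev, List.map_map, List.sum_map_range_eq]
  rfl

/-- The length of l is the code under evaluation, and l stores the truth values of all smaller
codes. Indices are raised by one because position 0 belongs to the ghost variable. -/
def guardStep (e : List ℕ) (l : List Bool) : Bool :=
  if l.length.unpair.1 = 0 then
    decide (e.getD (l.length.unpair.2.unpair.1 + 1) 0 < l.length.unpair.2.unpair.2)
  else if l.length.unpair.1 = 1 then !l.getD l.length.unpair.2 false
  else if l.length.unpair.1 = 2 then
    l.getD l.length.unpair.2.unpair.1 false && l.getD l.length.unpair.2.unpair.2 false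
  else l.getD l.length.unpair.2.unpair.1 false || l.getD l.length.unpair.2.unpair.2 false

/-- The truth value of the guard with code `n`. -/
def guardEval (e : List ℕ) (n : ℕ) : Bool := cov guardStep e n

theorem guardEval_eq {k : ℕ} (φ : Guard k) (e : List ℕ) :
    guardEval e φ.code = φ.eval (pullState progVar (toExp (k + k + 1) e)) := by
  induction φ with
  | lt x n =>
    rw [guardEval, cov, guardStep, length_covList, Guard.code]
    simp only [Nat.unpair_pair, if_true]
    rfl
  | neg φ ih =>
    have h := add_le_natPair 1 φ.code
    rw [guardEval, cov, guardStep, length_covList, Guard.code]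
    simp only [Nat.unpair_pair, one_ne_zero, if_true, if_false]
    rw [getD_covList _ _ _ (by omega)]
    exact congrArg (!·) ih
  | and φ ψ ih ih' =>
    have h := add_le_natPair 2 (Nat.pair φ.code ψ.code)
    have h' := add_le_natPair φ.code ψ.code
    rw [guardEval, cov, guardStep, length_covList, Guard.code]
    simp only [Nat.unpair_pair, show ¬ (2 = 0) by decide, show ¬ (2 = 1) by decide, if_true, if_false]
    rw [getD_covList _ _ _ (by omega), getD_covList _ _ _ (by omega)]
    exact congrArg₂ (· && ·) ih ih'
  | or φ ψ ih ih' =>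
    have h := add_le_natPair 3 (Nat.pair φ.code ψ.code)
    have h' := add_le_natPair φ.code ψ.code
    rw [guardEval, cov, guardStep, length_covList, Guard.code]
    simp only [Nat.unpair_pair, show ¬ (3 = 0) by decide, show ¬ (3 = 1) by decide,
      show ¬ (3 = 2) by decide, if_false]
    rw [getD_covList _ _ _ (by omega), getD_covList _ _ _ (by omega)]
    exact congrArg₂ (· || ·) ih ih'

/-! ### Rows of the elementary operators -/

def assignRow (x n : ℕ) (p : List ℕ × QCode) : FL :=
  if p.1.getD (x + 1) 0 = n then (List.range (p.1.getD 0 0 + 1)).map fun i =>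
    (lset (lset p.1 (x + 1) i) 0 (p.1.getD 0 0 - i), p.2) else []

def decrRow (x : ℕ) (p : List ℕ × QCode) : FL :=
  (lset p.1 (x + 1) (p.1.getD (x + 1) 0 + 1), p.2) :: if p.1.getD (x + 1) 0 = 0 then [p] else []

def iidRow (x c y : ℕ) (p : List ℕ × QCode) : FL :=
  (List.range (p.1.getD (x + 1) 0 + 1)).map fun i => (lset p.1 (x + 1) i,
    qmul p.2 (distPow c ((lset p.1 (x + 1) i).getD (y + 1) 0) (p.1.getD (x + 1) 0 - i)))

def guardRow (n : ℕ) (p : List ℕ × QCode) : FL := if guardEval p.1 n then [p] else []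

/-- The functional `G ↦ coeff e (Op G)`, where `Op` is the operator of the instruction with code
`n`: an assignment, a decrement, an addition of samples, or the restriction to a guard. -/
def instrRow (n : ℕ) (p : List ℕ × QCode) : FL :=
  if n.unpair.1 = 0 then assignRow n.unpair.2.unpair.1 n.unpair.2.unpair.2 p
  else if n.unpair.1 = 1 then decrRow n.unpair.2 p
  else if n.unpair.1 = 2 then
    iidRow n.unpair.2.unpair.1 n.unpair.2.unpair.2.unpair.1 n.unpair.2.unpair.2.unpair.2 p
  else guardRow n.unpair.2 p

def applyInstr (n : ℕ) (fl : FL) : FL := fl.flatMap (instrRow n)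

variable {k : ℕ}

theorem ev_assignRow (x : Fin k) (n : ℕ) (p : List ℕ × QCode)
    (G : MvPowerSeries (Fin (k + k + 1)) ℝ) :
    ev (k + k + 1) (assignRow x n p) G
      = qval p.2 * MvPowerSeries.coeff (toExp (k + k + 1) p.1) (asgOp (progVar x) 0 n G) := by
  rw [coeff_asgOp, assignRow]
  have h1 : toExp (k + k + 1) p.1 (progVar x) = p.1.getD (x + 1) 0 := rfl
  have h2 : toExp (k + k + 1) p.1 0 = p.1.getD 0 0 := rfl
  rw [h1, h2]
  split_ifs with h
  · rw [ev_map_range, Finset.Nat.sum_antidiagonal_eq_sum_range_succ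
      (fun i j => MvPowerSeries.coeff (((toExp (k + k + 1) p.1).update (progVar x) i).update 0 j) G),
      Finset.mul_sum]
    refine Finset.sum_congr rfl fun i _ => ?_
    rw [← toExp_lset, ← toExp_lset]
    rfl
  · rw [ev_nil, mul_zero]

theorem ev_decrRow (x : Fin k) (p : List ℕ × QCode) (G : MvPowerSeries (Fin (k + k + 1)) ℝ) :
    ev (k + k + 1) (decrRow x p) G = qval p.2 * MvPowerSeries.coeff (toExp (k + k + 1) p.1)
      (shiftOp (progVar x) G + zeroOp (progVar x) G) := by
  rw [map_add, coeff_shiftOp, coeff_zeroOp, decrRow, ev_cons, ← toExp_lset_add_one, mul_add]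
  have h1 : toExp (k + k + 1) p.1 (progVar x) = p.1.getD (x + 1) 0 := rfl
  rw [h1]
  congr 1
  split_ifs
  · rw [ev_cons, ev_nil, add_zero]
  · rw [ev_nil, mul_zero]

theorem ev_iidRow (x : Fin k) (D : DistExpr) (y : Fin k) (p : List ℕ × QCode)
    (G : MvPowerSeries (Fin (k + k + 1)) ℝ) :
    ev (k + k + 1) (iidRow x D.code y p) G = qval p.2 * MvPowerSeries.coeff (toExp (k + k + 1) p.1)
      (iidOp (progVar x) (progVar y) D.ser G) := by
  rw [coeff_iidOp, iidRow, ev_map_range, Finset.Nat.sum_antidiagonal_eq_sum_range_succ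
    (fun i j => MvPowerSeries.coeff ((toExp (k + k + 1) p.1).update (progVar x) i) G
      * PowerSeries.coeff j (D.ser ^ ((toExp (k + k + 1) p.1).update (progVar x) i) (progVar y))),
    Finset.mul_sum]
  refine Finset.sum_congr rfl fun i _ => ?_
  rw [← toExp_lset, qval_mul, Rat.cast_mul, qval_distPow, mul_assoc, mul_comm (PowerSeries.coeff _ _)]
  rfl

theorem ev_guardRow (φ : Guard k) (p : List ℕ × QCode) (G : MvPowerSeries (Fin (k + k + 1)) ℝ) :
    ev (k + k + 1) (guardRow φ.code p) G = qval p.2 * MvPowerSeries.coeff (toExp (k + k + 1) p.1)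
      (resOp (fun e => φ.eval (pullState progVar e)) G) := by
  rw [coeff_resOp, guardRow, guardEval_eq]
  split_ifs
  · rw [ev_cons, ev_nil, add_zero]
  · rw [ev_nil, mul_zero]

theorem ev_applyInstr_guard (φ : Guard k) (fl : FL) (G : MvPowerSeries (Fin (k + k + 1)) ℝ) :
    ev (k + k + 1) (applyInstr (Nat.pair 3 φ.code) fl) G
      = ev (k + k + 1) fl (resOp (fun e => φ.eval (pullState progVar e)) G) := by
  refine ev_flatMap_eq _ _ _ _ _ fun p => ?_
  rw [instrRow]
  simp only [Nat.unpair_pair, show ¬ (3 = 0) by decide, show ¬ (3 = 1) by decide,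
      show ¬ (3 = 2) by decide, if_false]
  exact ev_guardRow φ p G

theorem ev_applyInstr_guard_not (φ : Guard k) (fl : FL) (G : MvPowerSeries (Fin (k + k + 1)) ℝ) :
    ev (k + k + 1) (applyInstr (Nat.pair 3 (Nat.pair 1 φ.code)) fl) G
      = ev (k + k + 1) fl (resOp (fun e => !φ.eval (pullState progVar e)) G) :=
  ev_applyInstr_guard φ.neg fl G

/-- Tags below 3 are elementary instructions and form a path of their own. Tag 3 marks a conditional
in a program but a guard in a path: each branch is prefixed by the guard or its negation. All larger
tags are treated as sequential composition. -/
def pathStep (_ : Unit) (l : List (List (List ℕ))) : List (List ℕ) :=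
  if l.length.unpair.1 < 3 then [[l.length]]
  else if l.length.unpair.1 = 3 then
    ((l.getD l.length.unpair.2.unpair.2.unpair.1 []).map fun q =>
        Nat.pair 3 l.length.unpair.2.unpair.1 :: q)
      ++ (l.getD l.length.unpair.2.unpair.2.unpair.2 []).map fun q =>
        Nat.pair 3 (Nat.pair 1 l.length.unpair.2.unpair.1) :: q
  else (l.getD l.length.unpair.2.unpair.2 []).flatMap fun q =>
    (l.getD l.length.unpair.2.unpair.1 []).map fun p => p ++ q

/-- The execution paths of the program with code `n`, as lists of instructions. -/
def paths (n : ℕ) : List (List ℕ) := cov pathStep () n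

theorem paths_of_lt {n : ℕ} (h : n.unpair.1 < 3) : paths n = [[n]] := by
  rw [paths, cov, pathStep, length_covList, if_pos h]

theorem paths_ite (a b c : ℕ) : paths (Nat.pair 3 (Nat.pair a (Nat.pair b c)))
    = (paths b).map (fun q => Nat.pair 3 a :: q)
      ++ (paths c).map fun q => Nat.pair 3 (Nat.pair 1 a) :: q := by
  have h := add_le_natPair 3 (Nat.pair a (Nat.pair b c))
  have h' := add_le_natPair a (Nat.pair b c)
  have h'' := add_le_natPair b c
  rw [paths, cov, pathStep, length_covList]
  simp only [Nat.unpair_pair, lt_irrefl, if_false, if_true]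
  rw [getD_covList _ _ _ (by omega), getD_covList _ _ _ (by omega)]
  rfl

theorem paths_seq (b c : ℕ) : paths (Nat.pair 4 (Nat.pair b c))
    = (paths c).flatMap fun q => (paths b).map fun p => p ++ q := by
  have h := add_le_natPair 4 (Nat.pair b c)
  have h' := add_le_natPair b c
  rw [paths, cov, pathStep, length_covList]
  simp only [Nat.unpair_pair, show ¬ (4 < 3) by decide, show ¬ (4 = 3) by decide, if_false]
  rw [getD_covList _ _ _ (by omega), getD_covList _ _ _ (by omega)]
  rfl

/-- Pulling back reverses the order: the right fold starts with the last instruction of the path. -/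
def runPath (fl : FL) (p : List ℕ) : FL := p.foldr applyInstr fl

def runPaths (ps : List (List ℕ)) (fl : FL) : FL := ps.flatMap (runPath fl)

theorem ev_runPaths_cons (m n : ℕ) (ps : List (List ℕ)) (fl : FL) (G H : MvPowerSeries (Fin m) ℝ)
    (h : ∀ fl', ev m (applyInstr n fl') G = ev m fl' H) :
    ev m (runPaths (ps.map fun q => n :: q) fl) G = ev m (runPaths ps fl) H := by
  rw [runPaths, runPaths, List.flatMap_map, ev_flatMap, ev_flatMap]
  refine congrArg List.sum (List.map_congr_left fun q _ => ?_)
  exact h _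

/-- The operator of a loop-free program is the sum of the operators of its execution paths, and each
path acts on functionals by transposition. Flattening the program into paths avoids a recursion with
a changing functional as parameter. -/
theorem ev_runPaths {P : Prog k} (hP : P.LoopFree) (fl : FL)
    (G : MvPowerSeries (Fin (k + k + 1)) ℝ) :
    ev (k + k + 1) (runPaths (paths P.code) fl) G
      = ev (k + k + 1) fl (ghostOp progVar 0 P G) := by
  induction P generalizing fl G with
  | assign x n =>
    rw [paths_of_lt (by simp [Prog.code])]
    change ev (k + k + 1) (applyInstr _ fl ++ []) G = _
    rw [List.append_nil]
    refine ev_flatMap_eq _ _ _ _ _ fun p => ?_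
    rw [instrRow, Prog.code]
    simp only [Nat.unpair_pair, if_true]
    exact ev_assignRow x n p G
  | decr x =>
    rw [paths_of_lt (by simp [Prog.code])]
    change ev (k + k + 1) (applyInstr _ fl ++ []) G = _
    rw [List.append_nil]
    refine ev_flatMap_eq _ _ _ _ _ fun p => ?_
    rw [instrRow, Prog.code]
    simp only [Nat.unpair_pair, one_ne_zero, if_false, if_true]
    exact ev_decrRow x p G
  | iid x D y =>
    rw [paths_of_lt (by simp [Prog.code])]
    change ev (k + k + 1) (applyInstr _ fl ++ []) G = _
    rw [List.append_nil]
    refine ev_flatMap_eq _ _ _ _ _ fun p => ?_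
    rw [instrRow, Prog.code]
    simp only [Nat.unpair_pair, show ¬ (2 = 0) by decide, show ¬ (2 = 1) by decide, if_false, if_true]
    exact ev_iidRow x D y p G
  | ite φ P Q ihP ihQ =>
    rw [Prog.code, paths_ite, runPaths, List.flatMap_append, ev_append]
    refine Eq.trans (congrArg₂ (· + ·)
      (ev_runPaths_cons _ _ _ _ _ _ fun fl' => ev_applyInstr_guard φ fl' G)
      (ev_runPaths_cons _ _ _ _ _ _ fun fl' => ev_applyInstr_guard_not φ fl' G)) ?_
    rw [ihP hP.1, ihQ hP.2, ← ev_add]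
    rfl
  | seq P Q ihP ihQ =>
    have h : runPaths (paths (Prog.seq P Q).code) fl
        = (paths Q.code).flatMap fun q => runPaths (paths P.code) (runPath fl q) := by
      rw [Prog.code, paths_seq, runPaths, List.flatMap_assoc]
      congr 1
      funext q
      rw [List.flatMap_map, runPaths]
      congr 1
      funext p
      exact List.foldr_append
    rw [h, ev_flatMap]
    simp only [ihP hP.1]
    rw [← ev_flatMap]
    exact ihQ hP.2 fl _
  | loop φ P _ => exact hP.elim

/-- The functional `G ↦ coeff e (G' - (restrict G by ¬φ) - G'')`, where `G' = ⟦I⟧ G` and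
`G'' = ⟦I⟧ (⟦P⟧ (restrict G by φ))`, for the codes `a`, `b`, `c` of `φ`, `P`, `I`. -/
def defectFL (a b c : ℕ) (e : List ℕ) : FL :=
  runPaths (paths c) [(e, (1, 0, 0))] ++ (applyInstr (Nat.pair 3 (Nat.pair 1 a)) [(e, (0, 1, 0))]
    ++ applyInstr (Nat.pair 3 a) (runPaths (paths b) (runPaths (paths c) [(e, (0, 1, 0))])))

def diagTest (k : ℕ) (l : List ℕ) : Bool :=
  decide (l.getD 0 0 = 0) && decide (∀ i < k, l.getD (i + 1) 0 = l.getD (i + k + 1) 0)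

/-- The coefficients of the defect series. -/
def defectCoeff (k a b c : ℕ) (e : List ℕ) : QCode :=
  qlsum ((defectFL a b c e).map fun p => if diagTest k p.1 then p.2 else (0, 0, 0))

theorem diagTest_eq (k : ℕ) (l : List ℕ) : MvPowerSeries.coeff (toExp (k + k + 1) l)
    (diagSeries (Finset.univ : Finset (Fin k))) = if diagTest k l then 1 else 0 := by
  rw [coeff_diagSeries, diagTest]
  refine if_congr ?_ rfl rfl
  rw [Bool.and_eq_true, decide_eq_true_iff, decide_eq_true_iff]
  refine and_congr Iff.rfl ?_
  constructor
  · intro h i hi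
    have := h.1 ⟨i, hi⟩
    simpa [toExp_apply, progVar, inputVar] using this
  · intro h
    refine ⟨fun i => ?_, fun i hi => absurd (Finset.mem_univ i) hi⟩
    simpa [toExp_apply, progVar, inputVar] using h i i.2

/-- After transposition only coefficients of the diagonal series are needed, and these are 0 or 1.
The triple (0, 1, 0) is the weight -1 of the subtracted terms. -/
theorem qval_defectCoeff {φ : Guard k} {P I : Prog k} (hP : P.LoopFree) (hI : I.LoopFree)
    (e : List ℕ) : (qval (defectCoeff k φ.code P.code I.code e) : ℝ)
      = MvPowerSeries.coeff (toExp (k + k + 1) e) (defectSeries φ P I) := by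
  have h : ∀ fl : FL, (qval (qlsum (fl.map fun p => if diagTest k p.1 then p.2 else (0, 0, 0))) : ℝ)
      = ev (k + k + 1) fl (diagSeries (Finset.univ : Finset (Fin k))) := by
    intro fl
    induction fl with
    | nil => rw [ev_nil, List.map_nil]; exact_mod_cast qval_zero
    | cons p fl ih =>
      rw [ev_cons, ← ih, List.map_cons, diagTest_eq]
      change ((qval (qadd _ _) : ℚ) : ℝ) = _
      rw [qval_add, Rat.cast_add]
      congr 1
      split_ifs
      · rw [mul_one]
      · rw [mul_zero, qval_zero, Rat.cast_zero]
  have h1 : qval (0, 1, 0) = -1 := by simp [qval]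
  rw [defectCoeff, h, defectFL, ev_append, ev_append, ev_runPaths hI, ev_applyInstr_guard_not,
    ev_applyInstr_guard, ev_runPaths hP, ev_runPaths hI, ev_cons, ev_cons, ev_cons, ev_nil, ev_nil,
    ev_nil, defectSeries, map_sub, map_add, qval_one, h1]
  push_cast
  ring

end Functionals

/-! ### The test whether a slice of the defect series has sum zero -/

section SliceTest

def qzero (r : QCode) : Bool := decide (r.1 = r.2.1)

theorem qzero_iff (r : QCode) : qzero r = true ↔ qval r = 0 := by
  rw [qzero, decide_eq_true_iff, qval_eq_zero_iff]

/-- The coefficients of a truncated polynomial. -/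
def truncCoeff (B : ℕ) (l : List QCode) (i : ℕ) : QCode := if i ≤ B then l.getD i (0, 0, 0) else (0, 0, 0)

def convCoeff (B : ℕ) (l : List QCode) (d : ℕ → QCode) (n : ℕ) : QCode :=
  qsum (n + 1) fun i => qmul (truncCoeff B l i) (d (n - i))

theorem qval_convCoeff (B : ℕ) (l : List QCode) (d : ℕ → QCode) (n : ℕ) :
    qval (convCoeff B l d n) = ∑ p ∈ Finset.HasAntidiagonal.antidiagonal n,
      qval (truncCoeff B l p.1) * qval (d p.2) := by
  rw [convCoeff, qval_sum, Finset.Nat.sum_antidiagonal_eq_sum_range_succ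
    (fun i j => qval (truncCoeff B l i) * qval (d j))]
  simp only [qval_mul]

/-- `l` is the denominator of a Padé approximant of the series `d` of degree `B` which can be
evaluated at `1`. -/
def padeTest (B : ℕ) (l : List QCode) (d : ℕ → QCode) : Bool :=
  decide (∀ j < B, qzero (convCoeff B l d (B + 1 + j)) = true) &&
    (!qzero (qsum (B + 1) (truncCoeff B l)) || !qzero (qsum (B + 1) (convCoeff B l d)))

theorem padeTest_iff (B : ℕ) (l : List QCode) (d : ℕ → QCode) : padeTest B l d = true ↔
    (∀ n, B < n → n ≤ 2 * B → ∑ p ∈ Finset.HasAntidiagonal.antidiagonal n,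
      qval (truncCoeff B l p.1) * qval (d p.2) = 0) ∧
      (∑ i ∈ Finset.range (B + 1), qval (truncCoeff B l i) ≠ 0 ∨ ∑ n ∈ Finset.range (B + 1),
        ∑ p ∈ Finset.HasAntidiagonal.antidiagonal n,
          qval (truncCoeff B l p.1) * qval (d p.2) ≠ 0) := by
  rw [padeTest, Bool.and_eq_true, Bool.or_eq_true, decide_eq_true_iff, Bool.not_eq_true',
    Bool.not_eq_true', ← Bool.not_eq_true, ← Bool.not_eq_true, qzero_iff, qzero_iff, qval_sum,
    qval_sum]
  simp only [qzero_iff, qval_convCoeff]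
  refine and_congr_left fun _ => ⟨fun h n hn hn' => ?_, fun h j hj => h _ (by omega) (by omega)⟩
  have := h (n - (B + 1)) (by omega)
  rwa [show B + 1 + (n - (B + 1)) = n by omega] at this

theorem exists_padeTest (B : ℕ) (d : ℕ → QCode) : ∃ l, padeTest B l d = true := by
  obtain ⟨β, h1, h2, h3⟩ := exists_pade_coeff B fun n => qval (d n)
  refine ⟨(List.range (B + 1)).map fun i => qdecode (ratCode (β i)), (padeTest_iff _ _ _).2 ?_⟩
  have h : ∀ i, qval (truncCoeff B ((List.range (B + 1)).map fun i => qdecode (ratCode (β i))) i)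
      = β i := by
    intro i
    rw [truncCoeff]
    split_ifs with hi
    · rw [List.getD_eq_getElem _ _ (by simpa using Nat.lt_succ_of_le hi), List.getElem_map,
        List.getElem_range, qval_decode_ratCode]
    · rw [qval_zero, h1 i (by omega)]
  simp only [h]
  exact ⟨h2, h3⟩

/-- Any list that passes the test yields the right answer, so it does not matter which one the
search returns. -/
theorem hasSum_zero_iff_padeTest {B : ℕ} {d : ℕ → QCode} {l : List QCode}
    (hl : padeTest B l d = true) {S : ℝ} (hd : HasSum (fun n => (qval (d n) : ℝ)) S)
    {p q : Polynomial ℝ} (hp : p.natDegree ≤ B) (hq : q.natDegree ≤ B) (hq0 : q.coeff 0 ≠ 0)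
    (hpq : (q : PowerSeries ℝ) * PowerSeries.mk (fun n => (qval (d n) : ℝ)) = p) :
    HasSum (fun n => (qval (d n) : ℝ)) 0 ↔ qzero (qsum (B + 1) (convCoeff B l d)) = true := by
  obtain ⟨h1, h2⟩ := (padeTest_iff _ _ _).1 hl
  rw [hasSum_zero_iff_pade (β := fun i => (qval (truncCoeff B l i) : ℝ)) hd hp hq hq0 hpq, qzero_iff,
    qval_sum]
  · simp only [qval_convCoeff]
    exact_mod_cast Iff.rfl
  · intro i hi
    rw [truncCoeff, if_neg (by omega), qval_zero, Rat.cast_zero]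
  · intro n hn hn'
    exact_mod_cast h1 n hn hn'
  · exact_mod_cast h2

end SliceTest


/-! ### Primitive recursiveness of the computation -/

attribute [fun_prop] Primrec

section PrimrecBasic

variable {α β γ : Type} [Primcodable α] [Primcodable β] [Primcodable γ]

@[fun_prop] theorem Primrec.id_fun : Primrec fun a : α => a := Primrec.id

@[fun_prop] theorem Primrec.const_fun (b : β) : Primrec fun _ : α => b := Primrec.const b

@[fun_prop] theorem Primrec.comp_fun {f : β → γ} {g : α → β} (hf : Primrec f) (hg : Primrec g) :
    Primrec fun a => f (g a) := hf.comp hg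

@[fun_prop] theorem Primrec.fst_fun {f : α → β × γ} (hf : Primrec f) : Primrec fun a => (f a).1 :=
  Primrec.fst.comp hf

@[fun_prop] theorem Primrec.snd_fun {f : α → β × γ} (hf : Primrec f) : Primrec fun a => (f a).2 :=
  Primrec.snd.comp hf

@[fun_prop] theorem Primrec.pair_fun {f : α → β} {g : α → γ} (hf : Primrec f) (hg : Primrec g) :
    Primrec fun a => (f a, g a) := hf.pair hg

@[fun_prop] theorem Primrec.add_fun {f g : α → ℕ} (hf : Primrec f) (hg : Primrec g) :
    Primrec fun a => f a + g a := Primrec.nat_add.comp hf hg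

@[fun_prop] theorem Primrec.mul_fun {f g : α → ℕ} (hf : Primrec f) (hg : Primrec g) :
    Primrec fun a => f a * g a := Primrec.nat_mul.comp hf hg

@[fun_prop] theorem Primrec.sub_fun {f g : α → ℕ} (hf : Primrec f) (hg : Primrec g) :
    Primrec fun a => f a - g a := Primrec.nat_sub.comp hf hg

@[fun_prop] theorem Primrec.pow_fun {f g : α → ℕ} (hf : Primrec f) (hg : Primrec g) :
    Primrec fun a => f a ^ g a := (Primrec₂.unpaired'.1 Nat.Primrec.pow).comp hf hg

@[fun_prop] theorem Primrec.max_fun {f g : α → ℕ} (hf : Primrec f) (hg : Primrec g) :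
    Primrec fun a => max (f a) (g a) := Primrec.nat_max.comp hf hg

@[fun_prop] theorem Primrec.natPair_fun {f g : α → ℕ} (hf : Primrec f) (hg : Primrec g) :
    Primrec fun a => Nat.pair (f a) (g a) := Primrec₂.natPair.comp hf hg

@[fun_prop] theorem Primrec.unpair_fun {f : α → ℕ} (hf : Primrec f) :
    Primrec fun a => (f a).unpair := Primrec.unpair.comp hf

@[fun_prop] theorem Primrec.not_fun {f : α → Bool} (hf : Primrec f) : Primrec fun a => !f a :=
  Primrec.not.comp hf

@[fun_prop] theorem Primrec.and_fun {f g : α → Bool} (hf : Primrec f) (hg : Primrec g) :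
    Primrec fun a => f a && g a := Primrec.and.comp hf hg

@[fun_prop] theorem Primrec.or_fun {f g : α → Bool} (hf : Primrec f) (hg : Primrec g) :
    Primrec fun a => f a || g a := Primrec.or.comp hf hg

@[fun_prop] theorem Primrec.decide_eq_fun {f g : α → ℕ} (hf : Primrec f) (hg : Primrec g) :
    Primrec fun a => decide (f a = g a) :=
  primrecPred_iff_primrec_decide.1 (Primrec.eq.comp hf hg)

@[fun_prop] theorem Primrec.decide_lt_fun {f g : α → ℕ} (hf : Primrec f) (hg : Primrec g) :
    Primrec fun a => decide (f a < g a) :=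
  primrecPred_iff_primrec_decide.1 (Primrec.nat_lt.comp hf hg)

theorem Primrec.decide_forall_lt_fun {n : α → ℕ} {p : α → ℕ → Prop} [∀ a i, Decidable (p a i)]
    (hn : Primrec n) (hp : Primrec fun q : α × ℕ => decide (p q.1 q.2)) :
    Primrec fun a => decide (∀ i < n a, p a i) := by
  have h : PrimrecRel fun (i : ℕ) (a : α) => p a i :=
    PrimrecPred.primrecRel (p := fun q : ℕ × α => p q.2 q.1)
      (primrecPred_iff_primrec_decide.2 (hp.comp (Primrec.snd.pair Primrec.fst)))
  refine primrecPred_iff_primrec_decide.1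
    ((h.forall_mem_list.comp (Primrec.list_range.comp hn) Primrec.id).of_eq fun a => ?_)
  simp only [List.mem_range, id]

@[fun_prop] theorem Primrec.ite_eq_fun {f g : α → ℕ} {u v : α → β} (hf : Primrec f)
    (hg : Primrec g) (hu : Primrec u) (hv : Primrec v) :
    Primrec fun a => if f a = g a then u a else v a := Primrec.ite (Primrec.eq.comp hf hg) hu hv

@[fun_prop] theorem Primrec.ite_lt_fun {f g : α → ℕ} {u v : α → β} (hf : Primrec f)
    (hg : Primrec g) (hu : Primrec u) (hv : Primrec v) :
    Primrec fun a => if f a < g a then u a else v a := Primrec.ite (Primrec.nat_lt.comp hf hg) hu hv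

@[fun_prop] theorem Primrec.ite_le_fun {f g : α → ℕ} {u v : α → β} (hf : Primrec f)
    (hg : Primrec g) (hu : Primrec u) (hv : Primrec v) :
    Primrec fun a => if f a ≤ g a then u a else v a := Primrec.ite (Primrec.nat_le.comp hf hg) hu hv

@[fun_prop] theorem Primrec.ite_bool_fun {f : α → Bool} {u v : α → β} (hf : Primrec f)
    (hu : Primrec u) (hv : Primrec v) : Primrec fun a => if f a = true then u a else v a :=
  Primrec.ite (Primrec.eq.comp hf (Primrec.const true)) hu hv

@[fun_prop] theorem Primrec.cons_fun {f : α → β} {g : α → List β} (hf : Primrec f)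
    (hg : Primrec g) : Primrec fun a => f a :: g a := Primrec.list_cons.comp hf hg

@[fun_prop] theorem Primrec.append_fun {f g : α → List β} (hf : Primrec f) (hg : Primrec g) :
    Primrec fun a => f a ++ g a := Primrec.list_append.comp hf hg

@[fun_prop] theorem Primrec.length_fun {f : α → List β} (hf : Primrec f) :
    Primrec fun a => (f a).length := Primrec.list_length.comp hf

@[fun_prop] theorem Primrec.getD_fun {f : α → List β} {g : α → ℕ} (hf : Primrec f)
    (hg : Primrec g) (d : β) : Primrec fun a => (f a).getD (g a) d :=
  (Primrec.list_getD d).comp hf hg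

@[fun_prop] theorem Primrec.range_fun {f : α → ℕ} (hf : Primrec f) :
    Primrec fun a => List.range (f a) := Primrec.list_range.comp hf

@[fun_prop] theorem Primrec.map_fun {f : α → List β} {g : α → β → γ} (hf : Primrec f)
    (hg : Primrec fun p : α × β => g p.1 p.2) : Primrec fun a => (f a).map (g a) :=
  Primrec.list_map hf hg

@[fun_prop] theorem Primrec.flatMap_fun {f : α → List β} {g : α → β → List γ} (hf : Primrec f)
    (hg : Primrec fun p : α × β => g p.1 p.2) : Primrec fun a => (f a).flatMap (g a) :=
  Primrec.list_flatMap hf hg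

@[fun_prop] theorem Primrec.foldr_fun {f : α → List β} {g : α → β → γ → γ} {z : α → γ}
    (hf : Primrec f) (hz : Primrec z) (hg : Primrec fun p : α × β × γ => g p.1 p.2.1 p.2.2) :
    Primrec fun a => (f a).foldr (g a) (z a) :=
  Primrec.list_foldr (h := fun a q => g a q.1 q.2) hf hz hg

/-- Keeping the whole list of earlier values turns course-of-values recursion into ordinary
primitive recursion. -/
theorem Primrec.covList_fun {step : α → List β → β}
    (hs : Primrec fun p : α × List β => step p.1 p.2) {f : γ → α} {g : γ → ℕ} (hf : Primrec f)
    (hg : Primrec g) : Primrec fun c => covList step (f c) (g c) :=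
  Primrec.nat_rec' (f := g) (g := fun _ => []) (h := fun c q => q.2 ++ [step (f c) q.2]) hg
    (by fun_prop) (by
      have : Primrec fun p : γ × ℕ × List β => step (f p.1) p.2.2 :=
        hs.comp ((hf.comp Primrec.fst).pair (Primrec.snd.comp Primrec.snd))
      change Primrec fun p : γ × ℕ × List β => p.2.2 ++ [step (f p.1) p.2.2]
      fun_prop)

theorem Primrec.cov_fun {step : α → List β → β}
    (hs : Primrec fun p : α × List β => step p.1 p.2) {f : γ → α} {g : γ → ℕ} (hf : Primrec f)
    (hg : Primrec g) : Primrec fun c => cov step (f c) (g c) :=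
  hs.comp (hf.pair (Primrec.covList_fun hs hf hg))

end PrimrecBasic

/-! ### Primitive recursiveness of the individual algorithms -/

section PrimrecComputation

variable {α : Type} [Primcodable α]

@[fun_prop] theorem Primrec.qadd_fun {f g : α → QCode} (hf : Primrec f) (hg : Primrec g) :
    Primrec fun a => qadd (f a) (g a) := by unfold qadd; fun_prop

@[fun_prop] theorem Primrec.qmul_fun {f g : α → QCode} (hf : Primrec f) (hg : Primrec g) :
    Primrec fun a => qmul (f a) (g a) := by unfold qmul; fun_prop

@[fun_prop] theorem Primrec.qneg_fun {f : α → QCode} (hf : Primrec f) :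
    Primrec fun a => qneg (f a) := by unfold qneg; fun_prop

@[fun_prop] theorem Primrec.qinv_fun {f : α → QCode} (hf : Primrec f) :
    Primrec fun a => qinv (f a) := by unfold qinv; fun_prop

@[fun_prop] theorem Primrec.qzero_fun {f : α → QCode} (hf : Primrec f) :
    Primrec fun a => qzero (f a) := by unfold qzero; fun_prop

@[fun_prop] theorem Primrec.qdecode_fun {f : α → ℕ} (hf : Primrec f) :
    Primrec fun a => qdecode (f a) := by unfold qdecode; fun_prop

@[fun_prop] theorem Primrec.qsum_fun {n : α → ℕ} {f : α → ℕ → QCode} (hn : Primrec n)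
    (hf : Primrec fun p : α × ℕ => f p.1 p.2) : Primrec fun a => qsum (n a) (f a) :=
  Primrec.nat_rec' (f := n) (g := fun _ => (0, 0, 0)) (h := fun a q => qadd q.2 (f a q.1)) hn
    (by fun_prop) (by
      have : Primrec fun p : α × ℕ × QCode => f p.1 p.2.1 :=
        hf.comp (Primrec.fst.pair (Primrec.fst.comp Primrec.snd))
      change Primrec fun p : α × ℕ × QCode => qadd p.2.2 (f p.1 p.2.1)
      fun_prop)

@[fun_prop] theorem Primrec.qlsum_fun {f : α → List QCode} (hf : Primrec f) :
    Primrec fun a => qlsum (f a) := by unfold qlsum; fun_prop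

@[fun_prop] theorem Primrec.decodeList_fun {f : α → ℕ} (hf : Primrec f) :
    Primrec fun a => decodeList (f a) :=
  Primrec.option_getD.comp (Primrec.decode.comp hf) (Primrec.const [])

@[fun_prop] theorem Primrec.distCoeff_fun {f g : α → ℕ} (hf : Primrec f) (hg : Primrec g) :
    Primrec fun a => distCoeff (f a) (g a) := by
  refine Primrec.cov_fun ?_ hf hg
  unfold distStep
  fun_prop

@[fun_prop] theorem Primrec.distPow_fun {f g h : α → ℕ} (hf : Primrec f) (hg : Primrec g)
    (hh : Primrec h) : Primrec fun a => distPow (f a) (g a) (h a) := by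
  have key : Primrec fun a => distPowList (f a) (h a) (g a) := by
    refine Primrec.nat_rec' (f := g)
      (g := fun a => (List.range (h a + 1)).map fun i => if i = 0 then (1, 0, 0) else (0, 0, 0))
      (h := fun a q => (List.range (h a + 1)).map fun n => qsum (n + 1) fun i =>
        qmul (q.2.getD i (0, 0, 0)) (distCoeff (f a) (n - i))) hg (by fun_prop) ?_
    change Primrec fun p : α × ℕ × List QCode => (List.range (h p.1 + 1)).map fun n =>
      qsum (n + 1) fun i => qmul (p.2.2.getD i (0, 0, 0)) (distCoeff (f p.1) (n - i))
    fun_prop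
  unfold distPow
  fun_prop

@[fun_prop] theorem Primrec.lset_fun {l : α → List ℕ} {f g : α → ℕ} (hl : Primrec l)
    (hf : Primrec f) (hg : Primrec g) : Primrec fun a => lset (l a) (f a) (g a) := by
  unfold lset; fun_prop

@[fun_prop] theorem Primrec.boxes_fun {f g : α → ℕ} (hf : Primrec f) (hg : Primrec g) :
    Primrec fun a => boxes (f a) (g a) := by
  refine Primrec.nat_rec' (f := g) (g := fun _ => [[]]) (h := fun a q => q.2.flatMap fun l =>
    (List.range (f a + 1)).map fun i => i :: l) hg (by fun_prop) ?_
  change Primrec fun p : α × ℕ × List (List ℕ) => p.2.2.flatMap fun l =>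
    (List.range (f p.1 + 1)).map fun i => i :: l
  fun_prop

@[fun_prop] theorem Primrec.guardEval_fun {f : α → List ℕ} {g : α → ℕ} (hf : Primrec f)
    (hg : Primrec g) : Primrec fun a => guardEval (f a) (g a) := by
  refine Primrec.cov_fun ?_ hf hg
  unfold guardStep
  fun_prop

@[fun_prop] theorem Primrec.assignRow_fun {f g : α → ℕ} {p : α → List ℕ × QCode}
    (hf : Primrec f) (hg : Primrec g) (hp : Primrec p) :
    Primrec fun a => assignRow (f a) (g a) (p a) := by unfold assignRow; fun_prop

@[fun_prop] theorem Primrec.decrRow_fun {f : α → ℕ} {p : α → List ℕ × QCode} (hf : Primrec f)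
    (hp : Primrec p) : Primrec fun a => decrRow (f a) (p a) := by unfold decrRow; fun_prop

@[fun_prop] theorem Primrec.iidRow_fun {f g h : α → ℕ} {p : α → List ℕ × QCode}
    (hf : Primrec f) (hg : Primrec g) (hh : Primrec h) (hp : Primrec p) :
    Primrec fun a => iidRow (f a) (g a) (h a) (p a) := by unfold iidRow; fun_prop

@[fun_prop] theorem Primrec.guardRow_fun {f : α → ℕ} {p : α → List ℕ × QCode} (hf : Primrec f)
    (hp : Primrec p) : Primrec fun a => guardRow (f a) (p a) := by unfold guardRow; fun_prop

@[fun_prop] theorem Primrec.instrRow_fun {f : α → ℕ} {p : α → List ℕ × QCode} (hf : Primrec f)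
    (hp : Primrec p) : Primrec fun a => instrRow (f a) (p a) := by unfold instrRow; fun_prop

@[fun_prop] theorem Primrec.applyInstr_fun {f : α → ℕ} {g : α → FL} (hf : Primrec f)
    (hg : Primrec g) : Primrec fun a => applyInstr (f a) (g a) := by unfold applyInstr; fun_prop

@[fun_prop] theorem Primrec.paths_fun {f : α → ℕ} (hf : Primrec f) :
    Primrec fun a => paths (f a) := by
  refine Primrec.cov_fun ?_ (Primrec.const ()) hf
  unfold pathStep
  fun_prop

@[fun_prop] theorem Primrec.runPath_fun {f : α → FL} {g : α → List ℕ} (hf : Primrec f)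
    (hg : Primrec g) : Primrec fun a => runPath (f a) (g a) := by unfold runPath; fun_prop

@[fun_prop] theorem Primrec.runPaths_fun {f : α → List (List ℕ)} {g : α → FL} (hf : Primrec f)
    (hg : Primrec g) : Primrec fun a => runPaths (f a) (g a) := by unfold runPaths; fun_prop

@[fun_prop] theorem Primrec.defectFL_fun {f g h : α → ℕ} {e : α → List ℕ} (hf : Primrec f)
    (hg : Primrec g) (hh : Primrec h) (he : Primrec e) :
    Primrec fun a => defectFL (f a) (g a) (h a) (e a) := by unfold defectFL; fun_prop

@[fun_prop] theorem Primrec.diagTest_fun {f : α → ℕ} {l : α → List ℕ} (hf : Primrec f)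
    (hl : Primrec l) : Primrec fun a => diagTest (f a) (l a) := by
  unfold diagTest
  have := Primrec.decide_forall_lt_fun (n := f)
    (p := fun a i => (l a).getD (i + 1) 0 = (l a).getD (i + f a + 1) 0) hf (by fun_prop)
  fun_prop

@[fun_prop] theorem Primrec.defectCoeff_fun {j f g h : α → ℕ} {e : α → List ℕ} (hj : Primrec j)
    (hf : Primrec f) (hg : Primrec g) (hh : Primrec h) (he : Primrec e) :
    Primrec fun a => defectCoeff (j a) (f a) (g a) (h a) (e a) := by unfold defectCoeff; fun_prop

@[fun_prop] theorem Primrec.defectBound_fun {j f g h : α → ℕ} (hj : Primrec j)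
    (hf : Primrec f) (hg : Primrec g) (hh : Primrec h) :
    Primrec fun a => defectBound (j a) (f a) (g a) (h a) := by
  unfold defectBound codeBound; fun_prop

@[fun_prop] theorem Primrec.truncCoeff_fun {f g : α → ℕ} {l : α → List QCode} (hf : Primrec f)
    (hl : Primrec l) (hg : Primrec g) : Primrec fun a => truncCoeff (f a) (l a) (g a) := by
  unfold truncCoeff; fun_prop

theorem Primrec.convCoeff_fun {f g : α → ℕ} {l : α → List QCode} {d : α → ℕ → QCode}
    (hf : Primrec f) (hl : Primrec l) (hd : Primrec fun p : α × ℕ => d p.1 p.2) (hg : Primrec g) :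
    Primrec fun a => convCoeff (f a) (l a) (d a) (g a) := by
  unfold convCoeff
  have h : Primrec fun p : α × ℕ => g p.1 - p.2 := by fun_prop
  have : Primrec fun p : α × ℕ => d p.1 (g p.1 - p.2) := hd.comp (Primrec.fst.pair h)
  fun_prop

theorem Primrec.qsum_convCoeff_fun {f : α → ℕ} {l : α → List QCode} {d : α → ℕ → QCode}
    (hf : Primrec f) (hl : Primrec l) (hd : Primrec fun p : α × ℕ => d p.1 p.2) :
    Primrec fun a => qzero (qsum (f a + 1) (convCoeff (f a) (l a) (d a))) := by
  have : Primrec fun p : α × ℕ => convCoeff (f p.1) (l p.1) (d p.1) p.2 :=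
    Primrec.convCoeff_fun (d := fun p : α × ℕ => d p.1) (by fun_prop) (by fun_prop)
      (hd.comp ((Primrec.fst.comp Primrec.fst).pair Primrec.snd)) (by fun_prop)
  fun_prop

theorem Primrec.padeTest_fun {f : α → ℕ} {l : α → List QCode} {d : α → ℕ → QCode}
    (hf : Primrec f) (hl : Primrec l) (hd : Primrec fun p : α × ℕ => d p.1 p.2) :
    Primrec fun a => padeTest (f a) (l a) (d a) := by
  unfold padeTest
  have h1 := Primrec.qsum_convCoeff_fun hf hl hd
  have h2 : Primrec fun p : α × ℕ => convCoeff (f p.1) (l p.1) (d p.1) (f p.1 + 1 + p.2) :=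
    Primrec.convCoeff_fun (d := fun p : α × ℕ => d p.1) (by fun_prop) (by fun_prop)
      (hd.comp ((Primrec.fst.comp Primrec.fst).pair Primrec.snd)) (by fun_prop)
  have h3 := Primrec.decide_forall_lt_fun (n := f)
    (p := fun a j => qzero (convCoeff (f a) (l a) (d a) (f a + 1 + j)) = true) hf (by
      simp only [Bool.decide_eq_true]
      fun_prop)
  fun_prop

end PrimrecComputation

/-! ### The decision procedure -/

section Decision

/-- Unbounded search for a witness that always exists is computable. -/
theorem exists_computable_search {α : Type} [Primcodable α] {c : α → ℕ → Bool}
    (hc : Computable₂ c) (h : ∀ a, ∃ n, c a n = true) :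
    ∃ s : α → ℕ, Computable s ∧ ∀ a, c a (s a) = true := by
  refine ⟨fun a => Nat.find (h a), ?_, fun a => Nat.find_spec (h a)⟩
  have h1 : Partrec fun a => Nat.rfind fun n => Part.some (c a n) := Partrec.rfind hc.partrec₂
  refine h1.of_eq fun a => ?_
  refine Part.eq_some_iff.2 (Nat.mem_rfind.2 ⟨?_, fun {m} hm => ?_⟩)
  · rw [Part.mem_some_iff]
    exact (Nat.find_spec (h a)).symm
  · rw [Part.mem_some_iff]
    exact (Bool.eq_false_iff.2 (Nat.find_min (h a) hm)).symm

/-- A computable test on all members of a computable list. -/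
theorem Computable.forall_mem_list {α β : Type} [Primcodable α] [Primcodable β] (b₀ : β)
    {l : α → List β} (hl : Computable l) {t : α × β → Bool} (ht : Computable t) :
    ∃ d : α → Bool, Computable d ∧ ∀ a, d a = true ↔ ∀ b ∈ l a, t (a, b) = true := by
  refine ⟨fun a => Nat.rec true (fun j r => r && t (a, (l a).getD j b₀)) (l a).length, ?_, ?_⟩
  · refine Computable.nat_rec (f := fun a => (l a).length) (g := fun _ => true)
      (h := fun a q => q.2 && t (a, (l a).getD q.1 b₀)) (Computable.list_length.comp hl)
      (Computable.const true) ?_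
    refine Primrec.and.to_comp.comp (Computable.snd.comp Computable.snd) (ht.comp ?_)
    exact Computable.fst.pair ((Primrec.list_getD b₀).to_comp.comp (hl.comp Computable.fst)
      (Computable.fst.comp Computable.snd))
  · intro a
    have h : ∀ n, (Nat.rec true (fun j r => r && t (a, (l a).getD j b₀)) n : Bool) = true ↔
        ∀ j < n, t (a, (l a).getD j b₀) = true := by
      intro n
      induction n with
      | zero => simp
      | succ n ih => rw [Bool.and_eq_true, ih, Nat.forall_lt_succ_right]
    rw [h]
    constructor
    · intro h1 b hb
      obtain ⟨j, hj, rfl⟩ := List.mem_iff_getElem.1 hb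
      have := h1 j hj
      rwa [List.getD_eq_getElem _ _ hj] at this
    · intro h1 j hj
      rw [List.getD_eq_getElem _ _ hj]
      exact h1 _ (List.getElem_mem hj)

/-- The degree bound for the defect series of the loop with code `x.2.1` and the program with code
`x.2.2`. -/
def inputBound (x : ℕ × ℕ × ℕ) : ℕ :=
  defectBound x.1 x.2.1.unpair.2.unpair.1 x.2.1.unpair.2.unpair.2 x.2.2

/-- The degree bound for the slices of the defect series that have to be tested. -/
def sliceBound (x : ℕ × ℕ × ℕ) : ℕ := ((x.1 + x.1) * inputBound x + 1) * inputBound x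

def sliceCoeff (q : (ℕ × ℕ × ℕ) × List ℕ) (n : ℕ) : QCode :=
  defectCoeff q.1.1 q.1.2.1.unpair.2.unpair.1 q.1.2.1.unpair.2.unpair.2 q.1.2.2 (n :: q.2)

def decodeQList (n : ℕ) : List QCode := (Encodable.decode (α := List QCode) n).getD []

theorem primrec_inputBound : Primrec inputBound := by unfold inputBound; fun_prop

theorem primrec_sliceBound : Primrec sliceBound := by
  have := primrec_inputBound
  unfold sliceBound
  fun_prop

@[fun_prop] theorem Primrec.sliceCoeff_fun {α : Type} [Primcodable α]
    {f : α → (ℕ × ℕ × ℕ) × List ℕ} {g : α → ℕ} (hf : Primrec f) (hg : Primrec g) :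
    Primrec fun a => sliceCoeff (f a) (g a) := by
  unfold sliceCoeff; fun_prop

theorem primrec_decodeQList : Primrec decodeQList :=
  Primrec.option_getD.comp Primrec.decode (Primrec.const [])

theorem exists_padeTest_decode (B : ℕ) (d : ℕ → QCode) :
    ∃ n, padeTest B (decodeQList n) d = true := by
  obtain ⟨l, hl⟩ := exists_padeTest B d
  refine ⟨Encodable.encode l, ?_⟩
  have : decodeQList (Encodable.encode l) = l := by
    rw [decodeQList, Encodable.encodek, Option.getD_some]
  rw [this]
  exact hl

/-- The approximant is found by unbounded search, which stops on every input because an approximant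
exists for every sequence of rationals, whether or not the input codes a program. This makes the
test total. -/
theorem exists_computable_sliceTest : ∃ t : (ℕ × ℕ × ℕ) × List ℕ → Bool, Computable t ∧
    ∀ q, ∃ l, padeTest (sliceBound q.1) l (sliceCoeff q) = true ∧
      t q = qzero (qsum (sliceBound q.1 + 1) (convCoeff (sliceBound q.1) l (sliceCoeff q))) := by
  have h1 := primrec_sliceBound
  have h2 := primrec_decodeQList
  have hd : Primrec fun p : (((ℕ × ℕ × ℕ) × List ℕ) × ℕ) × ℕ => sliceCoeff p.1.1 p.2 := by
    fun_prop
  have h4 : Primrec fun p : ((ℕ × ℕ × ℕ) × List ℕ) × ℕ => sliceBound p.1.1 := by fun_prop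
  have h5 : Primrec fun p : ((ℕ × ℕ × ℕ) × List ℕ) × ℕ => decodeQList p.2 := by fun_prop
  have hc : Primrec fun p : ((ℕ × ℕ × ℕ) × List ℕ) × ℕ =>
      padeTest (sliceBound p.1.1) (decodeQList p.2) (sliceCoeff p.1) :=
    Primrec.padeTest_fun h4 h5 hd
  have hc' : Computable₂ fun (q : (ℕ × ℕ × ℕ) × List ℕ) n =>
      padeTest (sliceBound q.1) (decodeQList n) (sliceCoeff q) := hc.to_comp
  obtain ⟨s, hs, hs'⟩ := exists_computable_search hc' fun q => exists_padeTest_decode _ _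
  have h3 : Primrec fun p : ((ℕ × ℕ × ℕ) × List ℕ) × ℕ =>
      qzero (qsum (sliceBound p.1.1 + 1)
        (convCoeff (sliceBound p.1.1) (decodeQList p.2) (sliceCoeff p.1))) :=
    Primrec.qsum_convCoeff_fun h4 h5 hd
  have hid : Computable fun q : (ℕ × ℕ × ℕ) × List ℕ => (q, s q) := Computable.id.pair hs
  exact ⟨_, h3.to_comp.comp hid, fun q => ⟨decodeQList (s q), hs' q, rfl⟩⟩

theorem toExp_degree_le {m B : ℕ} {l : List ℕ} (hl : l ∈ boxes B m) : (toExp m l).degree ≤ m * B := by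
  rw [Finsupp.degree_eq_sum]
  refine (Finset.sum_le_card_nsmul _ _ B fun i _ => ?_).trans (by simp)
  obtain ⟨h1, h2⟩ := (mem_boxes B m l).1 hl
  rw [toExp_apply, List.getD_eq_getElem _ _ (by rw [h1]; exact i.2)]
  exact h2 _ (List.getElem_mem _)

theorem hasSum_slice_iff {k : ℕ} {φ : Guard k} {P I : Prog k} (hP : P.LoopFree) (hI : I.LoopFree)
    {q : (ℕ × ℕ × ℕ) × List ℕ} (hq : q.1 = (k, (Prog.loop φ P).code, I.code))
    (hbox : q.2 ∈ boxes (inputBound q.1) (k + k)) {l : List QCode}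
    (hl : padeTest (sliceBound q.1) l (sliceCoeff q) = true) :
    HasSum (fun ζ => PowerSeries.coeff ζ (slice (toExp (k + k) q.2) (defectSeries φ P I))) 0 ↔
      qzero (qsum (sliceBound q.1 + 1) (convCoeff (sliceBound q.1) l (sliceCoeff q))) = true := by
  have hB : inputBound q.1 = defectBound k φ.code P.code I.code := by
    rw [hq, inputBound, Prog.code, Nat.unpair_pair, Nat.unpair_pair]
  have hd : (fun n => (qval (sliceCoeff q n) : ℝ))
      = fun ζ => PowerSeries.coeff ζ (slice (toExp (k + k) q.2) (defectSeries φ P I)) := by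
    funext n
    rw [sliceCoeff, hq, Prog.code, Nat.unpair_pair, Nat.unpair_pair, coeff_slice, ← toExp_cons]
    exact qval_defectCoeff hP hI _
  have hS := hasSum_slice_defectSeries (φ := φ) hP hI (toExp (k + k) q.2)
  obtain ⟨a, b, ha, hb, hb0, hab⟩ := (RatBound.defectSeries φ P I).exists_slice_quotient
    (toExp (k + k) q.2)
  -- A vector in the box has 2k entries of size at most the degree bound, which limits its degree
  -- and hence the degrees of the quotient for its slice.
  have hle : ((toExp (k + k) q.2).degree + 1) * defectBound k φ.code P.code I.code
      ≤ sliceBound q.1 := by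
    have := toExp_degree_le hbox
    rw [sliceBound, hB, show q.1.1 = k by rw [hq]]
    rw [hB] at this
    exact Nat.mul_le_mul_right _ (by omega)
  rw [← hd] at hS ⊢
  refine hasSum_zero_iff_padeTest hl hS (ha.trans hle) (hb.trans hle) hb0 ?_
  rw [hd, ← hab]
  congr 1
  ext n
  rw [PowerSeries.coeff_mk]

end Decision

/-- There is one algorithm which, given the number `k` of program variables and (the codes of) a
loop `L = while (φ) {P}` and a program `I`, decides whether `⟦L⟧ = ⟦I⟧` whenever `L` is universally
almost-surely terminating and `P` and `I` are loop-free. -/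
theorem mainTheorem1 :
    ∃ dec : ℕ × ℕ × ℕ → Bool, Computable dec ∧
      ∀ (k : ℕ) (φ : Guard k) (P I : Prog k),
        P.LoopFree → I.LoopFree → (Prog.loop φ P).UAST →
          (dec (k, (Prog.loop φ P).code, I.code) = true ↔ (Prog.loop φ P).sem = I.sem) := by
  obtain ⟨t, ht, ht'⟩ := exists_computable_sliceTest
  have hbox : Primrec fun x : ℕ × ℕ × ℕ => boxes (inputBound x) (x.1 + x.1) := by
    have := primrec_inputBound
    fun_prop
  -- The algorithm runs the slice test on every exponent vector of a computable finite box. The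
  -- empty list is only the default for list access.
  obtain ⟨dec, hdec, hdec'⟩ := Computable.forall_mem_list ([] : List ℕ) hbox.to_comp ht
  refine ⟨dec, hdec, fun k φ P I hP hI hL => ?_⟩
  have hB : inputBound (k, (Prog.loop φ P).code, I.code) = defectBound k φ.code P.code I.code := by
    rw [inputBound, Prog.code, Nat.unpair_pair, Nat.unpair_pair]
  have key : ∀ l ∈ boxes (defectBound k φ.code P.code I.code) (k + k),
      (t ((k, (Prog.loop φ P).code, I.code), l) = true ↔ HasSum (fun ζ => PowerSeries.coeff ζ
        (slice (toExp (k + k) l) (defectSeries φ P I))) 0) := by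
    intro l hl
    obtain ⟨c, hc, hc'⟩ := ht' ((k, (Prog.loop φ P).code, I.code), l)
    rw [hc']
    exact (hasSum_slice_iff hP hI rfl (by rw [hB]; exact hl) hc).symm
  rw [hdec', sem_loop_eq_iff_forall_slice hP hI hL, hB]
  constructor
  · intro h α hα
    have hmem : List.ofFn α ∈ boxes (defectBound k φ.code P.code I.code) (k + k) := by
      rw [mem_boxes, List.length_ofFn]
      refine ⟨rfl, fun i hi => ?_⟩
      obtain ⟨j, rfl⟩ := List.mem_ofFn.1 hi
      exact hα j
    have := (key _ hmem).1 (h _ hmem)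
    rwa [toExp_ofFn] at this
  · intro h l hl
    refine (key l hl).2 (h _ fun i => ?_)
    obtain ⟨h1, h2⟩ := (mem_boxes _ _ l).1 hl
    rw [toExp_apply, List.getD_eq_getElem _ _ (by rw [h1]; exact i.2)]
    exact h2 _ (List.getElem_mem _)
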